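/- **Setting.** Let $\mathcal T\subset\mathbb R^2$ be a compact convex set with non-empty interior, and let $\gamma$ be the counter-clockwise (ccw) arc-length parametrization of its perimeter $\partial\mathcal T$, of length $L$ and extended $L$-periodically (corners are allowed). Put $[a\to b]=(b-a)\bmod L\in[0,L)$. Let $0<\nu\le 1$. *Players.* Two defenders move on the perimeter, $\dot s_k=\omega_k$ with $\omega_k$ measurable and $|\omega_k|\le1$; an intruder moves in the plane, $\dot x=u$ with $u$ measurable and $\|u\|\le\nu$. *Breaching points.* For $x\notin\operatorname{int}\mathcal T$ let $\mathcal S_d(x)$ be the set of perimeter points $s$ such that the segment from $x$ to $\gamma(s)$ meets $\mathcal T$ only in $\gamma(s)$. Put $$J_L(s;s_D,x)=[s_D\to s]-\tfrac1\nu\|\gamma(s)-x\|,\qquad J_R(s;s_D,x)=[s\to s_D]-\tfrac1\nu\|\gamma(s)-x\| .$$ For $s_D\notin\mathcal S_d(x)$, the maximizers over $s\in\mathcal S_d(x)$ of $J_L$ and of $J_R$ do not depend on $s_D$; they are called $s_L(x)$ and $s_R(x)$. For arbitrary $s_D$ let $J_L^*(s_D,x)=J_L(s_L(x);s_D,x)$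 and $J_R^*(s_D,x)=J_R(s_R(x);s_D,x)$. *Afferent surface and capture.* $\Gamma_{\rm aff}(s_D)$ is the set of $x\notin\operatorname{int}\mathcal T$ with $J_L^*(s_D,x)=J_R^*(s_D,x)$ and with $s_D$ on the ccw arc from $s_R(x)$ to $s_L(x)$. Every $x\notin\operatorname{int}\mathcal T$ lies on $\Gamma_{\rm aff}(\sigma)$ for exactly one perimeter point $\sigma=\sigma(x)$, its foot. The game ends when $x\in\Gamma_{\rm aff}(s_1)\cup\Gamma_{\rm aff}(s_2)$ (capture), or when the intruder reaches $\mathcal T$ without being captured (breach). *Roles and regions.* The two afferent surfaces divide the game space into two parts. In the part that contains the intruder, $D_i$ is the defender on the clockwise side and $D_j$ the one on the ccw side; that is, $\sigma(x)$ lies strictly between $s_i$ and $s_j$ on the ccw arc from $s_i$ to $s_j$. Let $g\in(0,L]$ be the length of this arc ($g=L$ if the defenders coincide), $s_{\rm mid}=s_i+g/2$, and $J_{\rm mid}=\frac g2-\frac1\nu\|\gamma(s_{\rm mid})-x\|$. Define - $\mathcal R_i$: $[s_i\to\sigma(x)]\le[s_i\to s_L(x)]<\frac g2$; - $\mathcal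 R_j$: $[\sigma(x)\to s_j]\le[s_R(x)\to s_j]<\frac g2$; - $(s_{\rm opt},V_{ij})=(s_L,\ J_L^*(s_i,x))$ on $\mathcal R_i$, $\ (s_R,\ J_R^*(s_j,x))$ on $\mathcal R_j$, $\ (s_{\rm mid},\ J_{\rm mid})$ otherwise. The cooperative intruder-winning region is the set of states with $V_{ij}>0$. The intruder's feedback strategy is $u^*=\nu\,\dfrac{\gamma(s_{\rm opt})-x}{\|\gamma(s_{\rm opt})-x\|}$, where at every instant the roles and $s_{\rm opt}$ are taken from the current state. A *feedback response* to a control $\omega=(\omega_i,\omega_j)$ is an admissible intruder control that equals $u^*$ at almost all times before the game ends. The pincer maneuver is $\omega^*=[1,-1]$. *Payoff.* $P_1=\min\{[s_i\to s_B],[s_B\to s_j]\}$ at the time of a breach, where $\gamma(s_B)$ is the point of breach and $i,j$ are the roles at that time; $P_1=0$ if no breach occurs. The intruder maximizes $P_1$ and the defenders minimize it. **Theorem.** Suppose that the initial state $(s_i,s_j,x_A)$ has $x_A\notin\operatorname{int}\mathcal T$, that $D_i$ and $D_j$ have the roles just described, and that $V_{ij}=V_{ij}(s_i,s_j,x_A)>0$.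 Then the intruder strategy $u^*$ and the pincer maneuver $\omega^*$ form an equilibrium, and the value of the game is $V_{ij}$: 1. For every admissible $u$, $P_1(\omega^*,u)\le V_{ij}$. 2. For every admissible $\omega$ a feedback response exists, and every feedback response yields $P_1\ge V_{ij}$; the only possible exception is that $\nu=1$, $\mathcal T$ is not strongly convex, and the game goes on forever (neither capture nor breach). Here $\mathcal T$ is strongly convex if for some $c>0$ and all $p,q\in\mathcal T$ the closed disk of radius $c\|p-q\|^2$ about $\frac{p+q}2$ is contained in $\mathcal T$. 3. Every feedback response to $\omega^*$ yields $P_1=V_{ij}$. 4. $V_{ij}=\max_\alpha\inf_\omega P_1(\omega,\alpha(\omega))=\min_\beta\sup_u P_1(\beta(u),u)$, where $\alpha$ and $\beta$ range over the non-anticipative strategies of the intruder and of the defender team, and both the maximum and the minimum are attained. -/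

import Mathlib

open MeasureTheory Set

noncomputable section

namespace PerimeterDefense

/-- The plane with its Euclidean norm. -/
abbrev Plane := EuclideanSpace ℝ (Fin 2)

/-- A convex target in the plane together with an arc-length parametrization of its perimeter,
traversed counter-clockwise.  The parametrization is extended periodically to all of `ℝ`, so that a
real number names a perimeter point and numbers that differ by a multiple of `L` name the same
point.  Corners are allowed. -/
structure Target where
  region : Set Plane
  isCompact_region : IsCompact region
  convex_region : Convex ℝ region
  interior_nonempty : (interior region).Nonempty
  /-- length of the perimeter -/
  L : ℝ
  L_pos : 0 < L
  /-- the perimeter curve -/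
  γ : ℝ → Plane
  periodic_γ : Function.Periodic γ L
  injOn_γ : InjOn γ (Ico 0 L)
  range_γ : range γ = frontier region
  unitSpeed_γ : HasUnitSpeedOn γ univ
  /-- the region lies to the left of the tangent vector -/
  ccw_γ : ∀ (s : ℝ) (v : Plane), HasDerivAt γ v s → ∀ y ∈ region,
    0 ≤ v 0 * (y 1 - γ s 1) - v 1 * (y 0 - γ s 0)

variable (P : Target) (ν : ℝ)

/-- Counter-clockwise arc length from `a` to `b`: `(b - a) mod L`, in `[0, L)`. -/
def arc (a b : ℝ) : ℝ := toIcoMod P.L_pos 0 (b - a)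

/-- Counter-clockwise arc length of the gap from one defender to the next one.  It is
`(b - a) mod L`, except that the gap from a point all the way round to the same point is `L`. -/
def gap (a b : ℝ) : ℝ := toIocMod P.L_pos 0 (b - a)

/-- The perimeter points that can be reached from `x` along a straight line that meets the target
only at its end. -/
def visible (x : Plane) : Set ℝ := {s | segment ℝ x (P.γ s) ∩ P.region = {P.γ s}}

/-- `J_L(s_B; s_D, x)`: time margin at `s_B` if the defender moves counter-clockwise. -/
def JL (sB sD : ℝ) (x : Plane) : ℝ := arc P sD sB - dist (P.γ sB) x / ν

/-- `J_R(s_B; s_D, x)`: time margin at `s_B` if the defender moves clockwise. -/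
def JR (sB sD : ℝ) (x : Plane) : ℝ := arc P sB sD - dist (P.γ sB) x / ν

/-- `s` maximizes `J_L` over the visible perimeter points, the defender being at a point that is not
visible from `x`. -/
def IsLeftBreachingPoint (x : Plane) (s : ℝ) : Prop :=
  s ∈ visible P x ∧ ∀ sD, sD ∉ visible P x → ∀ s' ∈ visible P x, JL P ν s' sD x ≤ JL P ν s sD x

/-- The same for `J_R`. -/
def IsRightBreachingPoint (x : Plane) (s : ℝ) : Prop :=
  s ∈ visible P x ∧ ∀ sD, sD ∉ visible P x → ∀ s' ∈ visible P x, JR P ν s' sD x ≤ JR P ν s sD x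

/-- The left breaching point `s_L(x)`. -/
def sL (x : Plane) : ℝ := Classical.epsilon (IsLeftBreachingPoint P ν x)

/-- The right breaching point `s_R(x)`. -/
def sR (x : Plane) : ℝ := Classical.epsilon (IsRightBreachingPoint P ν x)

/-- `J_L^*(s_D, x)`. -/
def JLstar (sD : ℝ) (x : Plane) : ℝ := JL P ν (sL P ν x) sD x

/-- `J_R^*(s_D, x)`. -/
def JRstar (sD : ℝ) (x : Plane) : ℝ := JR P ν (sR P ν x) sD x

/-- The afferent surface of a defender at `sD`: the part of the surface `J_L^* = J_R^*` that extends
from the defender, that is, on which the defender lies on the arc from `s_R(x)` to `s_L(x)`.  (On the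
other part, the dispersal surface, the defender is outside that arc.) -/
def afferent (sD : ℝ) : Set Plane :=
  {x | x ∉ interior P.region ∧ arc P (sR P ν x) sD ≤ arc P (sR P ν x) (sL P ν x) ∧
    JLstar P ν sD x = JRstar P ν sD x}

/-- The perimeter point from which the afferent surface through `x` extends. -/
def foot (x : Plane) : ℝ := Classical.epsilon fun s => x ∈ afferent P ν s

/-- The afferent surfaces of two defenders divide the game space into two parts.  This is the part
with `si` on its clockwise side and `sj` on its counter-clockwise side: it consists of the afferent
surfaces that extend from the perimeter points strictly between `si` and `sj`. -/
def part (si sj : ℝ) : Set Plane :=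
  {x | x ∉ interior P.region ∧ 0 < arc P si (foot P ν x) ∧ arc P si (foot P ν x) < gap P si sj}

/-- The midpoint of the perimeter arc from `si` counter-clockwise to `sj`. -/
def sMid (si sj : ℝ) : ℝ := si + gap P si sj / 2

/-- `J_mid`. -/
def Jmid (si sj : ℝ) (x : Plane) : ℝ := gap P si sj / 2 - dist (P.γ (sMid P si sj)) x / ν

/-- `s_L ∈ [s_i, s_mid)`, within the part of the game space that contains `x`: going
counter-clockwise from `si` one meets the foot of `x`, then `s_L(x)`, and then the midpoint. -/
def regionI (si sj : ℝ) : Set Plane :=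
  {x | arc P si (foot P ν x) ≤ arc P si (sL P ν x) ∧ arc P si (sL P ν x) < arc P si (sMid P si sj)}

/-- `s_R ∈ (s_mid, s_j]`, within the part of the game space that contains `x`: going clockwise from
`sj` one meets the foot of `x`, then `s_R(x)`, and then the midpoint. -/
def regionJ (si sj : ℝ) : Set Plane :=
  {x | arc P (foot P ν x) sj ≤ arc P (sR P ν x) sj ∧ arc P (sR P ν x) sj < arc P (sMid P si sj) sj}

open Classical in
/-- The breaching point `s_opt` chosen by the intruder. -/
def sOpt (si sj : ℝ) (x : Plane) : ℝ :=
  if x ∈ regionI P ν si sj then sL P ν x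
  else if x ∈ regionJ P ν si sj then sR P ν x
  else sMid P si sj

open Classical in
/-- The function `V_ij`. -/
def Vij (si sj : ℝ) (x : Plane) : ℝ :=
  if x ∈ regionI P ν si sj then JLstar P ν si x
  else if x ∈ regionJ P ν si sj then JRstar P ν sj x
  else Jmid P ν si sj x

/-- The cooperative intruder-winning region. -/
def intruderWinning (si sj : ℝ) : Set Plane := {x | x ∈ part P ν si sj ∧ 0 < Vij P ν si sj x}

open Classical in
/-- The intruder's feedback strategy, for two defenders at `s₁` and `s₂`: the current state decides
which defender is on the clockwise side of the intruder, and the intruder moves at full speed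
towards `s_opt`. -/
def intruderFeedback (s₁ s₂ : ℝ) (x : Plane) : Plane :=
  let B := if x ∈ part P ν s₁ s₂ then sOpt P ν s₁ s₂ x else sOpt P ν s₂ s₁ x
  (ν / ‖P.γ B - x‖) • (P.γ B - x)

/-- Admissible controls of a defender team: two measurable signed speeds of modulus at most `1`. -/
def DefenderControl : Type :=
  {ω : (ℝ → ℝ) × (ℝ → ℝ) //
    (Measurable ω.1 ∧ ∀ t, |ω.1 t| ≤ 1) ∧ (Measurable ω.2 ∧ ∀ t, |ω.2 t| ≤ 1)}

/-- Admissible controls of the intruder: measurable velocities of norm at most `ν`. -/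
def IntruderControl : Type := {u : ℝ → Plane // Measurable u ∧ ∀ t, ‖u t‖ ≤ ν}

/-- The pincer maneuver `[1, -1]`. -/
def pincer : DefenderControl :=
  ⟨(fun _ => 1, fun _ => -1), ⟨measurable_const, fun _ => by norm_num⟩,
    ⟨measurable_const, fun _ => by norm_num⟩⟩

/-- Position at time `t` of a player that starts at `a` and has velocity `v`. -/
def position {E : Type*} [NormedAddCommGroup E] [NormedSpace ℝ E] (a : E) (v : ℝ → E) (t : ℝ) : E :=
  a + ∫ τ in (0 : ℝ)..t, v τ

/-- The intruder is captured if it is on the afferent surface of a defender.  This includes the case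
that it is at the position of a defender. -/
def Captured (s₁ s₂ : ℝ) (x : Plane) : Prop := x ∈ afferent P ν s₁ ∨ x ∈ afferent P ν s₂

/-- The terminal condition of the game. -/
def Terminal (s₁ s₂ : ℝ) (x : Plane) : Prop := x ∈ P.region ∨ Captured P ν s₁ s₂ x

/-- Along the motions `s₁`, `s₂`, `x` the game has not ended up to and including time `t`. -/
def RunningAt (s₁ s₂ : ℝ → ℝ) (x : ℝ → Plane) (t : ℝ) : Prop :=
  ∀ τ ∈ Icc 0 t, ¬ Terminal P ν (s₁ τ) (s₂ τ) (x τ)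

/-- Along the motions `s₁`, `s₂`, `x` the game ends at time `t` by a breach of the perimeter. -/
def BreachAt (s₁ s₂ : ℝ → ℝ) (x : ℝ → Plane) (t : ℝ) : Prop :=
  0 ≤ t ∧ (∀ τ ∈ Ico 0 t, ¬ Terminal P ν (s₁ τ) (s₂ τ) (x τ)) ∧
    x t ∈ P.region ∧ ¬ Captured P ν (s₁ t) (s₂ t) (x t)

open Classical in
/-- The safe distance `min (arc D_i B) (arc B D_j)` for an intruder at the perimeter point
`x = γ B`, where `D_i` is the defender on its clockwise side and `D_j` the other one. -/
def safeDistance (s₁ s₂ : ℝ) (x : Plane) : ℝ :=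
  let B := Classical.epsilon fun s => P.γ s = x
  if x ∈ part P ν s₁ s₂ then min (arc P s₁ B) (arc P B s₂) else min (arc P s₂ B) (arc P B s₁)

open Classical in
/-- The payoff of a pair of motions: the safe distance at the time of the breach, and `0` if the
intruder never breaches the perimeter. -/
def motionPayoff (s₁ s₂ : ℝ → ℝ) (x : ℝ → Plane) : ℝ :=
  if h : ∃ t, BreachAt P ν s₁ s₂ x t then
    safeDistance P ν (s₁ h.choose) (s₂ h.choose) (x h.choose)
  else 0

/-- The payoff `P₁` of a pair of controls, for the initial state `(a₁, a₂, x₀)`. -/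
def payoff (a₁ a₂ : ℝ) (x₀ : Plane) (ω : DefenderControl) (u : IntruderControl ν) : ℝ :=
  motionPayoff P ν (position a₁ ω.1.1) (position a₂ ω.1.2) (position x₀ u.1)

/-- The game goes on forever under a pair of controls. -/
def NeverEnds (a₁ a₂ : ℝ) (x₀ : Plane) (ω : DefenderControl) (u : IntruderControl ν) : Prop :=
  ∀ t, 0 ≤ t → RunningAt P ν (position a₁ ω.1.1) (position a₂ ω.1.2) (position x₀ u.1) t

/-- The control `u` results from the intruder's feedback strategy when the defenders use `ω`: at
almost every time before the end of the game the intruder's velocity is the one that the strategy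
prescribes in the current state. -/
def IsFeedbackResponse (a₁ a₂ : ℝ) (x₀ : Plane) (ω : DefenderControl) (u : IntruderControl ν) :
    Prop :=
  ∀ᵐ t ∂(volume : Measure ℝ), 0 ≤ t →
    RunningAt P ν (position a₁ ω.1.1) (position a₂ ω.1.2) (position x₀ u.1) t →
    u.1 t = intruderFeedback P ν (position a₁ ω.1.1 t) (position a₂ ω.1.2 t) (position x₀ u.1 t)

/-- A non-anticipative strategy of the intruder: its control up to time `t` depends only on the
defenders' controls up to time `t`. -/
def IntruderStrategy : Type :=
  {α : DefenderControl → IntruderControl ν // ∀ (ω ω' : DefenderControl) (t : ℝ),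
    ω.1.1 =ᵐ[volume.restrict (Icc 0 t)] ω'.1.1 → ω.1.2 =ᵐ[volume.restrict (Icc 0 t)] ω'.1.2 →
    (α ω).1 =ᵐ[volume.restrict (Icc 0 t)] (α ω').1}

/-- A non-anticipative strategy of the defender team. -/
def DefenderStrategy : Type :=
  {β : IntruderControl ν → DefenderControl // ∀ (u u' : IntruderControl ν) (t : ℝ),
    u.1 =ᵐ[volume.restrict (Icc 0 t)] u'.1 →
    (β u).1.1 =ᵐ[volume.restrict (Icc 0 t)] (β u').1.1 ∧
    (β u).1.2 =ᵐ[volume.restrict (Icc 0 t)] (β u').1.2}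

/-- `V` is the value of the game that starts in `(a₁, a₂, x₀)`: it is the largest payoff that the
intruder can guarantee (`max min`) and the smallest bound on the payoff that the defenders can
guarantee (`min max`). -/
def IsGameValue (a₁ a₂ : ℝ) (x₀ : Plane) (V : ℝ) : Prop :=
  IsGreatest {c | ∃ α : IntruderStrategy ν, ∀ ω, c ≤ payoff P ν a₁ a₂ x₀ ω (α.1 ω)} V ∧
  IsLeast {c | ∃ β : DefenderStrategy ν, ∀ u, payoff P ν a₁ a₂ x₀ (β.1 u) u ≤ c} V

/-- Strong convexity of a planar set, for example of a disk, or of a convex region whose boundary is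
`C²` with positive curvature. -/
def StronglyConvexSet (S : Set Plane) : Prop :=
  ∃ c : ℝ, 0 < c ∧ ∀ x ∈ S, ∀ y ∈ S, Metric.closedBall (midpoint ℝ x y) (c * dist x y ^ 2) ⊆ S

end PerimeterDefense

end

/-! Everything rests on one function of the state, the `margin`: the maximum, over the perimeter
points `s` visible from `x`, of the perimeter distance from `s` to the nearest defender minus `‖γ s
- x‖ / ν`. Where `V_ij` is positive it equals the margin (`margin_eq_Vij`), the feedback strategy
heads for the maximizer (`Frame.sOpt_spec`), a positive margin excludes capture
(`not_captured_of_margin_pos`), and at a breach the margin is the safe distance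
(`safeDistance_eq_margin`). It remains to show that `u*` never lets the margin decrease and that
against the pincer no breach occurs with a margin above the initial one.

Geometry. The metric projection onto the target is nonexpansive, so a path outside the target is at
least as long as the arc swept by its projection. If a perimeter point is no longer visible after
the intruder has moved, one may head for the last visible point of that projection and go on along
the perimeter without a longer way (`reach_of_path`). As perimeter distance is 1-Lipschitz and `ν ≤
1`, a displacement `d` changes the margin by at most `d / ν`. Heading straight for the maximizer
attains this rate (`IsOpt.forward`), so at speed `ν` the intruder gains one unit per unit of time,
while the defenders can take away at most one. Distance is strictly convex in arc length on the
visible part (`Chart.exists_slope`); hence the breaching points are unique and can be compared with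
the maximizer.

Pincer. The foot of `x` moves with speed at most one, so an intruder that is not captured stays
between the closing defenders. Between them the clearance is a tent function, which falls by exactly
`t` in time `t`; this outweighs the most that the intruder can gain.

Existence of feedback responses. Receding from the maximizer costs the full rate `1 / ν` too
(`IsOpt.backward`). A Lipschitz function that attains its slope on segments to both sides of two
points has nearly equal directions there (`norm_sub_sq_le_of_slope`). So `u*` is locally Lipschitz
in the state and continuous in time, and the solutions for cut-off fields can be glued.

Arrival. Let `κ` be the cosine of the angle between the directions to `s_L` and `s_R`. The feedback
strategy decreases the nonnegative `spread` at least at the rate `1 + κ`. If `ν < 1` this is at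
least `2 (1 - ν)`; if `ν = 1` and the target is strongly convex, the rate is positive and dominates
a multiple of `spread ^ (2 / 3)`. Either way the spread would become negative in finite time unless
the target is reached first. Since a straight motion to the initial maximizer already secures the
margin against all defender controls, constant strategies settle the value of the game. -/

namespace PerimeterDefense

open Filter Topology RealInnerProductSpace

/-! ### The perimeter curve -/

section Curve

variable (P : Target)

lemma lipschitz_γ (s t : ℝ) : dist (P.γ s) (P.γ t) ≤ |s - t| := by
  wlog hst : s ≤ t generalizing s t
  · rw [dist_comm, abs_sub_comm]
    exact this t s (le_of_not_ge hst)
  have h1 : edist (P.γ s) (P.γ t) ≤ eVariationOn P.γ (univ ∩ Icc s t) :=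
    eVariationOn.edist_le _ ⟨mem_univ _, left_mem_Icc.2 hst⟩ ⟨mem_univ _, right_mem_Icc.2 hst⟩
  have h2 := P.unitSpeed_γ (mem_univ s) (mem_univ t)
  rw [h2, edist_dist] at h1
  have h3 : (0 : ℝ) ≤ (1 : NNReal) * (t - s) := by
    simp only [NNReal.coe_one, one_mul]; linarith
  have := (ENNReal.ofReal_le_ofReal_iff h3).1 h1
  rw [abs_sub_comm, abs_of_nonneg (by linarith)]
  simpa using this

lemma continuous_γ : Continuous P.γ :=
  (LipschitzWith.of_dist_le_mul (K := 1) fun s t => by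
    simpa [Real.dist_eq] using lipschitz_γ P s t).continuous

lemma γ_add_int (s : ℝ) (k : ℤ) : P.γ (s + k * P.L) = P.γ s := P.periodic_γ.int_mul k s

lemma exists_int_add_mem_Ico (a s : ℝ) : ∃ k : ℤ, s + k * P.L ∈ Ico a (a + P.L) := by
  obtain ⟨k, hk, -⟩ := existsUnique_add_zsmul_mem_Ico P.L_pos s a
  exact ⟨k, by simpa using hk⟩

lemma γ_eq_iff (s t : ℝ) : P.γ s = P.γ t ↔ ∃ k : ℤ, t = s + k * P.L := by
  constructor
  · intro h
    obtain ⟨k, hk⟩ := exists_int_add_mem_Ico P 0 s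
    obtain ⟨l, hl⟩ := exists_int_add_mem_Ico P 0 t
    rw [zero_add] at hk hl
    have := P.injOn_γ hk hl (by rw [γ_add_int, γ_add_int, h])
    exact ⟨k - l, by push_cast; linarith⟩
  · rintro ⟨k, rfl⟩
    exact (γ_add_int P s k).symm

lemma eq_of_γ_eq {s t : ℝ} (h : P.γ s = P.γ t) (hst : |s - t| < P.L) : s = t := by
  obtain ⟨k, rfl⟩ := (γ_eq_iff P s t).1 h
  have hL := P.L_pos
  rcases lt_trichotomy k 0 with hk | hk | hk
  · have : (k : ℝ) ≤ -1 := by exact_mod_cast Int.le_sub_one_of_lt hk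
    rw [abs_lt] at hst
    nlinarith [hst.1, hst.2]
  · simp [hk]
  · have : (1 : ℝ) ≤ k := by exact_mod_cast hk
    rw [abs_lt] at hst
    nlinarith [hst.1, hst.2]

lemma γ_mem_frontier (s : ℝ) : P.γ s ∈ frontier P.region := by
  rw [← P.range_γ]; exact mem_range_self s

lemma frontier_subset_region : frontier P.region ⊆ P.region :=
  P.isCompact_region.isClosed.frontier_subset

lemma γ_mem (s : ℝ) : P.γ s ∈ P.region := frontier_subset_region P (γ_mem_frontier P s)

lemma exists_γ_eq {q : Plane} (hq : q ∈ frontier P.region) : ∃ s, P.γ s = q := by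
  rwa [← P.range_γ] at hq

lemma mem_frontier_iff {q : Plane} :
    q ∈ frontier P.region ↔ q ∈ P.region ∧ q ∉ interior P.region := by
  rw [frontier, P.isCompact_region.isClosed.closure_eq]; rfl

/-- A reparametrized piece of the perimeter is at least as long as the parameter interval. -/
lemma abs_sub_le_of_lipschitz {g : ℝ → ℝ} {t₀ t₁ K : ℝ} (h : t₀ ≤ t₁) (hK : 0 ≤ K)
    (hg : ContinuousOn g (Icc t₀ t₁))
    (hlip : ∀ t ∈ Icc t₀ t₁, ∀ t' ∈ Icc t₀ t₁,
      dist (P.γ (g t)) (P.γ (g t')) ≤ K * |t - t'|) :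
    |g t₁ - g t₀| ≤ K * (t₁ - t₀) := by
  wlog hle : g t₀ ≤ g t₁ generalizing g
  · have hm : ∀ t ∈ Icc t₀ t₁, t₀ + t₁ - t ∈ Icc t₀ t₁ := fun t ht =>
      ⟨by linarith [ht.2], by linarith [ht.1]⟩
    have := this (g := fun t => g (t₀ + t₁ - t))
      (hg.comp (by fun_prop) hm)
      (fun t ht t' ht' => by
        have := hlip _ (hm t ht) _ (hm t' ht')
        rwa [show t₀ + t₁ - t - (t₀ + t₁ - t') = -(t - t') by ring, abs_neg] at this)
      (by
        simp only [add_sub_cancel_left, add_sub_cancel_right]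
        exact le_of_not_ge hle)
    simp only [add_sub_cancel_left, add_sub_cancel_right] at this
    rwa [abs_sub_comm]
  -- `τ s` is the first time at which `g` reaches the level `s`. It is monotone and `g (τ s) = s`,
  -- so the variation of `γ` over the parameter interval, which is its length, is at most that of `γ
  -- ∘ g`.
  have key : ∀ s : ℝ, ∃ τ : ℝ, s ∈ Icc (g t₀) (g t₁) →
      IsLeast {t | t ∈ Icc t₀ t₁ ∧ s ≤ g t} τ := by
    intro s
    by_cases hs : s ∈ Icc (g t₀) (g t₁)
    · have hc : IsCompact {t | t ∈ Icc t₀ t₁ ∧ s ≤ g t} := by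
        have : {t | t ∈ Icc t₀ t₁ ∧ s ≤ g t} = Icc t₀ t₁ ∩ g ⁻¹' Ici s := rfl
        rw [this]
        exact isCompact_Icc.of_isClosed_subset
          (hg.preimage_isClosed_of_isClosed isClosed_Icc isClosed_Ici) inter_subset_left
      obtain ⟨τ, hτ⟩ := hc.exists_isLeast ⟨t₁, right_mem_Icc.2 h, hs.2⟩
      exact ⟨τ, fun _ => hτ⟩
    · exact ⟨0, fun h' => absurd h' hs⟩
  choose τ hτ using key
  have hτmem : ∀ s ∈ Icc (g t₀) (g t₁), τ s ∈ Icc t₀ t₁ := fun s hs => (hτ s hs).1.1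
  have hgτ : ∀ s ∈ Icc (g t₀) (g t₁), g (τ s) = s := by
    intro s hs
    refine le_antisymm ?_ (hτ s hs).1.2
    by_contra hlt
    push Not at hlt
    have hsub : Icc t₀ (τ s) ⊆ Icc t₀ t₁ := Icc_subset_Icc_right (hτmem s hs).2
    obtain ⟨r, hr, hgr⟩ := intermediate_value_Icc (hτmem s hs).1 (hg.mono hsub) ⟨hs.1, hlt.le⟩
    have h1 := (hτ s hs).2 ⟨hsub hr, hgr.ge⟩
    have : r = τ s := le_antisymm hr.2 h1
    rw [this] at hgr
    exact absurd hgr hlt.ne'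
  have hmono : MonotoneOn τ (Icc (g t₀) (g t₁)) := by
    intro s hs s' hs' hss
    exact (hτ s hs).2 ⟨hτmem s' hs', hss.trans (hτ s' hs').1.2⟩
  have hv1 : eVariationOn P.γ (Icc (g t₀) (g t₁)) = ENNReal.ofReal (g t₁ - g t₀) := by
    have := P.unitSpeed_γ (mem_univ (g t₀)) (mem_univ (g t₁))
    simpa using this
  have hv2 : eVariationOn P.γ (Icc (g t₀) (g t₁)) ≤
      eVariationOn (P.γ ∘ g) (Icc t₀ t₁) := by
    have h1 := eVariationOn.comp_le_of_monotoneOn (P.γ ∘ g) τ hmono hτmem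
    refine le_trans (le_of_eq (eVariationOn.congr ?_)) h1
    intro s hs
    simp [hgτ s hs]
  have hv3 : eVariationOn (P.γ ∘ g) (Icc t₀ t₁) ≤ ENNReal.ofReal (K * (t₁ - t₀)) := by
    have hL : LipschitzOnWith K.toNNReal (P.γ ∘ g) (Icc t₀ t₁) :=
      LipschitzOnWith.of_dist_le_mul fun t ht t' ht' => by
        rw [Real.coe_toNNReal K hK]
        exact hlip t ht t' ht'
    have h1 := hL.comp_eVariationOn_le (g := id) (s := Icc t₀ t₁) (fun _ h => h)
    have h2 : eVariationOn (id : ℝ → ℝ) (Icc t₀ t₁) = ENNReal.ofReal (t₁ - t₀) := by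
      simp
    rw [h2] at h1
    rw [ENNReal.ofReal_mul hK]
    exact h1
  rw [hv1] at hv2
  have := (ENNReal.ofReal_le_ofReal_iff (mul_nonneg hK (by linarith))).1 (hv2.trans hv3)
  rwa [abs_of_nonneg (by linarith)]

/-! ### The perimeter as a circle -/

/-- The perimeter curve as a function on the circle of length `L`. -/
def circleγ : AddCircle P.L → Plane := P.periodic_γ.lift

lemma circleγ_coe (s : ℝ) : circleγ P (s : AddCircle P.L) = P.γ s := P.periodic_γ.lift_coe s

lemma continuous_circleγ : Continuous (circleγ P) := by
  refine (QuotientAddGroup.isQuotientMap_mk (N := AddSubgroup.zmultiples P.L)).continuous_iff.2 ?_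
  exact continuous_γ P

lemma coe_eq_coe_iff {p : ℝ} (s t : ℝ) :
    (s : AddCircle p) = (t : AddCircle p) ↔ ∃ k : ℤ, t = s + k * p := by
  rw [QuotientAddGroup.eq, AddSubgroup.mem_zmultiples_iff]
  refine exists_congr fun k => ?_
  rw [zsmul_eq_mul]
  constructor <;> intro h <;> linarith

lemma circleγ_injective : Function.Injective (circleγ P) := by
  intro z w h
  induction z using QuotientAddGroup.induction_on with | _ s
  induction w using QuotientAddGroup.induction_on with | _ t
  rw [circleγ_coe, circleγ_coe, γ_eq_iff] at h
  exact (coe_eq_coe_iff s t).2 h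

lemma range_circleγ : range (circleγ P) = frontier P.region := by
  rw [← P.range_γ]
  ext q
  constructor
  · rintro ⟨z, rfl⟩
    induction z using QuotientAddGroup.induction_on with | _ s
    exact ⟨s, (circleγ_coe P s).symm⟩
  · rintro ⟨s, rfl⟩
    exact ⟨s, circleγ_coe P s⟩

instance : Fact (0 < P.L) := ⟨P.L_pos⟩

/-- A continuous motion on the perimeter lifts to a continuous motion of the parameter. -/
lemma exists_lift {Y : ℝ → Plane} {T : ℝ} (hT : 0 ≤ T) (hY : ContinuousOn Y (Icc 0 T))
    (hf : ∀ t ∈ Icc 0 T, Y t ∈ frontier P.region) (θ₀ : ℝ) (h0 : P.γ θ₀ = Y 0) :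
    ∃ θ : ℝ → ℝ, ContinuousOn θ (Icc 0 T) ∧ θ 0 = θ₀ ∧ ∀ t ∈ Icc 0 T, P.γ (θ t) = Y t := by
  rcases hT.eq_or_lt with rfl | hT
  · refine ⟨fun _ => θ₀, continuousOn_const, rfl, fun t ht => ?_⟩
    rw [Icc_self, mem_singleton_iff] at ht
    rw [ht, h0]
  let e : AddCircle P.L ≃ range (circleγ P) := Equiv.ofInjective _ (circleγ_injective P)
  have he : Continuous e := (continuous_circleγ P).subtype_mk _
  -- The perimeter is an embedded circle, so the motion is a path in the circle; the covering of the
  -- circle by the line lifts it.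
  let H : AddCircle P.L ≃ₜ range (circleγ P) := he.homeoOfEquivCompactToT2
  have hscale : ∀ r : unitInterval, (r : ℝ) * T ∈ Icc 0 T := fun r =>
    ⟨mul_nonneg r.2.1 hT.le, mul_le_of_le_one_left hT.le r.2.2⟩
  have hmem : ∀ r : unitInterval, Y (r * T) ∈ range (circleγ P) := fun r => by
    rw [range_circleγ]; exact hf _ (hscale r)
  let c : C(unitInterval, AddCircle P.L) :=
    ⟨fun r => H.symm ⟨Y (r * T), hmem r⟩, by
      refine H.symm.continuous.comp (Continuous.subtype_mk ?_ _)
      exact hY.comp_continuous (by fun_prop) hscale⟩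
  have hc : ∀ r, circleγ P (c r) = Y (r * T) := fun r => by
    have : H (c r) = ⟨Y (r * T), hmem r⟩ := H.apply_symm_apply _
    exact congrArg Subtype.val this
  obtain ⟨Γ, hΓ, hΓ0⟩ := (AddCircle.isCoveringMap_coe P.L).exists_path_lifts c θ₀ (by
    apply circleγ_injective P
    rw [hc]
    have := circleγ_coe P θ₀
    rw [show ((0 : unitInterval) : ℝ) = 0 from rfl, zero_mul, ← h0]
    exact this.symm)
  have hΓ' : ∀ r, P.γ (Γ r) = Y (r * T) := fun r => by
    rw [← hc, ← circleγ_coe]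
    exact congrArg _ (congrFun hΓ r)
  refine ⟨fun t => Γ (projIcc 0 1 zero_le_one (t / T)), ?_, ?_, ?_⟩
  · exact (Γ.continuous.comp (continuous_projIcc.comp (by fun_prop))).continuousOn
  · simp only [zero_div, projIcc_left]
    exact hΓ0
  · intro t ht
    have h1 : t / T ∈ Icc (0 : ℝ) 1 := ⟨div_nonneg ht.1 hT.le, (div_le_one hT).2 ht.2⟩
    simp only [projIcc_of_mem zero_le_one h1]
    rw [hΓ']
    simp [hT.ne']

end Curve

/-! ### Plane geometry -/

/-- The cross product of two plane vectors. -/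
def cr (u v : Plane) : ℝ := u 0 * v 1 - u 1 * v 0

lemma inner_eq (u v : Plane) : ⟪u, v⟫ = u 0 * v 0 + u 1 * v 1 := by
  simp [PiLp.inner_apply, Fin.sum_univ_two, mul_comm]

lemma norm_sq_eq (u : Plane) : ‖u‖ ^ 2 = u 0 ^ 2 + u 1 ^ 2 := by
  rw [EuclideanSpace.norm_sq_eq, Fin.sum_univ_two]; simp

lemma cr_sq_add_inner_sq (u v : Plane) : cr u v ^ 2 + ⟪u, v⟫ ^ 2 = ‖u‖ ^ 2 * ‖v‖ ^ 2 := by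
  rw [inner_eq, norm_sq_eq, norm_sq_eq, cr]; ring

lemma cr_add_right (u v w : Plane) : cr u (v + w) = cr u v + cr u w := by simp [cr]; ring
lemma cr_add_left (u v w : Plane) : cr (u + v) w = cr u w + cr v w := by simp [cr]; ring
lemma cr_sub_right (u v w : Plane) : cr u (v - w) = cr u v - cr u w := by simp [cr]; ring
lemma cr_smul_right (a : ℝ) (u v : Plane) : cr u (a • v) = a * cr u v := by simp [cr]; ring
lemma cr_smul_left (a : ℝ) (u v : Plane) : cr (a • u) v = a * cr u v := by simp [cr]; ring
lemma cr_self (u : Plane) : cr u u = 0 := by simp [cr]; ring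
lemma cr_comm (u v : Plane) : cr u v = -cr v u := by simp [cr]; ring
lemma continuous_cr : Continuous fun p : Plane × Plane => cr p.1 p.2 := by
  unfold cr; fun_prop

/-- A vector in the cone between two others is a nonnegative combination of them. -/
lemma cr_smul_decomp (u v w : Plane) : cr u w • v = cr v w • u + cr u v • w := by
  ext i; fin_cases i <;> simp [cr] <;> ring

lemma cr_mul_norm_sq (e u v : Plane) :
    ‖e‖ ^ 2 * cr u v = ⟪e, u⟫ * cr e v - cr e u * ⟪e, v⟫ := by
  rw [norm_sq_eq, inner_eq, inner_eq, cr, cr, cr]; ring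

/-- Quarter turn. -/
def rot (u : Plane) : Plane := !₂[-u 1, u 0]

lemma inner_rot (u v : Plane) : ⟪rot u, v⟫ = cr u v := by
  rw [inner_eq, cr, rot]; simp; ring

lemma norm_rot (u : Plane) : ‖rot u‖ = ‖u‖ := by
  rw [← sq_eq_sq₀ (norm_nonneg _) (norm_nonneg _), norm_sq_eq, norm_sq_eq]; simp [rot]; ring

/-! ### The metric projection onto the target -/

section Projection

variable (P : Target)

lemma region_nonempty : P.region.Nonempty := P.interior_nonempty.mono interior_subset

lemma exists_proj (z : Plane) :
    ∃ p ∈ P.region, ∀ y ∈ P.region, ⟪z - p, y - p⟫ ≤ 0 := by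
  obtain ⟨p, hp, h⟩ := exists_norm_eq_iInf_of_complete_convex (region_nonempty P)
    P.isCompact_region.isComplete P.convex_region z
  exact ⟨p, hp, (norm_eq_iInf_iff_real_inner_le_zero P.convex_region hp).1 h⟩

/-- The metric projection onto the target. -/
noncomputable def proj (z : Plane) : Plane := (exists_proj P z).choose

lemma proj_mem (z : Plane) : proj P z ∈ P.region := (exists_proj P z).choose_spec.1

lemma inner_proj_le (z : Plane) {y : Plane} (hy : y ∈ P.region) :
    ⟪z - proj P z, y - proj P z⟫ ≤ 0 := (exists_proj P z).choose_spec.2 y hy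

/-- Adding the variational inequalities of the two projections gives `‖d‖ ^ 2 ≤ ⟪z - w, d⟫` for
their difference `d`. This is the source of all comparisons between arcs and paths. -/
lemma dist_proj_le (z w : Plane) : dist (proj P z) (proj P w) ≤ dist z w := by
  rw [dist_eq_norm, dist_eq_norm]
  set d := proj P z - proj P w
  have h1 := inner_proj_le P z (proj_mem P w)
  have h2 := inner_proj_le P w (proj_mem P z)
  have h3 : ‖d‖ ^ 2 ≤ ⟪z - w, d⟫ := by
    have e1 : ⟪z - proj P z, proj P w - proj P z⟫ = -⟪z - proj P z, d⟫ := by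
      rw [← inner_neg_right]; simp [d]
    have e2 : ⟪z - w, d⟫ = ⟪z - proj P z, d⟫ - ⟪w - proj P w, d⟫ + ⟪d, d⟫ := by
      rw [← inner_sub_left, ← inner_add_left]; congr 1; simp only [d]; abel
    rw [e2, real_inner_self_eq_norm_sq]
    linarith
  have h4 := real_inner_le_norm (z - w) d
  by_contra h
  push Not at h
  have : 0 < ‖d‖ := (norm_nonneg _).trans_lt h
  nlinarith

lemma continuous_proj : Continuous (proj P) :=
  (LipschitzWith.of_dist_le_mul (K := 1) fun z w => by simpa using dist_proj_le P z w).continuous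

lemma proj_of_mem {z : Plane} (hz : z ∈ P.region) : proj P z = z := by
  have := inner_proj_le P z hz
  rw [real_inner_self_eq_norm_sq] at this
  have h : ‖z - proj P z‖ = 0 := by nlinarith [norm_nonneg (z - proj P z)]
  exact (sub_eq_zero.1 (norm_eq_zero.1 h)).symm

lemma proj_ne {z : Plane} (hz : z ∉ P.region) : z - proj P z ≠ 0 := fun h =>
  hz (sub_eq_zero.1 h ▸ proj_mem P z)

/-- A point of the region where a nonzero linear functional is maximal is not interior. -/
lemma not_mem_interior_of_inner_le {q n : Plane} (hn : n ≠ 0)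
    (h : ∀ y ∈ P.region, ⟪n, y - q⟫ ≤ 0) : q ∉ interior P.region := by
  intro hq
  have hc : Tendsto (fun r : ℝ => q + r • n) (𝓝[>] 0) (𝓝 q) := by
    have : Continuous fun r : ℝ => q + r • n := by fun_prop
    have h0 := this.tendsto 0
    simp only [zero_smul, add_zero] at h0
    exact h0.mono_left nhdsWithin_le_nhds
  have h1 := (hc.eventually (mem_interior_iff_mem_nhds.1 hq)).and self_mem_nhdsWithin
  obtain ⟨r, hr, hr0⟩ := h1.exists
  have := h _ hr
  rw [add_sub_cancel_left, inner_smul_right, real_inner_self_eq_norm_sq] at this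
  have : 0 < ‖n‖ ^ 2 := by positivity
  have : 0 < r := hr0
  nlinarith

lemma proj_mem_frontier {z : Plane} (hz : z ∉ interior P.region) :
    proj P z ∈ frontier P.region := by
  rw [mem_frontier_iff]
  refine ⟨proj_mem P z, ?_⟩
  by_cases h : z ∈ P.region
  · rwa [proj_of_mem P h]
  · exact not_mem_interior_of_inner_le P (proj_ne P h) fun y hy => inner_proj_le P z hy

end Projection

end PerimeterDefense

namespace PerimeterDefense

open Filter Topology RealInnerProductSpace

/-! ### Visibility -/

section Visibility

variable (P : Target)

/-- The half-open segment from `x` to `q` misses the target. -/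
def Sees (x q : Plane) : Prop := ∀ r : ℝ, 0 ≤ r → r < 1 → x + r • (q - x) ∉ P.region

variable {P}

lemma mem_visible_iff {x : Plane} (hx : x ∉ P.region) {s : ℝ} :
    s ∈ visible P x ↔ Sees P x (P.γ s) := by
  have hne : P.γ s - x ≠ 0 := fun h => hx (sub_eq_zero.1 h ▸ γ_mem P s)
  rw [visible, mem_ofPred_eq, segment_eq_image']
  constructor
  · intro h r hr0 hr1 hr
    have : x + r • (P.γ s - x) ∈ ({P.γ s} : Set Plane) := by
      rw [← h]; exact ⟨⟨r, ⟨hr0, hr1.le⟩, rfl⟩, hr⟩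
    rw [mem_singleton_iff] at this
    have h2 : (1 - r) • (P.γ s - x) = 0 := by
      rw [sub_smul, one_smul, sub_eq_zero]
      conv_lhs => rw [← this]
      rw [add_sub_cancel_left]
    rcases smul_eq_zero.1 h2 with h | h
    · linarith
    · exact hne h
  · intro h
    ext y
    rw [mem_singleton_iff]
    constructor
    · rintro ⟨⟨r, hr, rfl⟩, hy⟩
      rcases hr.2.lt_or_eq with h1 | h1
      · exact absurd hy (h r hr.1 h1)
      · simp [h1]
    · rintro rfl
      exact ⟨⟨1, by simp, by simp⟩, γ_mem P s⟩

lemma mem_visible_iff_of_mem {x : Plane} (hx : x ∈ P.region) {s : ℝ} :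
    s ∈ visible P x ↔ P.γ s = x := by
  rw [visible, mem_ofPred_eq]
  constructor
  · intro h
    have : x ∈ ({P.γ s} : Set Plane) := by rw [← h]; exact ⟨left_mem_segment _ _ _, hx⟩
    exact (mem_singleton_iff.1 this).symm
  · rintro rfl
    rw [segment_same, inter_eq_left, singleton_subset_iff]
    exact γ_mem P s

/-- Before it reaches `q`, the segment stays strictly on the outer side of the support line at `q`.
-/
lemma sees_of_normal {x q n : Plane} (hn : ∀ y ∈ P.region, ⟪n, y - q⟫ ≤ 0)
    (h : 0 < ⟪n, x - q⟫) : Sees P x q := by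
  intro r _ hr1 hr
  have := hn _ hr
  rw [show x + r • (q - x) - q = (1 - r) • (x - q) by module, inner_smul_right] at this
  nlinarith

/-- The projection of a point between `x` and the target is visible from `x`. -/
lemma sees_proj {x y : Plane} (hy : y ∈ P.region) {r : ℝ} (hr : 0 ≤ r) (hr1 : r ≤ 1)
    (hz : x + r • (y - x) ∉ P.region) : Sees P x (proj P (x + r • (y - x))) := by
  set z := x + r • (y - x) with hzdef
  set p := proj P z
  have h1 : 0 < ⟪z - p, z - p⟫ := by
    rw [real_inner_self_eq_norm_sq]
    have := norm_pos_iff.2 (proj_ne P hz)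
    positivity
  have h2 := inner_proj_le P z hy
  -- The line through `p` normal to `z - p` supports the target. The point `z` lies strictly outside
  -- it and between `x` and `y`, and `y` lies inside, so `x` lies strictly outside.
  refine sees_of_normal (fun w hw => inner_proj_le P z hw) ?_
  have e : z - p = (1 - r) • (x - p) + r • (y - p) := by rw [hzdef]; module
  have h3 : ⟪z - p, z - p⟫ = (1 - r) * ⟪z - p, x - p⟫ + r * ⟪z - p, y - p⟫ := by
    conv_lhs => rw [show ⟪z - p, z - p⟫ = ⟪z - p, (1 - r) • (x - p) + r • (y - p)⟫ by rw [← e]]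
    rw [inner_add_right, inner_smul_right, inner_smul_right]
  by_contra h
  push Not at h
  nlinarith

lemma sees_proj_self {x : Plane} (hx : x ∉ P.region) : Sees P x (proj P x) := by
  obtain ⟨y, hy⟩ := region_nonempty P
  simpa using sees_proj (x := x) hy le_rfl zero_le_one (by simpa using hx)

lemma Sees.mem_frontier {x q : Plane} (h : Sees P x q) (hq : q ∈ P.region) :
    q ∈ frontier P.region := by
  rw [mem_frontier_iff]
  refine ⟨hq, fun hi => ?_⟩
  have hc : Tendsto (fun r : ℝ => x + r • (q - x)) (𝓝[<] 1) (𝓝 q) := by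
    have : Continuous fun r : ℝ => x + r • (q - x) := by fun_prop
    have h0 := this.tendsto 1
    simp only [one_smul, add_sub_cancel] at h0
    exact h0.mono_left nhdsWithin_le_nhds
  have h1 := (hc.eventually (mem_interior_iff_mem_nhds.1 hi)).and
    (Ioo_mem_nhdsLT (zero_lt_one (α := ℝ)))
  obtain ⟨r, hr, hr0⟩ := h1.exists
  exact h r hr0.1.le hr0.2 hr

/-- The first point of the target on a ray from `x`. -/
lemma exists_sees {x y : Plane} (hx : x ∉ P.region) (hy : y ∈ P.region) :
    ∃ q ∈ P.region, Sees P x q ∧ ∃ ρ : ℝ, 1 ≤ ρ ∧ y - x = ρ • (q - x) := by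
  have hcont : Continuous fun r : ℝ => x + r • (y - x) := by fun_prop
  have hc : IsCompact (Icc (0 : ℝ) 1 ∩ (fun r : ℝ => x + r • (y - x)) ⁻¹' P.region) :=
    isCompact_Icc.inter_right (P.isCompact_region.isClosed.preimage hcont)
  obtain ⟨r, ⟨⟨hr0, hr1⟩, hr⟩, hmin⟩ := hc.exists_isLeast ⟨1, by simp, by simpa using hy⟩
  have hrpos : 0 < r := hr0.lt_of_ne fun h => hx (by simpa [← h] using hr)
  refine ⟨_, hr, ?_, r⁻¹, (one_le_inv₀ hrpos).2 hr1, ?_⟩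
  · intro ρ hρ0 hρ1 hρ
    rw [add_sub_cancel_left, smul_smul] at hρ
    have := hmin ⟨⟨by positivity, by nlinarith⟩, hρ⟩
    nlinarith
  · rw [add_sub_cancel_left, smul_smul, inv_mul_cancel₀ hrpos.ne', one_smul]

/-- The last target point on the ray from `x` through an interior point `o` is a boundary point
hidden behind `o`. Such a point is where the perimeter can be cut open. -/
lemma exists_not_sees {x : Plane} (hx : x ∉ P.region) : ∃ s, ¬ Sees P x (P.γ s) := by
  obtain ⟨o, ho⟩ := P.interior_nonempty
  have hox : o - x ≠ 0 := fun h => hx (sub_eq_zero.1 h ▸ interior_subset ho)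
  obtain ⟨R, hR⟩ := P.isCompact_region.isBounded.subset_ball x
  set f : ℝ → Plane := fun r => x + r • (o - x)
  have hf : Continuous f := by fun_prop
  have hpos : 0 < ‖o - x‖ := norm_pos_iff.2 hox
  have hbd : ∀ r, 1 ≤ r → f r ∈ P.region → r ≤ R / ‖o - x‖ := fun r hr h => by
    have h1 := hR h
    rw [Metric.mem_ball, dist_eq_norm] at h1
    simp only [f, add_sub_cancel_left, norm_smul, Real.norm_eq_abs] at h1
    rw [abs_of_pos (by linarith)] at h1
    rw [le_div_iff₀ hpos]
    exact h1.le
  have hc : IsCompact (Icc 1 (R / ‖o - x‖) ∩ f ⁻¹' P.region) :=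
    isCompact_Icc.inter_right (P.isCompact_region.isClosed.preimage hf)
  have h1T : f 1 ∈ P.region := by simpa [f] using interior_subset ho
  obtain ⟨r, ⟨⟨hr1, -⟩, hr⟩, hmax⟩ := hc.exists_isGreatest ⟨1, ⟨le_rfl, hbd 1 le_rfl h1T⟩, h1T⟩
  have hnot : f r ∉ interior P.region := fun hi => by
    have h1 : ∀ᶠ ρ in 𝓝[>] r, f ρ ∈ P.region := nhdsWithin_le_nhds
      ((hf.tendsto r).eventually (mem_interior_iff_mem_nhds.1 hi))
    obtain ⟨ρ, hρ, hlt⟩ := (h1.and self_mem_nhdsWithin).exists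
    have hlt' : r < ρ := hlt
    exact absurd (hmax ⟨⟨by linarith, hbd ρ (by linarith) hρ⟩, hρ⟩) (not_le.2 hlt')
  have hr1' : 1 < r := by
    refine lt_of_le_of_ne hr1 fun h => ?_
    rw [← h] at hnot
    exact hnot (by simpa [f] using ho)
  obtain ⟨s, hs⟩ := exists_γ_eq P ((mem_frontier_iff P).2 ⟨hr, hnot⟩)
  refine ⟨s, fun h => ?_⟩
  have h1 := h r⁻¹ (by positivity) (inv_lt_one_of_one_lt₀ hr1')
  rw [hs, add_sub_cancel_left, smul_smul, inv_mul_cancel₀ (by positivity), one_smul,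
    add_sub_cancel] at h1
  exact h1 (interior_subset ho)

lemma eq_smul_of_cr_eq_zero {u v : Plane} (hu : u ≠ 0) (h : cr v u = 0) :
    v = (⟪v, u⟫ / ‖u‖ ^ 2) • u := by
  have hpos : ‖u‖ ^ 2 ≠ 0 := by have := norm_pos_iff.2 hu; positivity
  rw [norm_sq_eq] at *
  rw [inner_eq]
  rw [cr] at h
  ext i
  fin_cases i
  · simp; field_simp; linear_combination (u 1) * h
  · simp; field_simp; linear_combination (-u 0) * h

/-- Hidden points stay hidden under small changes. If `q` is hidden behind `q' = x + r (q - x)`, the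
ray from `x` to a nearby `y` crosses the segment from `q'` to `o` at `q' + t y (o - q')`, and does
so before `y`, because the crossing parameter `ρ y` tends to `r < 1`. -/
lemma eventually_not_sees {x q o : Plane} (hx : x ∉ P.region) (hq : q ∈ P.region)
    {r : ℝ} (hr0 : 0 ≤ r) (hr1 : r < 1) (hr : x + r • (q - x) ∈ P.region) (ho : o ∈ P.region)
    {t : Plane → ℝ} (ht : Tendsto t (𝓝 q) (𝓝 0)) :
    ∀ᶠ y in 𝓝 q, y ∈ P.region → 0 ≤ t y →
      cr (r • (q - x) + t y • (o - (x + r • (q - x)))) (y - x) = 0 → ¬ Sees P x y := by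
  have hrpos : 0 < r := hr0.lt_of_ne fun h => hx (by simpa [← h] using hr)
  have hqx : q - x ≠ 0 := fun h => hx (sub_eq_zero.1 h ▸ hq)
  set q' := x + r • (q - x)
  set ρ : Plane → ℝ := fun y => ⟪r • (q - x) + t y • (o - q'), y - x⟫ / ‖y - x‖ ^ 2
  have hρ : Tendsto ρ (𝓝 q) (𝓝 r) := by
    have h1 : Tendsto (fun y => r • (q - x) + t y • (o - q')) (𝓝 q) (𝓝 (r • (q - x))) := by
      have := (tendsto_const_nhds (x := r • (q - x))).add (ht.smul_const (o - q'))
      simpa using this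
    have h2 : Tendsto (fun y => y - x) (𝓝 q) (𝓝 (q - x)) := by
      have : Continuous fun y : Plane => y - x := by fun_prop
      exact this.tendsto q
    have hn : ‖q - x‖ ^ 2 ≠ 0 := by have := norm_pos_iff.2 hqx; positivity
    have h3 := (h1.inner h2 (𝕜 := ℝ)).div (h2.norm.pow 2) hn
    rwa [inner_smul_left, real_inner_self_eq_norm_sq, RCLike.conj_to_real, mul_div_assoc,
      div_self hn, mul_one] at h3
  filter_upwards [hρ.eventually (Ioo_mem_nhds hrpos hr1), ht.eventually (gt_mem_nhds one_pos)]
    with y hy1 hy2 hyT ht0 hcr hs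
  have hyx : y - x ≠ 0 := fun h => hx (sub_eq_zero.1 h ▸ hyT)
  have h1 := eq_smul_of_cr_eq_zero hyx hcr
  apply hs (ρ y) hy1.1.le hy1.2
  change _ = ρ y • (y - x) at h1
  rw [← h1, ← add_assoc]
  have := P.convex_region hr ho (sub_nonneg.2 hy2.le) ht0 (by ring)
  convert this using 1
  simp only [q']; module

/-- The set of points of the target that are seen from `x` is closed. -/
lemma isClosed_sees {x : Plane} (hx : x ∉ P.region) : IsClosed {q | q ∈ P.region ∧ Sees P x q} := by
  rw [← isOpen_compl_iff, isOpen_iff_mem_nhds]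
  intro q hq
  rw [mem_compl_iff, mem_ofPred_eq, not_and] at hq
  by_cases hqT : q ∈ P.region
  swap
  · filter_upwards [P.isCompact_region.isClosed.isOpen_compl.mem_nhds hqT] with y hy h
    exact hy h.1
  have hns := hq hqT
  simp only [Sees, not_forall, not_not] at hns
  obtain ⟨r, hr0, hr1, hr⟩ := hns
  set q' := x + r • (q - x)
  -- The sign `ε` selects a side of the ray from `x` through `q`. If the target has a point `o`
  -- strictly on that side, the segment from `q'` to `o` blocks the view; otherwise all target
  -- points `y` in question lie on the ray itself, and `q'` blocks it.
  suffices key : ∀ ε : ℝ, ε ^ 2 = 1 → ∀ᶠ y in 𝓝 q, y ∈ P.region → 0 ≤ ε * cr (q - x) (y - x) →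
      ¬ Sees P x y by
    filter_upwards [key 1 (by norm_num), key (-1) (by norm_num)] with y h1 h2 h
    rcases le_total 0 (cr (q - x) (y - x)) with h3 | h3
    · exact h1 h.1 (by linarith) h.2
    · exact h2 h.1 (by linarith) h.2
  intro ε hε
  have hzero := eventually_not_sees hx hqT hr0 hr1 hr hqT (t := fun _ => 0) tendsto_const_nhds
  by_cases ho : ∃ o ∈ P.region, 0 < ε * cr (q - x) (o - x)
  · obtain ⟨o, hoT, ho⟩ := ho
    have hcD : Continuous fun y => cr (o - q') (y - x) :=
      continuous_cr.comp (f := fun y => ((o - q' : Plane), y - x)) (by fun_prop)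
    have hcN : Continuous fun y => cr (q - x) (y - x) :=
      continuous_cr.comp (f := fun y => ((q - x : Plane), y - x)) (by fun_prop)
    have hDq : cr (o - q') (q - x) = -cr (q - x) (o - x) := by
      simp only [q', cr, PiLp.sub_apply, PiLp.add_apply, PiLp.smul_apply, smul_eq_mul]; ring
    have hD0 : cr (o - q') (q - x) ≠ 0 := by
      rw [hDq]; intro h; rw [neg_eq_zero] at h; rw [h, mul_zero] at ho; exact ho.false
    -- This quotient solves the linear equation that says that `q' + t (o - q')` lies on the line
    -- through `x` and `y`.
    have ht : Tendsto (fun y => -(r * cr (q - x) (y - x)) / cr (o - q') (y - x)) (𝓝 q) (𝓝 0) := by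
      have := ((hcN.tendsto q).const_mul r).neg.div (hcD.tendsto q) hD0
      rwa [cr_self, mul_zero, neg_zero, zero_div] at this
    have hDneg : ∀ᶠ y in 𝓝 q, ε * cr (o - q') (y - x) < 0 := by
      have h1 : Continuous fun y => ε * cr (o - q') (y - x) := by fun_prop
      refine (h1.tendsto q).eventually (gt_mem_nhds ?_)
      rw [hDq]; linarith
    filter_upwards [eventually_not_sees hx hqT hr0 hr1 hr hoT ht, hDneg] with y h1 h2 hyT hy
    refine h1 hyT ?_ ?_
    · have hDn : cr (o - q') (y - x) ≠ 0 := fun h => by rw [h, mul_zero] at h2; exact h2.false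
      have : -(r * cr (q - x) (y - x)) / cr (o - q') (y - x) =
          r * (ε * cr (q - x) (y - x)) / -(ε * cr (o - q') (y - x)) := by
        have hε0 : ε ≠ 0 := by rintro rfl; norm_num at hε
        field_simp
      rw [this]
      exact div_nonneg (mul_nonneg hr0 hy) (by linarith)
    · have hDn : cr (o - q') (y - x) ≠ 0 := fun h => by rw [h, mul_zero] at h2; exact h2.false
      rw [cr_add_left, cr_smul_left, cr_smul_left]
      field_simp
      ring
  · push Not at ho
    filter_upwards [hzero] with y h1 hyT hy
    refine h1 hyT le_rfl ?_
    have h0 : ε * cr (q - x) (y - x) = 0 := le_antisymm (ho y hyT) hy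
    have hε0 : ε ≠ 0 := by rintro rfl; norm_num at hε
    rw [mul_eq_zero, or_iff_right hε0] at h0
    rw [zero_smul, add_zero, cr_smul_left, h0, mul_zero]

/-- A visible point `q` is joined to the projection of `x` by the projection of the segment from `x`
to `q`, all of which is visible by `sees_proj`. -/
lemma isPreconnected_sees (x : Plane) :
    IsPreconnected {q | q ∈ P.region ∧ Sees P x q} := by
  refine isPreconnected_of_forall (proj P x) fun q hq => ?_
  refine ⟨(fun r : ℝ => proj P (x + r • (q - x))) '' Icc 0 1, ?_, ⟨0, by simp, by simp⟩,
    ⟨1, by simp, by simp [proj_of_mem P hq.1]⟩, ?_⟩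
  · rintro _ ⟨r, hr, rfl⟩
    refine ⟨proj_mem P _, ?_⟩
    by_cases hz : x + r • (q - x) ∈ P.region
    · rcases hr.2.lt_or_eq with h1 | h1
      · exact absurd hz (hq.2 r hr.1 h1)
      · simpa [h1, proj_of_mem P hq.1] using hq.2
    · exact sees_proj hq.1 hr.1 hr.2 hz
  · exact isPreconnected_Icc.image _
      ((continuous_proj P).comp (by fun_prop)).continuousOn

/-- `[a, b]` is a parameter interval of the visible part of the perimeter. -/
structure Chart (P : Target) (x : Plane) (a b : ℝ) : Prop where
  le : a ≤ b
  lt : b < a + P.L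
  mem_visible : ∀ s, s ∈ visible P x ↔ ∃ k : ℤ, s + k * P.L ∈ Icc a b

/-- From outside the target, the visible part of the perimeter is a compact connected set that omits
a point. Cutting the circle at a hidden point turns it into a compact interval. A perimeter point
sees only itself, so its interval is degenerate. -/
lemma exists_chart {x : Plane} (hx : x ∉ interior P.region) : ∃ a b, Chart P x a b := by
  by_cases hxT : x ∈ P.region
  · obtain ⟨s₀, rfl⟩ := exists_γ_eq P ((mem_frontier_iff P).2 ⟨hxT, hx⟩)
    refine ⟨s₀, s₀, le_rfl, by linarith [P.L_pos], fun s => ?_⟩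
    rw [mem_visible_iff_of_mem hxT, γ_eq_iff]
    refine exists_congr fun k => ?_
    rw [Icc_self, mem_singleton_iff, eq_comm]
  obtain ⟨sD, hsD⟩ := exists_not_sees hxT
  set C : Set Plane := {q | q ∈ P.region ∧ Sees P x q}
  set A : Set (AddCircle P.L) := circleγ P ⁻¹' C
  have hemb : IsClosedEmbedding (circleγ P) :=
    (continuous_circleγ P).isClosedEmbedding (circleγ_injective P)
  have hAimg : circleγ P '' A = C := by
    rw [image_preimage_eq_iff, range_circleγ]
    exact fun q hq => hq.2.mem_frontier hq.1
  have hAconn : IsPreconnected A := by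
    rw [← hemb.isInducing.isPreconnected_image, hAimg]
    exact isPreconnected_sees x
  have hAcomp : IsCompact A := ((isClosed_sees hxT).preimage (continuous_circleγ P)).isCompact
  have hAmem : ∀ s : ℝ, (s : AddCircle P.L) ∈ A ↔ s ∈ visible P x := fun s => by
    rw [mem_visible_iff hxT, mem_preimage, circleγ_coe]
    exact ⟨fun h => h.2, fun h => ⟨γ_mem P s, h⟩⟩
  have hAne : A.Nonempty := by
    have h1 := sees_proj_self hxT
    obtain ⟨s, hs⟩ := exists_γ_eq P (h1.mem_frontier (proj_mem P x))
    exact ⟨(s : AddCircle P.L), (hAmem s).2 ((mem_visible_iff hxT).2 (hs ▸ h1))⟩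
  have hD : (sD : AddCircle P.L) ∉ A := fun h => hsD ((mem_visible_iff hxT).1 ((hAmem sD).1 h))
  let F : AddCircle P.L → ℝ := fun z => (AddCircle.equivIco P.L sD z : ℝ)
  have hF : ContinuousOn F A := fun z hz => by
    have hne : z ≠ (sD : AddCircle P.L) := fun h => hD (h ▸ hz)
    exact (continuous_subtype_val.continuousAt.comp
      (AddCircle.continuousAt_equivIco P.L sD hne)).continuousWithinAt
  have hFcoe : ∀ s ∈ Ico sD (sD + P.L), F (s : AddCircle P.L) = s := fun s hs => by
    simp only [F]
    rw [AddCircle.equivIco_coe_eq hs]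
  have hFinv : ∀ z, ((F z : ℝ) : AddCircle P.L) = z := fun z =>
    (AddCircle.equivIco P.L sD).symm_apply_apply z
  have hI := eq_Icc_of_connected_compact
    (⟨hAne.image F, hAconn.image F hF⟩ : IsConnected (F '' A)) (hAcomp.image_of_continuousOn hF)
  set a := sInf (F '' A)
  set b := sSup (F '' A)
  have hmem : ∀ s ∈ Icc a b, s ∈ Ioo sD (sD + P.L) ∧ s ∈ visible P x := fun s hs => by
    rw [← hI] at hs
    obtain ⟨z, hz, rfl⟩ := hs
    have h1 := (AddCircle.equivIco P.L sD z).2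
    refine ⟨⟨lt_of_le_of_ne h1.1 fun h => hD ?_, h1.2⟩, ?_⟩
    · have : (sD : AddCircle P.L) = z := by rw [← hFinv z]; exact congrArg _ h
      exact this ▸ hz
    · rw [← hAmem, hFinv]; exact hz
  have hab : a ≤ b := by
    have : (F '' A).Nonempty := hAne.image F
    rw [hI] at this
    exact nonempty_Icc.1 this
  refine ⟨a, b, hab, ?_, fun s => ?_⟩
  · have h1 := (hmem a (left_mem_Icc.2 hab)).1
    have h2 := (hmem b (right_mem_Icc.2 hab)).1
    linarith [h1.1, h2.2]
  · constructor
    · intro hs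
      obtain ⟨k, hk⟩ := exists_int_add_mem_Ico P sD s
      refine ⟨k, ?_⟩
      rw [← hI, ← hFcoe _ hk]
      refine mem_image_of_mem F ?_
      have : ((s + k * P.L : ℝ) : AddCircle P.L) = (s : AddCircle P.L) :=
        ((coe_eq_coe_iff s _).2 ⟨k, rfl⟩).symm
      rw [this]
      exact (hAmem s).2 hs
    · rintro ⟨k, hk⟩
      have h1 := (hmem _ hk).2
      rw [← hAmem] at h1 ⊢
      rwa [(coe_eq_coe_iff s _).2 ⟨k, rfl⟩]

namespace Chart

variable {x : Plane} {a b : ℝ}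

lemma visible_of_mem (h : Chart P x a b) {s : ℝ} (hs : s ∈ Icc a b) : s ∈ visible P x :=
  (h.mem_visible s).2 ⟨0, by simpa using hs⟩

lemma shift (h : Chart P x a b) (k : ℤ) : Chart P x (a + k * P.L) (b + k * P.L) := by
  refine ⟨by linarith [h.le], by linarith [h.lt], fun s => ?_⟩
  rw [h.mem_visible]
  constructor
  · rintro ⟨l, hl⟩
    exact ⟨l + k, by push_cast; constructor <;> linarith [hl.1, hl.2]⟩
  · rintro ⟨l, hl⟩
    exact ⟨l - k, by push_cast; constructor <;> linarith [hl.1, hl.2]⟩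

lemma eq_of_γ_eq (h : Chart P x a b) {s t : ℝ} (hs : s ∈ Icc a b) (ht : t ∈ Icc a b)
    (hst : P.γ s = P.γ t) : s = t :=
  PerimeterDefense.eq_of_γ_eq P hst (by
    rw [abs_lt]; constructor <;> linarith [h.lt, hs.1, hs.2, ht.1, ht.2])

lemma sees (h : Chart P x a b) (hx : x ∉ P.region) {s : ℝ} (hs : s ∈ Icc a b) :
    Sees P x (P.γ s) := (mem_visible_iff hx).1 (h.visible_of_mem hs)

lemma exists_mem (h : Chart P x a b) {s : ℝ} (hs : s ∈ visible P x) :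
    ∃ k : ℤ, s + k * P.L ∈ Icc a b := (h.mem_visible s).1 hs

lemma exists_of_sees (h : Chart P x a b) (hx : x ∉ P.region) {q : Plane} (hq : q ∈ P.region)
    (hs : Sees P x q) : ∃ s ∈ Icc a b, P.γ s = q := by
  obtain ⟨s, rfl⟩ := exists_γ_eq P (hs.mem_frontier hq)
  obtain ⟨k, hk⟩ := h.exists_mem ((mem_visible_iff hx).2 hs)
  exact ⟨_, hk, γ_add_int P s k⟩

lemma not_sees (h : Chart P x a b) (hx : x ∉ P.region) {s : ℝ} (hs : b < s)
    (hs' : s < a + P.L) : ¬ Sees P x (P.γ s) := by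
  intro hv
  obtain ⟨k, hk⟩ := h.exists_mem ((mem_visible_iff hx).2 hv)
  have hL := P.L_pos
  rcases lt_trichotomy k 0 with hk0 | hk0 | hk0
  · have : (k : ℝ) ≤ -1 := by exact_mod_cast Int.le_sub_one_of_lt hk0
    nlinarith [hk.1]
  · subst hk0
    simp only [Int.cast_zero, zero_mul, add_zero] at hk
    linarith [hk.2]
  · have : (1 : ℝ) ≤ k := by exact_mod_cast hk0
    nlinarith [hk.2, h.le]

lemma exists_eq_of_mem (h : Chart P x a b) (hx : x ∈ P.region) :
    b = a ∧ P.γ a = x := by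
  have h1 := (mem_visible_iff_of_mem hx).1 (h.visible_of_mem (left_mem_Icc.2 h.le))
  have h2 := (mem_visible_iff_of_mem hx).1 (h.visible_of_mem (right_mem_Icc.2 h.le))
  exact ⟨h.eq_of_γ_eq (right_mem_Icc.2 h.le) (left_mem_Icc.2 h.le) (h2.trans h1.symm), h1⟩

lemma not_mem_interior (h : Chart P x a b) : x ∉ interior P.region := by
  by_cases hx : x ∈ P.region
  · rw [← (h.exists_eq_of_mem hx).2]
    exact ((mem_frontier_iff P).1 (γ_mem_frontier P a)).2
  · exact fun h' => hx (interior_subset h')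

end Chart

lemma mem_visible_of_γ_eq_proj {x : Plane} {θ : ℝ} (h : P.γ θ = proj P x) : θ ∈ visible P x := by
  by_cases hx : x ∈ P.region
  · rw [mem_visible_iff_of_mem hx, h, proj_of_mem P hx]
  · rw [mem_visible_iff hx, h]; exact sees_proj_self hx

lemma exists_chart_mem {x : Plane} (hx : x ∉ interior P.region) {θ : ℝ} (h : θ ∈ visible P x) :
    ∃ a b, Chart P x a b ∧ θ ∈ Icc a b := by
  obtain ⟨a, b, hab⟩ := exists_chart hx
  obtain ⟨k, hk⟩ := hab.exists_mem h
  refine ⟨_, _, hab.shift (-k), ?_⟩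
  push_cast
  constructor <;> linarith [hk.1, hk.2]

end Visibility

end PerimeterDefense

namespace PerimeterDefense

open Filter Topology RealInnerProductSpace

/-! ### Geometry of the visible arc and strict convexity of the distance -/

section ChartGeometry

variable {P : Target} {x : Plane} {a b : ℝ}

lemma inner_lt_norm {e v : Plane} (he : ‖e‖ = 1) (h : cr e v ≠ 0) : ⟪v, e⟫ < ‖v‖ := by
  have h1 := cr_sq_add_inner_sq e v
  rw [he, real_inner_comm] at h1
  have : 0 < cr e v ^ 2 := by positivity
  exact lt_of_pow_lt_pow_left₀ 2 (norm_nonneg v) (by nlinarith)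

lemma inner_decomp {n : Plane} (hn : ‖n‖ = 1) (v w : Plane) :
    ⟪v, w⟫ = ⟪v, n⟫ * ⟪n, w⟫ + ⟪v, rot n⟫ * ⟪rot n, w⟫ := by
  have h := norm_sq_eq n
  rw [hn, one_pow] at h
  have e : ⟪v, rot n⟫ = cr n v := by rw [real_inner_comm, inner_rot]
  rw [e, inner_rot, inner_eq, inner_eq, inner_eq, cr, cr]
  linear_combination (v 0 * w 0 + v 1 * w 1) * h

lemma cr_rot_right (u n : Plane) : cr u (rot n) = ⟪u, n⟫ := by
  rw [inner_eq, cr, rot]; simp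

namespace Chart

/-- Directions to visible points rotate strictly monotonically. -/
lemma exists_angular (h : Chart P x a b) (hx : x ∉ P.region) :
    ∃ ε : ℝ, ε ^ 2 = 1 ∧ ∀ s ∈ Icc a b, ∀ s' ∈ Icc a b, s < s' →
      0 < ε * cr (P.γ s - x) (P.γ s' - x) := by
  set e : Plane := proj P x - x
  have hpos : ∀ y ∈ P.region, 0 < ⟪e, y - x⟫ := fun y hy => by
    have h1 := inner_proj_le P x hy
    have h2 : ⟪e, y - x⟫ = ⟪e, e⟫ - ⟪x - proj P x, y - proj P x⟫ := by
      have e1 : y - x = e + (y - proj P x) := by simp [e]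
      rw [e1, inner_add_right, show x - proj P x = -e by simp [e], inner_neg_left]
      ring
    have h3 : 0 < ⟪e, e⟫ := by
      rw [real_inner_self_eq_norm_sq]
      have : e ≠ 0 := fun h' => proj_ne P hx (by rw [← neg_eq_zero, neg_sub]; exact h')
      have := norm_pos_iff.2 this
      positivity
    linarith
  have he : 0 < ‖e‖ ^ 2 := by
    have := hpos _ (proj_mem P x)
    rwa [real_inner_self_eq_norm_sq] at this
  -- The tangent of the angle between `γ s - x` and the direction `e` to the nearest point; it is
  -- finite since the target lies in the open half-plane ahead. It is injective on the chart, as of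
  -- two points on one ray the nearer hides the other, hence strictly monotone.
  set m : ℝ → ℝ := fun s => cr e (P.γ s - x) / ⟪e, P.γ s - x⟫
  have hcγ : Continuous fun s => P.γ s - x := (continuous_γ P).sub continuous_const
  have hm : ContinuousOn m (Icc a b) := by
    refine Continuous.continuousOn (Continuous.div ?_ ?_ ?_)
    · exact continuous_cr.comp (continuous_const.prodMk hcγ)
    · exact continuous_const.inner hcγ
    · exact fun s => (hpos _ (γ_mem P s)).ne'
  have hcr : ∀ s s', ‖e‖ ^ 2 * cr (P.γ s - x) (P.γ s' - x) =
      ⟪e, P.γ s - x⟫ * ⟪e, P.γ s' - x⟫ * (m s' - m s) := fun s s' => by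
    have h1 := (hpos _ (γ_mem P s)).ne'
    have h2 := (hpos _ (γ_mem P s')).ne'
    rw [cr_mul_norm_sq]
    simp only [m]
    field_simp
  have hinj : InjOn m (Icc a b) := by
    intro s hs s' hs' hss
    have h0 : cr (P.γ s - x) (P.γ s' - x) = 0 := by
      have := hcr s s'
      rw [hss, sub_self, mul_zero, mul_eq_zero] at this
      exact this.resolve_left he.ne'
    have hne : ∀ s, P.γ s - x ≠ 0 := fun s h' => hx (sub_eq_zero.1 h' ▸ γ_mem P s)
    have key : ∀ s ∈ Icc a b, ∀ s' ∈ Icc a b, cr (P.γ s - x) (P.γ s' - x) = 0 →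
        ⟪e, P.γ s - x⟫ ≤ ⟪e, P.γ s' - x⟫ → P.γ s = P.γ s' := by
      intro s hs s' hs' h0 hle
      have h1 := eq_smul_of_cr_eq_zero (hne s') h0
      set c := ⟪P.γ s - x, P.γ s' - x⟫ / ‖P.γ s' - x‖ ^ 2
      have h2 : ⟪e, P.γ s - x⟫ = c * ⟪e, P.γ s' - x⟫ := by
        conv_lhs => rw [h1, inner_smul_right]
      have hp := hpos _ (γ_mem P s)
      have hp' := hpos _ (γ_mem P s')
      have hc0 : 0 ≤ c := by
        by_contra hc
        push Not at hc
        nlinarith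
      rcases lt_or_ge c 1 with hc1 | hc1
      · exact absurd (by rw [← h1, add_sub_cancel]; exact γ_mem P s)
          (h.sees hx hs' c hc0 hc1)
      · have hc : c = 1 := by nlinarith
        rw [hc, one_smul] at h1
        exact sub_left_inj.1 h1
    rcases le_total ⟪e, P.γ s - x⟫ ⟪e, P.γ s' - x⟫ with hle | hle
    · exact h.eq_of_γ_eq hs hs' (key s hs s' hs' h0 hle)
    · exact (h.eq_of_γ_eq hs' hs (key s' hs' s hs (by rw [cr_comm, h0, neg_zero]) hle)).symm
  have hfin : ∀ s s', m s < m s' → 0 < cr (P.γ s - x) (P.γ s' - x) := fun s s' hlt => by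
    have h1 := hcr s s'
    have h2 := mul_pos (mul_pos (hpos _ (γ_mem P s)) (hpos _ (γ_mem P s'))) (sub_pos.2 hlt)
    rw [← h1] at h2
    exact pos_of_mul_pos_right h2 he.le
  rcases hm.strictMonoOn_of_injOn_Icc' h.le hinj with hmono | hanti
  · exact ⟨1, by norm_num, fun s hs s' hs' hlt => by
      rw [one_mul]; exact hfin _ _ (hmono hs hs' hlt)⟩
  · exact ⟨-1, by norm_num, fun s hs s' hs' hlt => by
      have := hfin _ _ (hanti hs hs' hlt)
      rw [cr_comm]; linarith⟩

/-- Every point of the target lies behind a visible point. -/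
lemma exists_ray (h : Chart P x a b) (hx : x ∉ P.region) {y : Plane} (hy : y ∈ P.region) :
    ∃ s ∈ Icc a b, ∃ ρ : ℝ, 1 ≤ ρ ∧ y - x = ρ • (P.γ s - x) := by
  obtain ⟨q, hq, hsq, ρ, hρ, he⟩ := exists_sees hx hy
  obtain ⟨s, hs, rfl⟩ := h.exists_of_sees hx hq hsq
  exact ⟨s, hs, ρ, hρ, he⟩

lemma γ_sub_ne (hx : x ∉ P.region) (s : ℝ) : P.γ s - x ≠ 0 := fun h =>
  hx (sub_eq_zero.1 h ▸ γ_mem P s)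

/-- With a single visible point the whole target would lie on one ray from `x` and have no interior.
-/
lemma lt_of_not_mem (h : Chart P x a b) (hx : x ∉ P.region) : a < b := by
  refine lt_of_le_of_ne h.le fun hab => ?_
  subst hab
  obtain ⟨o, ho⟩ := P.interior_nonempty
  have hz : ∀ y ∈ P.region, cr (P.γ a - x) (y - x) = 0 := fun y hy => by
    obtain ⟨s, hs, ρ, -, he⟩ := h.exists_ray hx hy
    rw [Icc_self, mem_singleton_iff] at hs
    rw [he, hs, cr_smul_right, cr_self, mul_zero]
  refine not_mem_interior_of_inner_le P (n := rot (P.γ a - x)) ?_ (fun y hy => ?_) ho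
  · rw [← norm_ne_zero_iff, norm_rot, norm_ne_zero_iff]; exact γ_sub_ne hx a
  · rw [inner_rot, show y - o = (y - x) - (o - x) by abel, cr_sub_right, hz y hy,
      hz o (interior_subset ho), sub_zero]

/-- A support line through `x` touches the target at an end of the visible part. -/
lemma eq_or_eq_of_tangent (h : Chart P x a b) (hx : x ∉ P.region) {s : ℝ} (hs : s ∈ Icc a b)
    {n : Plane} (hn0 : n ≠ 0) (hn : ∀ y ∈ P.region, ⟪n, y - P.γ s⟫ ≤ 0)
    (hnx : ⟪n, x - P.γ s⟫ = 0) : s = a ∨ s = b := by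
  by_contra hcon
  push Not at hcon
  have has : a < s := lt_of_le_of_ne hs.1 (Ne.symm hcon.1)
  have hsb : s < b := lt_of_le_of_ne hs.2 hcon.2
  obtain ⟨ε, hε, hang⟩ := h.exists_angular hx
  have h1 := hang a (left_mem_Icc.2 h.le) s hs has
  have h2 := hang s hs b (right_mem_Icc.2 h.le) hsb
  set u := P.γ s - x
  have hu : u ≠ 0 := γ_sub_ne hx s
  have hru : rot u ≠ 0 := by rw [← norm_ne_zero_iff, norm_rot, norm_ne_zero_iff]; exact hu
  have hnu : ⟪n, u⟫ = 0 := by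
    rw [show u = -(x - P.γ s) by simp [u], inner_neg_right, hnx, neg_zero]
  -- The normal is a multiple of `rot u`, so its products with `γ a - γ s` and `γ b - γ s` have
  -- opposite signs by the angular order, although both must be nonpositive.
  have hnr := eq_smul_of_cr_eq_zero hru (by rw [cr_rot_right, hnu])
  set c := ⟪n, rot u⟫ / ‖rot u‖ ^ 2
  have hc : c ≠ 0 := fun hc => hn0 (by rw [hnr, hc, zero_smul])
  have hval : ∀ t, ⟪n, P.γ t - P.γ s⟫ = c * cr u (P.γ t - x) := fun t => by
    rw [show P.γ t - P.γ s = (P.γ t - x) - u by simp [u], inner_sub_right, hnu, sub_zero]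
    conv_lhs => rw [hnr]
    rw [inner_smul_left, inner_rot]; simp
  have ha := hn _ (γ_mem P a)
  have hb := hn _ (γ_mem P b)
  rw [hval] at ha hb
  rw [cr_comm] at h1
  have hε0 : ε ≠ 0 := by rintro rfl; norm_num at hε
  have h12 := mul_pos h1 h2
  have h3 : 0 ≤ (c * cr u (P.γ a - x)) * (c * cr u (P.γ b - x)) :=
    mul_nonneg_of_nonpos_of_nonpos ha hb
  have h4 : 0 < c ^ 2 := by positivity
  have h5 : ε * -cr u (P.γ a - x) * (ε * cr u (P.γ b - x)) =
      -(ε ^ 2 * (cr u (P.γ a - x) * cr u (P.γ b - x))) := by ring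
  rw [h5, hε, one_mul] at h12
  have h6 : (c * cr u (P.γ a - x)) * (c * cr u (P.γ b - x)) =
      c ^ 2 * (cr u (P.γ a - x) * cr u (P.γ b - x)) := by ring
  rw [h6] at h3
  nlinarith

/-- At a visible point there is a support line with `x` on the outer side. -/
lemma exists_normal (h : Chart P x a b) (hx : x ∉ P.region) {s : ℝ} (hs : s ∈ Icc a b) :
    ∃ n : Plane, ‖n‖ = 1 ∧ (∀ y ∈ P.region, ⟪n, y - P.γ s⟫ ≤ 0) ∧ 0 ≤ ⟪n, x - P.γ s⟫ := by
  have hdisj : Disjoint (interior P.region) (segment ℝ x (P.γ s)) := by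
    rw [Set.disjoint_left]
    intro y hy hseg
    rw [segment_eq_image'] at hseg
    obtain ⟨r, hr, rfl⟩ := hseg
    rcases hr.2.lt_or_eq with h1 | h1
    · exact h.sees hx hs r hr.1 h1 (interior_subset hy)
    · simp only [h1, one_smul, add_sub_cancel] at hy
      exact ((mem_frontier_iff P).1 (γ_mem_frontier P s)).2 hy
  obtain ⟨f, u, hf1, hf2⟩ := geometric_hahn_banach_open P.convex_region.interior isOpen_interior
    (convex_segment x (P.γ s)) hdisj
  have hcl : ∀ y ∈ P.region, f y ≤ u := fun y hy => by
    have h1 : P.region ⊆ closure (interior P.region) := by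
      rw [P.convex_region.closure_interior_eq_closure_of_nonempty_interior P.interior_nonempty]
      exact subset_closure
    have h2 : closure (interior P.region) ⊆ {y | f y ≤ u} :=
      closure_minimal (fun z hz => (hf1 z hz).le) (isClosed_le f.continuous continuous_const)
    exact h2 (h1 hy)
  have hγ : f (P.γ s) = u := le_antisymm (hcl _ (γ_mem P s)) (hf2 _ (right_mem_segment _ _ _))
  set n₀ : Plane := (InnerProductSpace.toDual ℝ Plane).symm f
  have hn₀ : ∀ v, ⟪n₀, v⟫ = f v := fun v => InnerProductSpace.toDual_symm_apply
  have hne : n₀ ≠ 0 := by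
    intro h0
    obtain ⟨o, ho⟩ := P.interior_nonempty
    have h1 := hf1 o ho
    rw [← hγ, ← hn₀, ← hn₀, h0, inner_zero_left, inner_zero_left] at h1
    exact h1.false
  have hpos := norm_pos_iff.2 hne
  refine ⟨‖n₀‖⁻¹ • n₀, ?_, fun y hy => ?_, ?_⟩
  · rw [norm_smul, norm_inv, norm_norm, inv_mul_cancel₀ hpos.ne']
  · rw [inner_smul_left, hn₀, map_sub, hγ]
    exact mul_nonpos_of_nonneg_of_nonpos (by simp) (by linarith [hcl y hy])
  · rw [inner_smul_left, hn₀, map_sub, hγ]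
    exact mul_nonneg (by simp) (by linarith [hf2 x (left_mem_segment _ _ _)])

/-- A continuous motion of a visible perimeter point stays in its chart interval. -/
lemma mem_Icc_of_continuousOn (h : Chart P x a b) {θ : ℝ → ℝ} {T : ℝ}
    (hθ : ContinuousOn θ (Icc 0 T)) (hv : ∀ t ∈ Icc 0 T, θ t ∈ visible P x)
    (h0 : θ 0 ∈ Icc a b) {t : ℝ} (ht : t ∈ Icc 0 T) : θ t ∈ Icc a b := by
  have hsub : Icc 0 t ⊆ Icc 0 T := Icc_subset_Icc_right ht.2
  have hnot : ∀ c, b < c → c < a + P.L → c ∉ visible P x := fun c hc hc' hcv => by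
    obtain ⟨k, hk⟩ := h.exists_mem hcv
    have hL := P.L_pos
    rcases lt_trichotomy k 0 with hk0 | hk0 | hk0
    · have : (k : ℝ) ≤ -1 := by exact_mod_cast Int.le_sub_one_of_lt hk0
      nlinarith [hk.1]
    · subst hk0
      simp only [Int.cast_zero, zero_mul, add_zero] at hk
      linarith [hk.2]
    · have : (1 : ℝ) ≤ k := by exact_mod_cast hk0
      nlinarith [hk.2, h.le]
  have hnot' : ∀ c, b - P.L < c → c < a → c ∉ visible P x := fun c hc hc' hcv => by
    refine hnot (c + P.L) (by linarith) (by linarith) ?_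
    rw [h.mem_visible] at hcv ⊢
    obtain ⟨k, hk⟩ := hcv
    exact ⟨k - 1, by push_cast; constructor <;> linarith [hk.1, hk.2]⟩
  constructor
  · by_contra hlt
    push Not at hlt
    have h1 := h.lt
    -- A motion that leaves the chart interval takes a value in the gap between it and its translate
    -- by a period, where everything is hidden. The midpoint of the gap keeps `c` from leaving it on
    -- the far side.
    set c := max (θ t) ((b - P.L + a) / 2)
    have hc1 : c < a := max_lt hlt (by linarith)
    have hc2 : b - P.L < c := lt_max_of_lt_right (by linarith)
    obtain ⟨r, hr, hrc⟩ := intermediate_value_Icc' ht.1 (hθ.mono hsub)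
      (show c ∈ Icc (θ t) (θ 0) from ⟨le_max_left _ _, hc1.le.trans h0.1⟩)
    exact hnot' c hc2 hc1 (hrc ▸ hv r (hsub hr))
  · by_contra hlt
    push Not at hlt
    have h1 := h.lt
    set c := min (θ t) ((a + P.L + b) / 2)
    have hc1 : b < c := lt_min hlt (by linarith)
    have hc2 : c < a + P.L := min_lt_of_right_lt (by linarith)
    obtain ⟨r, hr, hrc⟩ := intermediate_value_Icc ht.1 (hθ.mono hsub)
      (show c ∈ Icc (θ 0) (θ t) from ⟨h0.2.trans hc1.le, min_le_left _ _⟩)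
    exact hnot c hc1 hc2 (hrc ▸ hv r (hsub hr))

/-- Arc length is bounded by the length of a segment outside the target whose projection is
visible. -/
lemma abs_sub_le_dist (h : Chart P x a b) (hx : x ∉ P.region) {p q : Plane}
    (hgood : ∀ z ∈ segment ℝ p q, z ∉ interior P.region ∧ Sees P x (proj P z))
    {s₀ s₁ : ℝ} (hs₀ : s₀ ∈ Icc a b) (hs₁ : s₁ ∈ Icc a b) (h0 : P.γ s₀ = proj P p)
    (h1 : P.γ s₁ = proj P q) : |s₁ - s₀| ≤ dist p q := by
  set Z : ℝ → Plane := fun r => p + r • (q - p)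
  have hZmem : ∀ r ∈ Icc (0 : ℝ) 1, Z r ∈ segment ℝ p q := fun r hr => by
    rw [segment_eq_image']; exact ⟨r, hr, rfl⟩
  have hZ0 : Z 0 = p := by simp [Z]
  have hZ1 : Z 1 = q := by simp [Z]
  obtain ⟨θ, hθ, hθ0, hθγ⟩ := exists_lift P zero_le_one
    (Y := fun r => proj P (Z r)) ((continuous_proj P).comp (by fun_prop)).continuousOn
    (fun r hr => proj_mem_frontier P (hgood _ (hZmem r hr)).1) s₀ (by simp only [hZ0, h0])
  have hθ1 : θ 1 = s₁ := by
    -- Visibility keeps the lift from winding around the target, so it ends at `s₁` itself and not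
    -- at a translate.
    refine h.eq_of_γ_eq (h.mem_Icc_of_continuousOn hθ (fun r hr => ?_) (hθ0 ▸ hs₀)
      (right_mem_Icc.2 zero_le_one)) hs₁ ?_
    · rw [mem_visible_iff hx, hθγ r hr]; exact (hgood _ (hZmem r hr)).2
    · rw [hθγ 1 (right_mem_Icc.2 zero_le_one), hZ1, h1]
  have := abs_sub_le_of_lipschitz P zero_le_one (K := dist p q) dist_nonneg hθ
    (fun t ht t' ht' => by
      rw [hθγ t ht, hθγ t' ht']
      refine (dist_proj_le P _ _).trans (le_of_eq ?_)
      rw [dist_eq_norm, show Z t - Z t' = (t - t') • (q - p) by simp only [Z]; module, norm_smul,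
        Real.norm_eq_abs, mul_comm, dist_comm p q, dist_eq_norm])
  rwa [hθ0, hθ1, sub_zero, mul_one] at this

lemma good_of_between {q : Plane} (hq : q ∈ P.region) (hs : Sees P x q)
    {r : ℝ} (hr : 0 ≤ r) (hr1 : r ≤ 1) : x + r • (q - x) ∉ interior P.region ∧
      Sees P x (proj P (x + r • (q - x))) := by
  rcases hr1.lt_or_eq with h1 | rfl
  · exact ⟨fun h => hs r hr h1 (interior_subset h), sees_proj hq hr hr1 (hs r hr h1)⟩
  · rw [one_smul, add_sub_cancel, proj_of_mem P hq]
    exact ⟨((mem_frontier_iff P).1 (hs.mem_frontier hq)).2, hs⟩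

/-- The path from a visible point through `x` to another one is longer than the arc. -/
lemma abs_sub_le_dist_add_dist (h : Chart P x a b) {s₀ s₁ : ℝ}
    (hs₀ : s₀ ∈ Icc a b) (hs₁ : s₁ ∈ Icc a b) :
    |s₁ - s₀| ≤ dist (P.γ s₀) x + dist (P.γ s₁) x := by
  by_cases hx : x ∈ P.region
  · have h1 := h.exists_eq_of_mem hx
    rw [h1.1, Icc_self, mem_singleton_iff] at hs₀ hs₁
    rw [hs₀, hs₁, sub_self, abs_zero]
    positivity
  obtain ⟨s, hs, hsp⟩ := h.exists_of_sees hx (proj_mem P x) (sees_proj_self hx)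
  have key : ∀ s' ∈ Icc a b, |s' - s| ≤ dist (P.γ s') x := fun s' hs' => by
    rw [dist_comm]
    refine h.abs_sub_le_dist hx (fun z hz => ?_) hs hs' hsp (proj_of_mem P (γ_mem P s')).symm
    rw [segment_eq_image'] at hz
    obtain ⟨r, hr, rfl⟩ := hz
    exact good_of_between (γ_mem P s') (h.sees hx hs') hr.1 hr.2
  have h0 := key s₀ hs₀
  have h1 := key s₁ hs₁
  rw [abs_le] at *
  constructor <;> linarith [h0.1, h0.2, h1.1, h1.2]

/-- Strict convexity in the form of a strict support line. Take a support line of the target at `p =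
γ s₂`, with unit tangent `τ`, and let `e` be the direction from `x` to `p`; the slope is `⟪τ, e⟫`.
Where this makes the distance increase away from `p`, one needs an upper bound of the arc: it is at
most the broken line from `p` along the support line to its intersection `k` with the segment from
`x` to `q = γ s`, and on to `q`. Where the distance decreases, the bound of the chord by the arc
suffices. -/
lemma exists_slope (h : Chart P x a b) (hx : x ∉ P.region) {s₂ : ℝ} (hs₂ : s₂ ∈ Ioo a b) :
    ∃ κ : ℝ, ∀ s ∈ Icc a b, s ≠ s₂ →
      dist (P.γ s₂) x + κ * (s - s₂) < dist (P.γ s) x := by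
  have hs₂' : s₂ ∈ Icc a b := Ioo_subset_Icc_self hs₂
  obtain ⟨n, hn1, hn, hnx⟩ := h.exists_normal hx hs₂'
  obtain ⟨ε, hε, hang⟩ := h.exists_angular hx
  set p := P.γ s₂
  have hd0 : 0 < ⟪n, x - p⟫ := by
    refine lt_of_le_of_ne hnx fun h0 => ?_
    rcases h.eq_or_eq_of_tangent hx hs₂' (n := n) (by rw [← norm_ne_zero_iff, hn1]; norm_num) hn
      h0.symm with h1 | h1
    · exact hs₂.1.ne' h1
    · exact hs₂.2.ne h1
  set d₀ := ⟪n, x - p⟫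
  set R := ‖p - x‖
  have hR : 0 < R := norm_pos_iff.2 (γ_sub_ne hx s₂)
  set e : Plane := R⁻¹ • (p - x)
  have he : ‖e‖ = 1 := by
    rw [norm_smul, norm_inv, Real.norm_of_nonneg hR.le]; exact inv_mul_cancel₀ hR.ne'
  have hpe : ⟪p - x, e⟫ = R := by
    rw [inner_smul_right, real_inner_self_eq_norm_sq, show ‖p - x‖ = R from rfl]; field_simp
  have hne : ⟪n, e⟫ ≤ 0 := by
    rw [inner_smul_right, show p - x = -(x - p) by abel, inner_neg_right]
    exact mul_nonpos_of_nonneg_of_nonpos (by positivity) (by linarith)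
  set τ : Plane := (-ε) • rot n
  have hτ : ‖τ‖ = 1 := by
    have : |ε| = 1 := by rw [← sq_abs] at hε; nlinarith [abs_nonneg ε]
    rw [norm_smul, norm_rot, hn1, norm_neg, Real.norm_eq_abs, this, one_mul]
  have hττ : ∀ v w : Plane, ⟪v, τ⟫ * ⟪τ, w⟫ = ⟪v, rot n⟫ * ⟪rot n, w⟫ := fun v w => by
    simp only [τ, inner_smul_right, inner_smul_left, RCLike.conj_to_real]
    linear_combination (⟪v, rot n⟫ * ⟪rot n, w⟫) * hε
  have hcrτ : ε * cr (p - x) τ = d₀ := by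
    rw [cr_smul_right, cr_rot_right, real_inner_comm, show p - x = -(x - p) by abel,
      inner_neg_right]
    linear_combination d₀ * hε
  refine ⟨⟪τ, e⟫, fun s hs hne' => ?_⟩
  set q := P.γ s
  set d₁ := -⟪n, q - p⟫
  have hd1 : 0 ≤ d₁ := by have := hn q (γ_mem P s); simp only [d₁]; linarith
  -- With this ratio of the distances to the support line, `k` is the point where the segment from
  -- `x` to `q` crosses it. Its coordinate `c` along the line has the sign given by the angular
  -- order.
  set t := d₁ / (d₀ + d₁)
  have ht0 : 0 ≤ t := by positivity
  have ht1 : t < 1 := by rw [div_lt_one (by linarith)]; linarith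
  set k : Plane := x + (1 - t) • (q - x)
  have hnk : ⟪n, k - p⟫ = 0 := by
    rw [show k - p = (1 - t) • (q - p) + t • (x - p) by simp only [k]; module, inner_add_right,
      inner_smul_right, inner_smul_right, show ⟪n, q - p⟫ = -d₁ by simp [d₁]]
    simp only [t]
    field_simp
    ring
  have hτne : τ ≠ 0 := by rw [← norm_ne_zero_iff, hτ]; norm_num
  have hkp := eq_smul_of_cr_eq_zero hτne (v := k - p) (by
    simp only [τ]
    rw [cr_smul_right, cr_rot_right, real_inner_comm, hnk, mul_zero])
  rw [hτ, one_pow, div_one] at hkp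
  set c := ⟪k - p, τ⟫
  have hcd : c * d₀ = (1 - t) * (ε * cr (p - x) (q - x)) := by
    have h1 : cr (p - x) (k - x) = (1 - t) * cr (p - x) (q - x) := by
      rw [show k - x = (1 - t) • (q - x) by simp only [k]; module, cr_smul_right]
    have h2 : cr (p - x) (k - x) = c * cr (p - x) τ := by
      rw [show k - x = (p - x) + (k - p) by abel, cr_add_right, cr_self, zero_add, hkp,
        cr_smul_right]
    rw [← hcrτ]
    linear_combination -ε * h2 + ε * h1
  have hkq : dist k q = t * dist q x := by
    rw [dist_eq_norm, dist_eq_norm, show k - q = (-t) • (q - x) by simp only [k]; module,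
      norm_smul, norm_neg, Real.norm_of_nonneg ht0]
  have hkx : ‖k - x‖ = (1 - t) * dist q x := by
    rw [dist_eq_norm, show k - x = (1 - t) • (q - x) by simp only [k]; module,
      norm_smul, Real.norm_of_nonneg (by linarith)]
  have hpk : dist p k = |c| := by
    rw [dist_comm, dist_eq_norm, hkp, norm_smul, hτ, mul_one, Real.norm_eq_abs]
  have hlen : |s - s₂| ≤ |c| + t * dist q x := by
    obtain ⟨sk, hsk, hskγ⟩ := h.exists_of_sees hx (proj_mem P k)
      (good_of_between (γ_mem P s) (h.sees hx hs) (by linarith) (by linarith)).2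
    have l1 := h.abs_sub_le_dist hx (p := p) (q := k) (fun z hz => ?_) hs₂' hsk
      (proj_of_mem P (γ_mem P s₂)).symm hskγ
    have l2 := h.abs_sub_le_dist hx (p := k) (q := q) (fun z hz => ?_) hsk hs hskγ
      (proj_of_mem P (γ_mem P s)).symm
    · rw [hpk] at l1
      rw [hkq] at l2
      have := abs_add_le (s - sk) (sk - s₂)
      rw [show s - sk + (sk - s₂) = s - s₂ by ring] at this
      linarith
    · rw [segment_eq_image'] at hz
      obtain ⟨r, hr, rfl⟩ := hz
      change k + r • (q - k) ∉ _ ∧ Sees P x (proj P (k + r • (q - k)))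
      rw [show k + r • (q - k) = x + (1 - t + r * t) • (q - x) by simp only [k]; module]
      exact good_of_between (γ_mem P s) (h.sees hx hs) (by nlinarith [hr.1])
        (by nlinarith [hr.2])
    · rw [segment_eq_image'] at hz
      obtain ⟨r, hr, rfl⟩ := hz
      -- A point of the support line is never interior. If it is a target point, it is seen because
      -- `x` lies strictly beyond the line; otherwise it lies between `x` and a point of the chord
      -- from `p` to `q`, and `sees_proj` applies.
      set z := p + r • (k - p)
      have hzp : ⟪n, z - p⟫ = 0 := by
        rw [show z - p = r • (k - p) by simp only [z]; module, inner_smul_right, hnk, mul_zero]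
      have hnz : ∀ y ∈ P.region, ⟪n, y - z⟫ ≤ 0 := fun y hy => by
        rw [show y - z = (y - p) - (z - p) by abel, inner_sub_right, hzp, sub_zero]
        exact hn y hy
      refine ⟨not_mem_interior_of_inner_le P (by rw [← norm_ne_zero_iff, hn1]; norm_num) hnz, ?_⟩
      by_cases hzT : z ∈ P.region
      · rw [proj_of_mem P hzT]
        refine sees_of_normal hnz ?_
        rw [show x - z = (x - p) - (z - p) by abel, inner_sub_right, hzp, sub_zero]
        exact hd0
      · have hz1 : 0 < 1 - r * t := by nlinarith [hr.1, hr.2]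
        -- Substituting `k = t x + (1 - t) q` into `z` and splitting off the weight `r t` of `x`
        -- leaves this point of the chord.
        have hy : (1 - r * t)⁻¹ • ((1 - r) • p + (r * (1 - t)) • q) ∈ P.region := by
          have := P.convex_region (γ_mem P s₂) (γ_mem P s)
            (a := (1 - r * t)⁻¹ * (1 - r)) (b := (1 - r * t)⁻¹ * (r * (1 - t)))
            (mul_nonneg (by positivity) (by linarith [hr.2]))
            (mul_nonneg (by positivity) (mul_nonneg hr.1 (by linarith)))
            (by field_simp; ring)
          rw [smul_add, smul_smul, smul_smul]
          exact this
        have hzeq : z = x + (1 - r * t) •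
            ((1 - r * t)⁻¹ • ((1 - r) • p + (r * (1 - t)) • q) - x) := by
          rw [smul_sub, smul_smul, mul_inv_cancel₀ hz1.ne', one_smul]
          simp only [z, k]
          module
        change Sees P x (proj P z)
        rw [hzeq]
        exact sees_proj hy hz1.le (by nlinarith [hr.1]) (by rwa [← hzeq])
  have hchord : ‖q - p‖ ≤ |s - s₂| := by
    rw [← dist_eq_norm]; exact lipschitz_γ P s s₂
  have hcrpos : cr (p - x) (q - x) ≠ 0 := by
    intro h0
    rcases lt_or_gt_of_ne hne' with hlt | hlt
    · have := hang s hs s₂ hs₂' hlt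
      rw [cr_comm, h0] at this; simp at this
    · have := hang s₂ hs₂' s hs hlt
      rw [h0] at this; simp at this
  have hcre : ∀ v, cr e v = R⁻¹ * cr (p - x) v := fun v => cr_smul_left _ _ _
  -- `δ` is the sign of `s - s₂`
  obtain ⟨δ, hδ, hδs, hδc⟩ : ∃ δ : ℝ, (δ = 1 ∨ δ = -1) ∧ s - s₂ = δ * |s - s₂| ∧ c = δ * |c| := by
    rcases lt_or_gt_of_ne hne' with hlt | hlt
    · refine ⟨-1, Or.inr rfl, by rw [abs_of_neg (by linarith)]; ring, ?_⟩
      have := hang s hs s₂ hs₂' hlt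
      rw [cr_comm] at this
      have hc : c < 0 := by
        by_contra hc
        push Not at hc
        nlinarith [mul_nonneg hc hd0.le]
      rw [abs_of_neg hc]; ring
    · refine ⟨1, Or.inl rfl, by rw [abs_of_pos (by linarith)]; ring, ?_⟩
      have := hang s₂ hs₂' s hs hlt
      have hc : 0 ≤ c := by
        by_contra hc
        push Not at hc
        nlinarith [mul_neg_of_neg_of_pos hc hd0]
      rw [abs_of_nonneg hc]; ring
  set κ := δ * ⟪τ, e⟫
  have hκ : |κ| ≤ 1 := by
    have h1 : |⟪τ, e⟫| ≤ 1 := by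
      have := abs_real_inner_le_norm τ e
      rwa [hτ, he, one_mul] at this
    have h2 : |δ| = 1 := by rcases hδ with rfl | rfl <;> norm_num
    rw [abs_mul, h2, one_mul]; exact h1
  have hgoal : ⟪τ, e⟫ * (s - s₂) = κ * |s - s₂| := by
    conv_lhs => rw [hδs]
    simp only [κ]
    ring
  rw [hgoal, dist_eq_norm p x]
  change R + κ * |s - s₂| < dist q x
  -- For `κ ≥ 0`, project `k - x` onto `e` and use `κ ≤ 1` on the remaining piece from `k` to `q`.
  -- For `κ < 0`, project `q - x` onto `e`; the normal part of `q - p` contributes nonnegatively.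
  rcases le_or_gt 0 κ with hκ0 | hκ0
  · have h1 : ⟪k - x, e⟫ < ‖k - x‖ := by
      refine inner_lt_norm he ?_
      rw [hcre, show k - x = (1 - t) • (q - x) by simp only [k]; module, cr_smul_right]
      have : 1 - t ≠ 0 := by linarith
      positivity
    have h2 : ⟪k - x, e⟫ = R + |c| * κ := by
      rw [show k - x = (p - x) + (k - p) by abel, inner_add_left, hpe, hkp, inner_smul_left]
      simp only [RCLike.conj_to_real, κ]
      nth_rewrite 1 [hδc]
      ring
    have h3 : κ * (t * dist q x) ≤ t * dist q x :=
      mul_le_of_le_one_left (by positivity) (abs_le.1 hκ).2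
    have h4 := mul_le_mul_of_nonneg_left hlen hκ0
    rw [h2, hkx] at h1
    linarith
  · have h1 : ⟪q - x, e⟫ < ‖q - x‖ := inner_lt_norm he (by
      rw [hcre]; positivity)
    have h2 : ⟪q - x, e⟫ = R + ⟪q - p, e⟫ := by
      rw [show q - x = (p - x) + (q - p) by abel, inner_add_left, hpe]
    have h3 := inner_decomp hn1 (q - p) e
    rw [← hττ] at h3
    have h4 : 0 ≤ ⟪q - p, n⟫ * ⟪n, e⟫ := by
      rw [real_inner_comm]
      exact mul_nonneg_of_nonpos_of_nonpos (hn q (γ_mem P s)) hne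
    have h5 : ⟪q - p, τ⟫ * ⟪τ, e⟫ = (δ * ⟪q - p, τ⟫) * κ := by
      simp only [κ]; rcases hδ with rfl | rfl <;> ring
    have h6 : δ * ⟪q - p, τ⟫ ≤ |s - s₂| := by
      have h7 := abs_real_inner_le_norm (q - p) τ
      rw [hτ, mul_one] at h7
      refine le_trans (le_abs_self _) ?_
      rw [abs_mul, show |δ| = 1 by rcases hδ with rfl | rfl <;> norm_num, one_mul]
      exact h7.trans hchord
    rw [dist_eq_norm]
    have h8 := mul_le_mul_of_nonpos_right h6 hκ0.le
    rw [h2, h3, h5] at h1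
    linarith

/-- The distance from `x` is a strictly convex function of arc length on the visible part. -/
lemma strictConvexOn_dist (h : Chart P x a b) :
    StrictConvexOn ℝ (Icc a b) fun s => dist (P.γ s) x := by
  refine strictConvexOn_of_slope_strict_mono_adjacent (convex_Icc a b) ?_
  intro s₁ s₂ s₃ h1 h3 h12 h23
  have hx : x ∉ P.region := fun hx => by
    have := (h.exists_eq_of_mem hx).1
    linarith [h1.1, h3.2]
  obtain ⟨κ, hκ⟩ := h.exists_slope hx (s₂ := s₂) ⟨h1.1.trans_lt h12, h23.trans_le h3.2⟩
  have k1 := hκ s₁ h1 h12.ne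
  have k3 := hκ s₃ h3 h23.ne'
  have l1 : (dist (P.γ s₂) x - dist (P.γ s₁) x) / (s₂ - s₁) < κ := by
    rw [div_lt_iff₀ (by linarith)]; linarith
  have l3 : κ < (dist (P.γ s₃) x - dist (P.γ s₂) x) / (s₃ - s₂) := by
    rw [lt_div_iff₀ (by linarith)]; linarith
  exact l1.trans l3

end Chart

end ChartGeometry

end PerimeterDefense

namespace PerimeterDefense

open Filter Topology RealInnerProductSpace

/-! ### Detours along the perimeter when the intruder moves -/

section Detour

variable {P : Target} {x y : Plane} {a b a' b' : ℝ}

lemma le_dist_of_inner_nonpos {p z x : Plane} (h : ⟪z - p, x - p⟫ ≤ 0) : dist p x ≤ dist x z := by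
  rw [dist_comm p x, dist_eq_norm, dist_eq_norm]
  have h1 := norm_sub_sq_real (x - p) (z - p)
  rw [sub_sub_sub_cancel_right, real_inner_comm] at h1
  refine le_of_sq_le_sq ?_ (norm_nonneg _)
  nlinarith [sq_nonneg ‖z - p‖]

namespace Chart

/-- When the projection of a path leaves the visible part for the last time, the visible point where
it does so is no farther from `x` than the path. -/
lemma exists_last_visible (h : Chart P x a b) (hx : x ∉ P.region) {Z : ℝ → Plane} {θ : ℝ → ℝ}
    {T : ℝ} (hZ : ContinuousOn Z (Icc 0 T)) (hθ : ContinuousOn θ (Icc 0 T))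
    (hp : ∀ t ∈ Icc 0 T, P.γ (θ t) = proj P (Z t)) {t₀ : ℝ} (ht₀ : t₀ ∈ Icc 0 T)
    (h0 : θ t₀ ∈ Icc a b) (hT : θ T ∉ Icc a b) :
    ∃ m ∈ Icc 0 T, θ m ∈ Icc a b ∧ dist (P.γ (θ m)) x ≤ dist x (Z m) := by
  have hc : IsCompact (Icc 0 T ∩ θ ⁻¹' Icc a b) :=
    isCompact_Icc.of_isClosed_subset (hθ.preimage_isClosed_of_isClosed isClosed_Icc isClosed_Icc)
      inter_subset_left
  obtain ⟨m, ⟨hm, hmab⟩, hmax⟩ := hc.exists_isGreatest ⟨t₀, ht₀, h0⟩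
  refine ⟨m, hm, hmab, le_dist_of_inner_nonpos ?_⟩
  have hmT : m < T := lt_of_le_of_ne hm.2 fun h' => hT (h' ▸ hmab)
  have hle : 𝓝[>] m ≤ 𝓝[Icc 0 T] m := by
    rw [← nhdsWithin_Ioo_eq_nhdsGT hmT]
    exact nhdsWithin_mono _ (fun t ht => ⟨hm.1.trans ht.1.le, ht.2.le⟩)
  have hθm : Tendsto θ (𝓝[>] m) (𝓝 (θ m)) := (hθ m hm).mono_left hle
  have hZm : Tendsto Z (𝓝[>] m) (𝓝 (Z m)) := (hZ m hm).mono_left hle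
  have hγm : Tendsto (fun t => P.γ (θ t)) (𝓝[>] m) (𝓝 (P.γ (θ m))) :=
    ((continuous_γ P).tendsto _).comp hθm
  -- Just after the last visible time the projected point is hidden from `x`, so its support line
  -- with normal `Z t - γ (θ t)` cannot have `x` strictly on the outer side. In the limit the angle
  -- at `γ (θ m)` is not acute.
  refine le_of_tendsto ((hZm.sub hγm).inner (tendsto_const_nhds.sub hγm)) ?_
  have hlt := h.lt
  filter_upwards [hθm.eventually (Ioo_mem_nhds (show b - P.L < θ m by linarith [hmab.1])
    (show θ m < a + P.L by linarith [hmab.2])), Ioo_mem_nhdsGT hmT] with t ht1 ht2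
  have htm : t ∈ Icc 0 T := ⟨hm.1.trans ht2.1.le, ht2.2.le⟩
  have hnot : θ t ∉ Icc a b := fun h' => absurd (hmax ⟨htm, h'⟩) (not_le.2 ht2.1)
  by_contra hpos
  push Not at hpos
  have hs : Sees P x (P.γ (θ t)) := by
    refine sees_of_normal (n := Z t - P.γ (θ t)) (fun w hw => ?_) hpos
    rw [hp t htm]
    exact inner_proj_le P (Z t) hw
  rw [mem_Icc, not_and_or, not_le, not_le] at hnot
  rcases hnot with h1 | h1
  · refine h.not_sees hx (s := θ t + P.L) (by linarith [ht1.1]) (by linarith) ?_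
    rw [P.periodic_γ]; exact hs
  · exact h.not_sees hx h1 ht1.2 hs

/-- The projection of the segment to a visible point lifts to the chart interval. -/
lemma exists_lift_segment (h : Chart P x a b) (hx : x ∉ P.region) {θ₀ s : ℝ}
    (hθ₀ : θ₀ ∈ Icc a b) (hp : P.γ θ₀ = proj P x) (hs : s ∈ Icc a b) :
    ∃ θ : ℝ → ℝ, ContinuousOn θ (Icc 0 1) ∧ θ 0 = θ₀ ∧ θ 1 = s ∧
      (∀ r ∈ Icc (0 : ℝ) 1, P.γ (θ r) = proj P (x + r • (P.γ s - x))) ∧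
      ∀ r ∈ Icc (0 : ℝ) 1, θ r ∈ Icc a b := by
  have hgood := fun (r : ℝ) (hr : r ∈ Icc (0 : ℝ) 1) =>
    good_of_between (γ_mem P s) (h.sees hx hs) hr.1 hr.2
  obtain ⟨θ, hθ, hθ0, hθγ⟩ := exists_lift P zero_le_one
    (Y := fun r => proj P (x + r • (P.γ s - x)))
    ((continuous_proj P).comp (by fun_prop)).continuousOn
    (fun r hr => proj_mem_frontier P (hgood r hr).1) θ₀ (by simp [hp])
  have hmem : ∀ r ∈ Icc (0 : ℝ) 1, θ r ∈ Icc a b := fun r hr => by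
    refine h.mem_Icc_of_continuousOn hθ (fun r hr => ?_) (hθ0 ▸ hθ₀) hr
    rw [mem_visible_iff hx, hθγ r hr]; exact (hgood r hr).2
  have h1 : (1 : ℝ) ∈ Icc (0 : ℝ) 1 := right_mem_Icc.2 zero_le_one
  refine ⟨θ, hθ, hθ0, h.eq_of_γ_eq (hmem 1 h1) hs ?_, hθγ, hmem⟩
  rw [hθγ 1 h1, one_smul, add_sub_cancel, proj_of_mem P (γ_mem P s)]

lemma eq_of_mem (h : Chart P x a b) (hx : x ∈ P.region) {s t : ℝ} (hs : s ∈ Icc a b)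
    (ht : t ∈ Icc a b) : s = t := by
  rw [(h.exists_eq_of_mem hx).1, Icc_self, mem_singleton_iff] at hs ht
  rw [hs, ht]

end Chart

lemma dist_proj_lift_le {Z : ℝ → Plane} {θ : ℝ → ℝ} {t₀ t₁ K : ℝ} (h01 : t₀ ≤ t₁) (hK : 0 ≤ K)
    (hZ : ∀ t ∈ Icc t₀ t₁, ∀ t' ∈ Icc t₀ t₁, dist (Z t) (Z t') ≤ K * |t - t'|)
    (hθ : ContinuousOn θ (Icc t₀ t₁)) (hp : ∀ t ∈ Icc t₀ t₁, P.γ (θ t) = proj P (Z t)) :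
    |θ t₁ - θ t₀| ≤ K * (t₁ - t₀) := by
  refine abs_sub_le_of_lipschitz P h01 hK hθ fun t ht t' ht' => ?_
  rw [hp t ht, hp t' ht']
  exact (dist_proj_le P _ _).trans (hZ t ht t' ht')

lemma dist_segment (x v : Plane) (t t' : ℝ) :
    dist (x + t • v) (x + t' • v) ≤ ‖v‖ * |t - t'| := by
  rw [dist_eq_norm, show x + t • v - (x + t' • v) = (t - t') • v by module, norm_smul,
    Real.norm_eq_abs, mul_comm]

/-- Every point of the chart interval of `x` can be reached from `y`, first along a straight line
and then along the perimeter, on a way that is no longer than `ℓ` plus the distance from `x`. -/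
def Reach (P : Target) (ℓ : ℝ) (x : Plane) (a b : ℝ) (y : Plane) (a' b' : ℝ) : Prop :=
  ∀ s ∈ Icc a b, ∃ s' ∈ Icc a' b', dist (P.γ s') y + |s - s'| ≤ ℓ + dist (P.γ s) x

/-- A point `γ s` still visible from `Y 0` is reached directly. Otherwise follow the path `Y` and
then the segment from `Y T` to `γ s`, and project this onto the perimeter. Up to the last moment at
which the projection is visible from `Y 0`, the way travelled bounds the distance from `Y 0` to the
projected point; from then on it bounds the remaining arc, because the projection is nonexpansive.
-/
lemma reach_of_path {Y : ℝ → Plane} {θ : ℝ → ℝ} {T K : ℝ} (hT : 0 ≤ T) (hK : 0 ≤ K)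
    (hY : ∀ t ∈ Icc 0 T, ∀ t' ∈ Icc 0 T, dist (Y t) (Y t') ≤ K * |t - t'|)
    (hθ : ContinuousOn θ (Icc 0 T)) (hp : ∀ t ∈ Icc 0 T, P.γ (θ t) = proj P (Y t))
    (h0 : Chart P (Y 0) a' b') (hθ0 : θ 0 ∈ Icc a' b')
    (hTc : Chart P (Y T) a b) (hθT : θ T ∈ Icc a b) : Reach P (K * T) (Y T) a b (Y 0) a' b' := by
  have m0 : (0 : ℝ) ∈ Icc 0 T := left_mem_Icc.2 hT
  have mT : T ∈ Icc 0 T := right_mem_Icc.2 hT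
  have hYc : ContinuousOn Y (Icc 0 T) :=
    (LipschitzOnWith.of_dist_le_mul (K := K.toNNReal) fun t ht t' ht' => by
      rw [Real.coe_toNNReal K hK]; exact hY t ht t' ht').continuousOn
  have hsub : ∀ m ∈ Icc 0 T, |θ T - θ m| ≤ K * (T - m) := fun m hm =>
    dist_proj_lift_le hm.2 hK
      (fun t ht t' ht' => hY t ⟨hm.1.trans ht.1, ht.2⟩ t' ⟨hm.1.trans ht'.1, ht'.2⟩)
      (hθ.mono (Icc_subset_Icc_left hm.1)) fun t ht => hp t ⟨hm.1.trans ht.1, ht.2⟩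
  have hsθ : ∀ s ∈ Icc a b, |s - θ T| ≤ dist (P.γ s) (Y T) := fun s hs => by
    by_cases hYT : Y T ∈ P.region
    · rw [hTc.eq_of_mem hYT hs hθT, sub_self, abs_zero]; exact dist_nonneg
    · rw [dist_comm]
      refine hTc.abs_sub_le_dist hYT (fun z hz => ?_) hθT hs (hp T mT)
        (proj_of_mem P (γ_mem P s)).symm
      rw [segment_eq_image'] at hz
      obtain ⟨r, hr, rfl⟩ := hz
      exact Chart.good_of_between (γ_mem P s) (hTc.sees hYT hs) hr.1 hr.2
  have hY0T : ∀ m ∈ Icc 0 T, dist (Y 0) (Y m) ≤ K * m := fun m hm => by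
    have := hY 0 m0 m hm
    rwa [zero_sub, abs_neg, abs_of_nonneg hm.1] at this
  intro s hs
  by_cases hY0 : Y 0 ∈ P.region
  · refine ⟨θ 0, hθ0, ?_⟩
    rw [hp 0 m0, proj_of_mem P hY0, dist_self, zero_add]
    have h1 := abs_add_le (s - θ T) (θ T - θ 0)
    rw [sub_add_sub_cancel] at h1
    have h2 := hsub 0 m0
    rw [sub_zero] at h2
    linarith [hsθ s hs]
  by_cases hsab : s ∈ Icc a' b'
  · refine ⟨s, hsab, ?_⟩
    rw [sub_self, abs_zero, add_zero]
    have h1 := hY0T T mT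
    have h2 := dist_triangle (P.γ s) (Y T) (Y 0)
    rw [dist_comm (Y T)] at h2
    linarith
  -- the last visible time is on the path
  have path_case : θ T ∉ Icc a' b' → ∃ s' ∈ Icc a' b',
      dist (P.γ s') (Y 0) + |s - s'| ≤ K * T + dist (P.γ s) (Y T) := fun hn => by
    obtain ⟨m, hm, hmab, hd⟩ := h0.exists_last_visible hY0 hYc hθ hp m0 hθ0 hn
    refine ⟨θ m, hmab, ?_⟩
    have h1 := abs_add_le (s - θ T) (θ T - θ m)
    rw [sub_add_sub_cancel] at h1
    have h2 := hsub m hm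
    have h3 := hY0T m hm
    linarith [hsθ s hs]
  by_cases hθT' : θ T ∈ Icc a' b'
  swap
  · exact path_case hθT'
  have hYT : Y T ∉ P.region := fun hYT => hsab (hTc.eq_of_mem hYT hθT hs ▸ hθT')
  -- The projection of the whole path ends at a visible point, so the last visible time lies on the
  -- final segment.
  obtain ⟨ϑ, hϑ, hϑ0, hϑ1, hϑp, -⟩ := hTc.exists_lift_segment hYT hθT (hp T mT) hs
  obtain ⟨m, hm, hmab, hd⟩ := h0.exists_last_visible hY0 (Z := fun r => Y T + r • (P.γ s - Y T))
    (by fun_prop) hϑ hϑp (left_mem_Icc.2 zero_le_one) (hϑ0 ▸ hθT') (hϑ1 ▸ hsab)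
  refine ⟨ϑ m, hmab, ?_⟩
  have h1 := dist_proj_lift_le (P := P) (Z := fun r => Y T + r • (P.γ s - Y T)) (θ := ϑ)
    (K := ‖P.γ s - Y T‖) hm.2 (norm_nonneg _) (fun t _ t' _ => dist_segment _ _ t t')
    (hϑ.mono (Icc_subset_Icc_left hm.1)) fun t ht => hϑp t ⟨hm.1.trans ht.1, ht.2⟩
  rw [hϑ1, ← dist_eq_norm] at h1
  have h2 := dist_triangle (Y 0) (Y T) (Y T + m • (P.γ s - Y T))
  have h3 := hY0T T mT
  have h4 : dist (Y T) (Y T + m • (P.γ s - Y T)) = m * dist (P.γ s) (Y T) := by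
    rw [dist_eq_norm, dist_eq_norm, show Y T - (Y T + m • (P.γ s - Y T)) =
      (-m) • (P.γ s - Y T) by module, norm_smul, norm_neg, Real.norm_of_nonneg hm.1]
  rw [h4] at h2
  linarith

/-- The chart intervals of two points belong together. -/
def Linked (P : Target) (ℓ : ℝ) (x : Plane) (a b : ℝ) (y : Plane) (a' b' : ℝ) : Prop :=
  Reach P ℓ x a b y a' b' ∧ Reach P ℓ y a' b' x a b

lemma linked_of_path {Y : ℝ → Plane} {θ : ℝ → ℝ} {t₀ t₁ K : ℝ} (h01 : t₀ ≤ t₁) (hK : 0 ≤ K)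
    (hY : ∀ t ∈ Icc t₀ t₁, ∀ t' ∈ Icc t₀ t₁, dist (Y t) (Y t') ≤ K * |t - t'|)
    (hθ : ContinuousOn θ (Icc t₀ t₁)) (hp : ∀ t ∈ Icc t₀ t₁, P.γ (θ t) = proj P (Y t))
    (h0 : Chart P (Y t₀) a b) (hθ0 : θ t₀ ∈ Icc a b)
    (hTc : Chart P (Y t₁) a' b') (hθT : θ t₁ ∈ Icc a' b') :
    Linked P (K * (t₁ - t₀)) (Y t₀) a b (Y t₁) a' b' := by
  have hT : 0 ≤ t₁ - t₀ := by linarith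
  constructor
  · have hm : ∀ t ∈ Icc 0 (t₁ - t₀), t₁ - t ∈ Icc t₀ t₁ := fun t ht =>
      ⟨by linarith [ht.2], by linarith [ht.1]⟩
    have := reach_of_path (P := P) (Y := fun t => Y (t₁ - t)) (θ := fun t => θ (t₁ - t))
      (a := a) (b := b) (a' := a') (b' := b') hT hK
      (fun t ht t' ht' => by
        have := hY _ (hm t ht) _ (hm t' ht')
        rwa [show t₁ - t - (t₁ - t') = -(t - t') by ring, abs_neg] at this)
      (hθ.comp (by fun_prop) hm) (fun t ht => hp _ (hm t ht))
      (by simpa using hTc) (by simpa using hθT) (by simpa using h0) (by simpa using hθ0)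
    simpa using this
  · have hm : ∀ t ∈ Icc 0 (t₁ - t₀), t₀ + t ∈ Icc t₀ t₁ := fun t ht =>
      ⟨by linarith [ht.1], by linarith [ht.2]⟩
    have := reach_of_path (P := P) (Y := fun t => Y (t₀ + t)) (θ := fun t => θ (t₀ + t))
      (a := a') (b := b') (a' := a) (b' := b) hT hK
      (fun t ht t' ht' => by
        have := hY _ (hm t ht) _ (hm t' ht')
        rwa [show t₀ + t - (t₀ + t') = t - t' by ring] at this)
      (hθ.comp (by fun_prop) hm) (fun t ht => hp _ (hm t ht))
      (by simpa using h0) (by simpa using hθ0) (by simpa using hTc) (by simpa using hθT)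
    simpa using this

lemma exists_lift_mem_chart {x : Plane} {a b : ℝ} (h : Chart P x a b) :
    ∃ θ ∈ Icc a b, P.γ θ = proj P x := by
  obtain ⟨s, hs⟩ := exists_γ_eq P (proj_mem_frontier P h.not_mem_interior)
  obtain ⟨k, hk⟩ := h.exists_mem (mem_visible_of_γ_eq_proj hs)
  exact ⟨_, hk, by rw [γ_add_int, hs]⟩

/-- Transport of a chart interval along a segment outside the target. -/
lemma exists_linked_of_segment (h : Chart P x a b)
    (hseg : ∀ z ∈ segment ℝ x y, z ∉ interior P.region) :
    ∃ a' b', Chart P y a' b' ∧ Linked P (dist x y) x a b y a' b' := by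
  obtain ⟨θ₀, hθ₀, hp0⟩ := exists_lift_mem_chart h
  have hmem : ∀ r ∈ Icc (0 : ℝ) 1, x + r • (y - x) ∉ interior P.region := fun r hr =>
    hseg _ (by rw [segment_eq_image']; exact ⟨r, hr, rfl⟩)
  obtain ⟨θ, hθ, hθ0, hθp⟩ := exists_lift P zero_le_one (Y := fun r => proj P (x + r • (y - x)))
    ((continuous_proj P).comp (by fun_prop)).continuousOn
    (fun r hr => proj_mem_frontier P (hmem r hr)) θ₀ (by simp [hp0])
  have h1 : (1 : ℝ) ∈ Icc (0 : ℝ) 1 := right_mem_Icc.2 zero_le_one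
  obtain ⟨a', b', hc, hmem'⟩ := exists_chart_mem (hmem 1 h1) (mem_visible_of_γ_eq_proj (hθp 1 h1))
  refine ⟨a', b', by simpa using hc, ?_⟩
  have := linked_of_path (P := P) (Y := fun r => x + r • (y - x)) (K := ‖y - x‖) zero_le_one
    (norm_nonneg _) (fun t _ t' _ => dist_segment _ _ t t') hθ hθp (by simpa using h)
    (hθ0 ▸ hθ₀) hc hmem'
  simpa [dist_comm x y, dist_eq_norm] using this

/-- Transport of a chart interval along the segment to a visible point. -/
lemma exists_lift_ray (h : Chart P x a b) (hx : x ∉ P.region) {s r : ℝ} (hs : s ∈ Icc a b)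
    (hr : r ∈ Ico (0 : ℝ) 1) (hy : y = x + r • (P.γ s - x)) (h' : Chart P y a' b')
    (hs' : s ∈ Icc a' b') {θ₀ : ℝ} (hθ₀ : θ₀ ∈ Icc a b) (hp0 : P.γ θ₀ = proj P x) :
    ∃ θ₁ ∈ Icc a' b', P.γ θ₁ = proj P y ∧ |θ₁ - θ₀| ≤ dist x y ∧
      Linked P (dist x y) x a b y a' b' := by
  subst hy
  obtain ⟨θ, hθ, hθ0, hθ1, hθp, hθm⟩ := h.exists_lift_segment hx hθ₀ hp0 hs
  set z := x + r • (P.γ s - x)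
  have hz : z ∉ P.region := h.sees hx hs r hr.1 hr.2
  have hmm : ∀ t ∈ Icc 0 (1 - r), 1 - t ∈ Icc (0 : ℝ) 1 := fun t ht =>
    ⟨by linarith [ht.2, hr.1], by linarith [ht.1]⟩
  -- Followed backwards from `s`, which lies in both chart intervals, the lift stays visible from
  -- the intermediate point and therefore stays in its interval.
  have hθr : θ r ∈ Icc a' b' := by
    have := h'.mem_Icc_of_continuousOn (θ := fun t => θ (1 - t)) (T := 1 - r)
      (hθ.comp (by fun_prop) hmm) (fun t ht => ?_) (by simpa [hθ1] using hs')
      (t := 1 - r) (right_mem_Icc.2 (by linarith [hr.2]))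
    · simpa using this
    · rw [mem_visible_iff hz, hθp _ (hmm t ht)]
      have hpos : 0 < 1 - r := by linarith [hr.2]
      have e : x + (1 - t) • (P.γ s - x) = z + ((1 - r - t) / (1 - r)) • (P.γ s - z) := by
        have : P.γ s - z = (1 - r) • (P.γ s - x) := by simp only [z]; module
        rw [this, smul_smul, div_mul_cancel₀ _ hpos.ne']
        simp only [z]; module
      rw [e]
      exact (Chart.good_of_between (γ_mem P s) ((mem_visible_iff hz).1 (h'.visible_of_mem hs'))
        (div_nonneg (by linarith [ht.2]) hpos.le) ((div_le_one hpos).2 (by linarith [ht.1]))).2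
  have hsub : Icc 0 r ⊆ Icc (0 : ℝ) 1 := Icc_subset_Icc_right hr.2.le
  have := linked_of_path (P := P) (Y := fun t => x + t • (P.γ s - x)) (K := ‖P.γ s - x‖) hr.1
    (norm_nonneg _) (fun t _ t' _ => dist_segment _ _ t t') (hθ.mono hsub)
    (fun t ht => hθp t (hsub ht)) (by simpa using h) (hθ0 ▸ hθ₀) h' hθr
  have e : dist x z = ‖P.γ s - x‖ * (r - 0) := by
    rw [dist_eq_norm, show x - z = (-r) • (P.γ s - x) by simp only [z]; module, norm_smul,
      norm_neg, Real.norm_of_nonneg hr.1, sub_zero, mul_comm]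
  have hlen := dist_proj_lift_le (P := P) (Z := fun t => x + t • (P.γ s - x)) hr.1 (norm_nonneg _)
    (fun t _ t' _ => dist_segment _ _ t t') (hθ.mono hsub) (fun t ht => hθp t (hsub ht))
  rw [hθ0] at hlen
  rw [e]
  exact ⟨θ r, hθr, hθp r ⟨hr.1, hr.2.le⟩, hlen, by simpa using this⟩

lemma linked_of_ray (h : Chart P x a b) (hx : x ∉ P.region) {s r : ℝ} (hs : s ∈ Icc a b)
    (hr : r ∈ Ico (0 : ℝ) 1) (hy : y = x + r • (P.γ s - x)) (h' : Chart P y a' b')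
    (hs' : s ∈ Icc a' b') : Linked P (dist x y) x a b y a' b' := by
  obtain ⟨θ₀, hθ₀, hp0⟩ := exists_lift_mem_chart h
  obtain ⟨-, -, -, -, hl⟩ := exists_lift_ray h hx hs hr hy h' hs' hθ₀ hp0
  exact hl

end Detour

/-! ### Optimal perimeter points -/

section Optimal

variable {P : Target} {ν : ℝ} {x y : Plane} {a b a' b' : ℝ} {c : ℝ → ℝ}

/-- `s` maximizes `c s - dist (γ s) x / ν` over the chart interval. -/
def IsOpt (P : Target) (ν : ℝ) (c : ℝ → ℝ) (x : Plane) (a b s : ℝ) : Prop :=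
  s ∈ Icc a b ∧ ∀ s' ∈ Icc a b, c s' - dist (P.γ s') x / ν ≤ c s - dist (P.γ s) x / ν

lemma exists_isOpt (h : a ≤ b) (hc : Continuous c) : ∃ s, IsOpt P ν c x a b s := by
  have hcont : Continuous fun s => c s - dist (P.γ s) x / ν :=
    hc.sub (((continuous_γ P).dist continuous_const).div_const ν)
  obtain ⟨s, hs, hmax⟩ := isCompact_Icc.exists_isMaxOn (nonempty_Icc.2 h) hcont.continuousOn
  exact ⟨s, hs, fun s' hs' => hmax hs'⟩

/-- Sliding along the perimeter by `|s - s'|` costs at most that much of `c`, hence at most `|s -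
s'| / ν`, which the detour estimate pays for. -/
lemma Reach.exists_le {ℓ : ℝ} (h : Reach P ℓ x a b y a' b') (hν : 0 < ν) (hν' : ν ≤ 1)
    (hc : ∀ s t, c s - c t ≤ |s - t|) {s : ℝ} (hs : s ∈ Icc a b) :
    ∃ s' ∈ Icc a' b', c s - dist (P.γ s) x / ν - ℓ / ν ≤ c s' - dist (P.γ s') y / ν := by
  obtain ⟨s', hs', hle⟩ := h s hs
  refine ⟨s', hs', ?_⟩
  have h1 := hc s s'
  have h2 : dist (P.γ s') y / ν + |s - s'| / ν ≤ ℓ / ν + dist (P.γ s) x / ν := by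
    rw [← add_div, ← add_div]; exact div_le_div_of_nonneg_right hle hν.le
  have h3 : |s - s'| ≤ |s - s'| / ν := le_div_self (abs_nonneg _) hν hν'
  linarith

lemma Reach.opt_le {ℓ s s' : ℝ} (h : Reach P ℓ x a b y a' b') (hν : 0 < ν) (hν' : ν ≤ 1)
    (hc : ∀ s t, c s - c t ≤ |s - t|) (hs : s ∈ Icc a b) (hs' : IsOpt P ν c y a' b' s') :
    c s - dist (P.γ s) x / ν - ℓ / ν ≤ c s' - dist (P.γ s') y / ν := by
  obtain ⟨t, ht, hle⟩ := h.exists_le hν hν' hc hs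
  exact hle.trans (hs'.2 t ht)

lemma strictConvexOn_div (h : Chart P x a b) (hν : 0 < ν) :
    StrictConvexOn ℝ (Icc a b) fun s => dist (P.γ s) x / ν := by
  have h1 := h.strictConvexOn_dist
  refine ⟨h1.1, fun s hs t ht hst p q hp hq hpq => ?_⟩
  have h2 := h1.2 hs ht hst hp hq hpq
  simp only [smul_eq_mul] at h2 ⊢
  calc _ < (p * dist (P.γ s) x + q * dist (P.γ t) x) / ν := div_lt_div_of_pos_right h2 hν
    _ = _ := by ring

lemma strictConcaveOn_obj (h : Chart P x a b) (hν : 0 < ν) (hc : ConcaveOn ℝ univ c) :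
    StrictConcaveOn ℝ (Icc a b) fun s => c s - dist (P.γ s) x / ν :=
  (hc.subset (subset_univ _) (convex_Icc a b)).sub_strictConvexOn (strictConvexOn_div h hν)

lemma IsOpt.unique (h : Chart P x a b) (hν : 0 < ν) (hc : ConcaveOn ℝ univ c) {s t : ℝ}
    (hs : IsOpt P ν c x a b s) (ht : IsOpt P ν c x a b t) : s = t :=
  (strictConcaveOn_obj h hν hc).eq_of_isMaxOn (fun r hr => hs.2 r hr) (fun r hr => ht.2 r hr)
    hs.1 ht.1

lemma mem_visible_of_ray (hx : x ∉ P.region) {s r : ℝ} (hs : s ∈ visible P x)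
    (hr : r ∈ Ico (0 : ℝ) 1) : s ∈ visible P (x + r • (P.γ s - x)) := by
  rw [mem_visible_iff hx] at hs
  have hz : x + r • (P.γ s - x) ∉ P.region := hs r hr.1 hr.2
  rw [mem_visible_iff hz]
  intro ρ hρ0 hρ1
  rw [show x + r • (P.γ s - x) + ρ • (P.γ s - (x + r • (P.γ s - x))) =
    x + (r + ρ * (1 - r)) • (P.γ s - x) by module]
  have := hr.1
  have := hr.2
  exact hs _ (by nlinarith) (by nlinarith)

/-- An optimal point stays optimal when `x` moves towards it. -/
lemma IsOpt.forward (h : Chart P x a b) (hx : x ∉ P.region) (hν : 0 < ν) (hν' : ν ≤ 1)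
    (hc : ∀ s t, c s - c t ≤ |s - t|) {s r : ℝ} (hs : IsOpt P ν c x a b s)
    (hr : r ∈ Ico (0 : ℝ) 1) (hy : y = x + r • (P.γ s - x)) (h' : Chart P y a' b')
    (hs' : s ∈ Icc a' b') : IsOpt P ν c y a' b' s := by
  have hl := linked_of_ray h hx hs.1 hr hy h' hs'
  refine ⟨hs', fun t ht => ?_⟩
  have h1 := hl.2.opt_le hν hν' hc ht hs
  -- The objective at `s` gains exactly `dist x y / ν`, and by `Reach.opt_le` no optimal value can
  -- gain more.
  have h2 : dist (P.γ s) x = dist (P.γ s) y + dist x y := by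
    have e1 : P.γ s - y = (1 - r) • (P.γ s - x) := by rw [hy]; module
    have e2 : x - y = (-r) • (P.γ s - x) := by rw [hy]; module
    rw [dist_eq_norm, dist_eq_norm, dist_eq_norm, e1, e2, norm_smul, norm_smul, norm_neg,
      Real.norm_of_nonneg hr.1, Real.norm_of_nonneg (by linarith [hr.2])]
    ring
  rw [h2, add_div] at h1
  linarith

end Optimal

end PerimeterDefense

namespace PerimeterDefense

open Filter Topology RealInnerProductSpace

/-! ### Receding from an optimal point -/

section Backward

variable {P : Target} {ν : ℝ} {x y : Plane} {a b a' b' : ℝ} {c : ℝ → ℝ}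

lemma not_mem_of_backward (hx : x ∉ P.region) {s ρ : ℝ} (hρ : 0 ≤ ρ) :
    x + (-ρ) • (P.γ s - x) ∉ P.region := fun hy => by
  refine hx ?_
  have := P.convex_region hy (γ_mem P s) (a := (1 + ρ)⁻¹) (b := (1 + ρ)⁻¹ * ρ) (by positivity)
    (by positivity) (by field_simp)
  convert this using 1
  have h : (1 + ρ)⁻¹ * (1 + ρ) = 1 := inv_mul_cancel₀ (by positivity)
  have e : (1 + ρ)⁻¹ • (x + -ρ • (P.γ s - x)) + ((1 + ρ)⁻¹ * ρ) • P.γ s =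
      ((1 + ρ)⁻¹ * (1 + ρ)) • x := by module
  rw [e, h, one_smul]

lemma mem_visible_backward (hx : x ∉ P.region) {s ρ : ℝ} (hρ : 0 ≤ ρ) (hs : s ∈ visible P x) :
    s ∈ visible P (x + (-ρ) • (P.γ s - x)) := by
  rw [mem_visible_iff (not_mem_of_backward hx hρ)]
  intro r hr0 hr1
  rw [show x + -ρ • (P.γ s - x) + r • (P.γ s - (x + -ρ • (P.γ s - x))) =
    x + (r * (1 + ρ) - ρ) • (P.γ s - x) by module]
  rcases le_or_gt 0 (r * (1 + ρ) - ρ) with h | h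
  · exact (mem_visible_iff hx).1 hs _ h (by nlinarith)
  · have := not_mem_of_backward (P := P) hx (s := s) (ρ := -(r * (1 + ρ) - ρ)) (by linarith)
    rwa [neg_neg] at this

/-- At an inner point `t` of the visible arc, `x` lies strictly beyond a support line. As `γ s` lies
on the inner side, receding from it leads farther out. -/
lemma sees_backward (h : Chart P x a b) (hx : x ∉ P.region) {s t ρ : ℝ} (hρ : 0 ≤ ρ)
    (ht : t ∈ Ioo a b) : Sees P (x + (-ρ) • (P.γ s - x)) (P.γ t) := by
  have ht' := Ioo_subset_Icc_self ht
  obtain ⟨n, hn1, hn, hnx⟩ := h.exists_normal hx ht'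
  have hpos : 0 < ⟪n, x - P.γ t⟫ := by
    refine lt_of_le_of_ne hnx fun h0 => ?_
    rcases h.eq_or_eq_of_tangent hx ht' (n := n) (by rw [← norm_ne_zero_iff, hn1]; norm_num) hn
      h0.symm with h1 | h1
    · exact ht.1.ne' h1
    · exact ht.2.ne h1
  refine sees_of_normal hn ?_
  rw [show x + -ρ • (P.γ s - x) - P.γ t =
    (1 + ρ) • (x - P.γ t) - ρ • (P.γ s - P.γ t) by module, inner_sub_right, inner_smul_right,
    inner_smul_right]
  have := hn _ (γ_mem P s)
  nlinarith

lemma Ioo_subset_of_backward (h : Chart P x a b) (hx : x ∉ P.region) {s ρ : ℝ} (hρ : 0 ≤ ρ)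
    (hs : s ∈ Icc a b) (hy : y = x + (-ρ) • (P.γ s - x)) (h' : Chart P y a' b')
    (hs' : s ∈ Icc a' b') : Ioo a b ⊆ Icc a' b' := by
  intro t ht
  have hyT : y ∉ P.region := hy ▸ not_mem_of_backward hx hρ
  have := h'.mem_Icc_of_continuousOn (θ := fun r => s + r * (t - s)) (T := 1) (by fun_prop)
    (fun r hr => ?_) (by simpa using hs') (t := 1) (right_mem_Icc.2 zero_le_one)
  · simpa using this
  · rcases hr.1.eq_or_lt with h0 | h0
    · rw [← h0, zero_mul, add_zero]; exact h'.visible_of_mem hs'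
    · rw [mem_visible_iff hyT, hy]
      refine sees_backward h hx hρ ⟨?_, ?_⟩
      · nlinarith [hs.1, ht.1, hr.2]
      · nlinarith [hs.2, ht.2, hr.2]

/-- Near a visible point that `x` recedes from, nothing new becomes visible. -/
lemma exists_delta_of_backward (h : Chart P x a b) (hx : x ∉ P.region) {s ρ : ℝ} (hρ : 0 ≤ ρ)
    (hs : s ∈ Icc a b) (hy : y = x + (-ρ) • (P.γ s - x)) (h' : Chart P y a' b')
    (hs' : s ∈ Icc a' b') :
    ∃ δ > 0, ∀ t ∈ Icc a' b', |t - s| < δ → t ∈ Icc a b := by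
  have hab := h.lt_of_not_mem hx
  have hsub := Ioo_subset_of_backward h hx hρ hs hy h' hs'
  have hyT : y ∉ P.region := hy ▸ not_mem_of_backward hx hρ
  -- If `s` is an end of the arc visible from `x`, the line through `x` and `γ s` supports the
  -- target. It also contains `y`, so `s` is an end of the arc visible from `y`, and since the open
  -- arc stays visible it is the same end.
  have tangent : ∀ η : ℝ, η ≠ 0 → (∀ t ∈ Icc a b, η * cr (P.γ s - x) (P.γ t - x) ≤ 0) →
      s = a' ∨ s = b' := fun η hη hle => by
    have hu : P.γ s - x ≠ 0 := Chart.γ_sub_ne hx s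
    refine h'.eq_or_eq_of_tangent hyT hs' (n := η • rot (P.γ s - x)) ?_ (fun w hw => ?_) ?_
    · refine smul_ne_zero hη ?_
      rw [← norm_ne_zero_iff, norm_rot, norm_ne_zero_iff]; exact hu
    · obtain ⟨t, ht, q, hq, e⟩ := h.exists_ray hx hw
      rw [inner_smul_left, inner_rot, show w - P.γ s = (w - x) - (P.γ s - x) by abel,
        cr_sub_right, cr_self, e, cr_smul_right, sub_zero, RCLike.conj_to_real]
      have := hle t ht
      nlinarith
    · rw [inner_smul_left, inner_rot, hy, show x + -ρ • (P.γ s - x) - P.γ s =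
        (-(1 + ρ)) • (P.γ s - x) by module, cr_smul_right, cr_self]
      ring
  obtain ⟨ε, hε, hang⟩ := h.exists_angular hx
  have hε0 : ε ≠ 0 := by rintro rfl; norm_num at hε
  obtain ⟨t₀, ht₀⟩ := nonempty_Ioo.2 hab
  have ht₀' := hsub ht₀
  rcases hs.1.eq_or_lt with h1 | h1
  · have hsa : s = a' := by
      refine (tangent (-ε) (neg_ne_zero.2 hε0) fun t ht => ?_).resolve_right fun hb => ?_
      · rcases ht.1.eq_or_lt with h2 | h2
        · rw [← h1, ← h2, cr_self, mul_zero]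
        · have := hang s hs t ht (by linarith)
          linarith
      · linarith [ht₀'.2, ht₀.1]
    refine ⟨b - a, by linarith, fun t ht htd => ?_⟩
    rw [abs_lt] at htd
    constructor <;> linarith [ht.1]
  rcases hs.2.eq_or_lt with h2 | h2
  · have hsb : s = b' := by
      refine (tangent ε hε0 fun t ht => ?_).resolve_left fun hb => ?_
      · rcases ht.2.eq_or_lt with h3 | h3
        · rw [h2, h3, cr_self, mul_zero]
        · have := hang t ht s hs (by linarith)
          rw [cr_comm] at this
          linarith
      · linarith [ht₀'.1, ht₀.2]
    refine ⟨b - a, by linarith, fun t ht htd => ?_⟩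
    rw [abs_lt] at htd
    constructor <;> linarith [ht.2]
  · refine ⟨min (s - a) (b - s), lt_min (by linarith) (by linarith), fun t _ htd => ?_⟩
    rw [lt_min_iff, abs_lt, abs_lt] at htd
    constructor <;> linarith [htd.1.1, htd.2.2]

/-- Second order upper bound of the norm. -/
lemma norm_add_le_of_unit {R : ℝ} (hR : 0 < R) {e w : Plane} (he : ‖e‖ = 1) :
    ‖R • e + w‖ ≤ R + ⟪w, e⟫ + ‖w‖ ^ 2 / (2 * R) := by
  have h1 : ‖R • e + w‖ ^ 2 = R ^ 2 + 2 * R * ⟪w, e⟫ + ‖w‖ ^ 2 := by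
    rw [norm_add_sq_real, norm_smul, he, inner_smul_left, real_inner_comm, Real.norm_of_nonneg hR.le]
    simp only [RCLike.conj_to_real]
    ring
  have h2 : 0 ≤ R + ⟪w, e⟫ + ‖w‖ ^ 2 / (2 * R) := by
    have h3 := (abs_le.1 (abs_real_inner_le_norm w e)).1
    rw [he, mul_one] at h3
    have h4 : 0 ≤ (R - ‖w‖) ^ 2 / (2 * R) + R / 2 := by positivity
    have h5 : (R - ‖w‖) ^ 2 / (2 * R) + R / 2 = R - ‖w‖ + ‖w‖ ^ 2 / (2 * R) := by
      field_simp; ring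
    linarith
  refine le_of_sq_le_sq ?_ h2
  rw [h1]
  set q := ‖w‖ ^ 2 / (2 * R)
  have h6 : ‖w‖ ^ 2 = 2 * R * q := by simp only [q]; field_simp
  rw [h6]
  nlinarith [sq_nonneg (⟪w, e⟫ + q)]

/-- A quadratic error does not spoil a local minimum of a convex function: at `s + r (t - s)` the
error is of order `r ^ 2`, whereas convexity compares `f s` and `f t` with weight `r`. -/
lemma le_of_convexOn_of_local {I : Set ℝ} {f : ℝ → ℝ} (hf : ConvexOn ℝ I f) {s δ C : ℝ}
    (hs : s ∈ I) (hδ : 0 < δ) (hC : 0 ≤ C)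
    (hloc : ∀ t ∈ I, |t - s| < δ → f s - C * (t - s) ^ 2 ≤ f t) :
    ∀ t ∈ I, f s ≤ f t := by
  intro t ht
  have hd : 0 < |t - s| + 1 := by positivity
  refine le_of_forall_pos_le_add fun ε hε => ?_
  obtain ⟨r, hr0, hr1, hrδ, hrε⟩ : ∃ r : ℝ, 0 < r ∧ r ≤ 1 ∧ r * |t - s| < δ ∧
      r * (C * (t - s) ^ 2) ≤ ε := by
    refine ⟨min 1 (min (δ / (|t - s| + 1)) (ε / (C * (t - s) ^ 2 + 1))), ?_, min_le_left _ _,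
      ?_, ?_⟩
    · refine lt_min one_pos (lt_min ?_ ?_) <;> positivity
    · have h1 : min 1 (min (δ / (|t - s| + 1)) (ε / (C * (t - s) ^ 2 + 1))) ≤
          δ / (|t - s| + 1) := (min_le_right _ _).trans (min_le_left _ _)
      calc _ ≤ δ / (|t - s| + 1) * |t - s| := mul_le_mul_of_nonneg_right h1 (abs_nonneg _)
        _ < δ := by rw [div_mul_eq_mul_div, div_lt_iff₀ hd]; nlinarith
    · have h1 : min 1 (min (δ / (|t - s| + 1)) (ε / (C * (t - s) ^ 2 + 1))) ≤
          ε / (C * (t - s) ^ 2 + 1) := (min_le_right _ _).trans (min_le_right _ _)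
      have hp : 0 ≤ C * (t - s) ^ 2 := by positivity
      calc _ ≤ ε / (C * (t - s) ^ 2 + 1) * (C * (t - s) ^ 2) :=
            mul_le_mul_of_nonneg_right h1 hp
        _ ≤ ε := by rw [div_mul_eq_mul_div, div_le_iff₀ (by positivity)]; nlinarith
  have h1 := hf.2 hs ht (show 0 ≤ 1 - r by linarith) hr0.le (by ring)
  have hmem := hf.1 hs ht (show 0 ≤ 1 - r by linarith) hr0.le (by ring)
  simp only [smul_eq_mul] at h1 hmem
  have e : (1 - r) * s + r * t - s = r * (t - s) := by ring
  have h2 := hloc _ hmem (by rw [e, abs_mul, abs_of_pos hr0]; exact hrδ)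
  rw [e] at h2
  have h3 : r * (f s) ≤ r * (f t + ε) := by
    have : C * (r * (t - s)) ^ 2 = r * (r * (C * (t - s) ^ 2)) := by ring
    rw [this] at h2
    nlinarith [mul_le_mul_of_nonneg_left hrε hr0.le]
  exact le_of_mul_le_mul_left h3 hr0

/-- An optimal point stays optimal when `x` recedes from it. -/
lemma IsOpt.backward (h : Chart P x a b) (hx : x ∉ P.region) (hν : 0 < ν)
    (hc : ConcaveOn ℝ univ c) {s ρ : ℝ} (hs : IsOpt P ν c x a b s) (hρ : 0 ≤ ρ)
    (hy : y = x + (-ρ) • (P.γ s - x)) (h' : Chart P y a' b') (hs' : s ∈ Icc a' b') :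
    IsOpt P ν c y a' b' s := by
  obtain ⟨δ, hδ, hloc⟩ := exists_delta_of_backward h hx hρ hs.1 hy h' hs'
  set R := ‖P.γ s - x‖
  have hR : 0 < R := norm_pos_iff.2 (Chart.γ_sub_ne hx s)
  set e : Plane := R⁻¹ • (P.γ s - x)
  have he : ‖e‖ = 1 := by
    rw [norm_smul, norm_inv, Real.norm_of_nonneg hR.le]; exact inv_mul_cancel₀ hR.ne'
  have hRe : P.γ s - x = R • e := by rw [smul_smul, mul_inv_cancel₀ hR.ne', one_smul]
  have hcv : ConvexOn ℝ (Icc a' b') fun t => dist (P.γ t) y / ν - c t :=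
    (strictConvexOn_div h' hν).convexOn.sub (hc.subset (subset_univ _) (convex_Icc a' b'))
  -- The distances from `x` and from `y` have the same first-order term `⟪w, e⟫` at `γ s`. Bounding
  -- the former above to second order and the latter below by its component along `e` leaves an
  -- error of at most `(t - s) ^ 2 / (2 R)` in distance.
  have key := le_of_convexOn_of_local hcv hs' hδ (C := 1 / (2 * R * ν)) (by positivity)
    fun t ht htd => by
    have hopt := hs.2 t (hloc t ht htd)
    set w := P.γ t - P.γ s
    have hw : ‖w‖ ^ 2 ≤ (t - s) ^ 2 := by
      rw [← sq_abs (t - s)]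
      have := lipschitz_γ P t s
      rw [dist_eq_norm] at this
      exact pow_le_pow_left₀ (norm_nonneg _) this 2
    have hx1 : dist (P.γ t) x ≤ R + ⟪w, e⟫ + ‖w‖ ^ 2 / (2 * R) := by
      rw [dist_eq_norm, show P.γ t - x = R • e + w by rw [← hRe]; simp only [w]; abel]
      exact norm_add_le_of_unit hR he
    have hy1 : (1 + ρ) * R + ⟪w, e⟫ ≤ dist (P.γ t) y := by
      have h1 := real_inner_le_norm (P.γ t - y) e
      rw [he, mul_one, show P.γ t - y = ((1 + ρ) * R) • e + w by
        rw [mul_smul, ← hRe, hy]; simp only [w]; module, inner_add_left, inner_smul_left,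
        real_inner_self_eq_norm_sq, he] at h1
      rw [dist_eq_norm, show P.γ t - y = ((1 + ρ) * R) • e + w by
        rw [mul_smul, ← hRe, hy]; simp only [w]; module]
      simpa using h1
    have hx2 : dist (P.γ s) x = R := dist_eq_norm _ _
    have hy2 : dist (P.γ s) y = (1 + ρ) * R := by
      rw [dist_eq_norm, hy, show P.γ s - (x + -ρ • (P.γ s - x)) = (1 + ρ) • (P.γ s - x) by module,
        norm_smul, Real.norm_of_nonneg (by positivity)]
    rw [hx2] at hopt
    rw [hy2]
    have h3 : dist (P.γ t) x / ν ≤ (R + ⟪w, e⟫ + ‖w‖ ^ 2 / (2 * R)) / ν :=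
      div_le_div_of_nonneg_right hx1 hν.le
    have h4 : ((1 + ρ) * R + ⟪w, e⟫) / ν ≤ dist (P.γ t) y / ν :=
      div_le_div_of_nonneg_right hy1 hν.le
    have h5 : ‖w‖ ^ 2 / (2 * R * ν) ≤ 1 / (2 * R * ν) * (t - s) ^ 2 := by
      rw [one_div_mul_eq_div]
      exact div_le_div_of_nonneg_right hw (by positivity)
    have h6 : (R + ⟪w, e⟫ + ‖w‖ ^ 2 / (2 * R)) / ν =
        R / ν + ⟪w, e⟫ / ν + ‖w‖ ^ 2 / (2 * R * ν) := by
      rw [add_div, add_div, div_div]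
    have h7 : ((1 + ρ) * R + ⟪w, e⟫) / ν = (1 + ρ) * R / ν + ⟪w, e⟫ / ν := add_div _ _ _
    rw [h6] at h3
    rw [h7] at h4
    linarith
  refine ⟨hs', fun t ht => ?_⟩
  have := key t ht
  linarith

/-- First order condition at an optimal point, in integrated form. -/
lemma IsOpt.inner_le (h : Chart P x a b) (hx : x ∉ P.region) (hν : 0 < ν)
    (hc : ConcaveOn ℝ univ c) (hcc : Continuous c) {s : ℝ} (hs : IsOpt P ν c x a b s) {t : ℝ}
    (ht : t ∈ Icc a b) : ν * (c t - c s) ≤ ⟪P.γ t - P.γ s, ‖P.γ s - x‖⁻¹ • (P.γ s - x)⟫ := by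
  set R := ‖P.γ s - x‖
  have hR : 0 < R := norm_pos_iff.2 (Chart.γ_sub_ne hx s)
  set e : Plane := R⁻¹ • (P.γ s - x)
  have he : ‖e‖ = 1 := by
    rw [norm_smul, norm_inv, Real.norm_of_nonneg hR.le]; exact inv_mul_cancel₀ hR.ne'
  have hRe : P.γ s - x = R • e := by rw [smul_smul, mul_inv_cancel₀ hR.ne', one_smul]
  have hclosed : IsClosed {t | ν * (c t - c s) ≤ ⟪P.γ t - P.γ s, e⟫} :=
    isClosed_le (by fun_prop) (((continuous_γ P).sub continuous_const).inner continuous_const)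
  -- The ends of the arc follow by continuity; only its inner points are sure to stay visible when
  -- `x` recedes.
  suffices hIoo : Ioo a b ⊆ {t | ν * (c t - c s) ≤ ⟪P.γ t - P.γ s, e⟫} by
    have := closure_minimal hIoo hclosed
    rw [closure_Ioo (h.lt_of_not_mem hx).ne] at this
    exact this ht
  clear ht t
  intro t ht
  set w := P.γ t - P.γ s
  change ν * (c t - c s) ≤ ⟪w, e⟫
  -- Since `s` stays optimal however far `x` recedes, the second-order term is divided by `1 + ρ`.
  -- The value of `ρ` chosen below makes it at most `η`.
  have hbound : ∀ ρ : ℝ, 0 ≤ ρ →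
      ν * (c t - c s) ≤ ⟪w, e⟫ + ‖w‖ ^ 2 / (2 * ((1 + ρ) * R)) := fun ρ hρ => by
    set y := x + (-ρ) • (P.γ s - x)
    have hvis := mem_visible_backward hx hρ (h.visible_of_mem hs.1)
    have hyT := not_mem_of_backward (P := P) hx (s := s) hρ
    obtain ⟨a', b', h', hs'⟩ := exists_chart_mem (fun h' => hyT (interior_subset h')) hvis
    have hopt := (hs.backward h hx hν hc hρ rfl h' hs').2 t
      (Ioo_subset_of_backward h hx hρ hs.1 rfl h' hs' ht)
    have hR' : 0 < (1 + ρ) * R := by positivity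
    have h1 : dist (P.γ t) y ≤ (1 + ρ) * R + ⟪w, e⟫ + ‖w‖ ^ 2 / (2 * ((1 + ρ) * R)) := by
      rw [dist_eq_norm, show P.γ t - y = ((1 + ρ) * R) • e + w by
        rw [mul_smul, ← hRe]; simp only [w, y]; module]
      exact norm_add_le_of_unit hR' he
    have h2 : dist (P.γ s) y = (1 + ρ) * R := by
      rw [dist_eq_norm, show P.γ s - y = (1 + ρ) • (P.γ s - x) by simp only [y]; module,
        norm_smul, Real.norm_of_nonneg (by positivity)]
    change c t - dist (P.γ t) y / ν ≤ c s - dist (P.γ s) y / ν at hopt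
    rw [h2] at hopt
    have h3 : c t - c s ≤ (dist (P.γ t) y - (1 + ρ) * R) / ν := by rw [sub_div]; linarith
    rw [le_div_iff₀ hν] at h3
    linarith
  refine le_of_forall_pos_le_add fun η hη => ?_
  have h1 := hbound (‖w‖ ^ 2 / (2 * R * η)) (by positivity)
  refine h1.trans (add_le_add_right ?_ _)
  rw [div_le_iff₀ (by positivity)]
  have : η * (2 * ((1 + ‖w‖ ^ 2 / (2 * R * η)) * R)) = 2 * R * η + ‖w‖ ^ 2 := by
    field_simp
  rw [this]
  have : 0 ≤ 2 * R * η := by positivity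
  linarith

end Backward

end PerimeterDefense

namespace PerimeterDefense

open Filter Topology RealInnerProductSpace

/-! ### Distance along the perimeter to the nearest defender -/

section Clearance

variable (P : Target)

/-- Distance along the perimeter. -/
noncomputable def cdist (s t : ℝ) : ℝ := ‖((s - t : ℝ) : AddCircle P.L)‖

/-- Perimeter distance from `s` to the nearest defender. -/
noncomputable def clearance (s₁ s₂ s : ℝ) : ℝ := min (cdist P s s₁) (cdist P s s₂)

/-- The concave function `min (s - A) (B - s)`. -/
noncomputable def tent (A B s : ℝ) : ℝ := min (s - A) (B - s)

variable {P}

lemma cdist_nonneg (s t : ℝ) : 0 ≤ cdist P s t := norm_nonneg _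

lemma cdist_comm (s t : ℝ) : cdist P s t = cdist P t s := by
  rw [cdist, cdist, ← norm_neg, ← AddCircle.coe_neg, neg_sub]

lemma norm_coe_le (t : ℝ) : ‖(t : AddCircle P.L)‖ ≤ |t| := by
  by_cases h : |t| ≤ |P.L| / 2
  · exact ((AddCircle.norm_coe_eq_abs_iff P.L P.L_pos.ne').2 h).le
  · exact (AddCircle.norm_le_half_period P.L P.L_pos.ne').trans (not_le.1 h).le

lemma cdist_triangle (s t r : ℝ) : cdist P s r ≤ cdist P s t + cdist P t r := by
  rw [cdist, cdist, cdist, show s - r = (s - t) + (t - r) by ring, AddCircle.coe_add]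
  exact norm_add_le _ _

lemma cdist_le (s t : ℝ) : cdist P s t ≤ |s - t| := norm_coe_le _

lemma cdist_congr {s t t' : ℝ} (h : ∃ k : ℤ, t' = t + k * P.L) : cdist P s t' = cdist P s t := by
  have := (coe_eq_coe_iff (p := P.L) t t').2 h
  rw [cdist, cdist, AddCircle.coe_sub, AddCircle.coe_sub, this]

lemma cdist_eq {s t : ℝ} (h0 : t ≤ s) (h1 : s ≤ t + P.L) :
    cdist P s t = min (s - t) (t + P.L - s) := by
  have hL := P.L_pos
  rcases le_total (s - t) (P.L / 2) with h | h
  · rw [cdist, (AddCircle.norm_coe_eq_abs_iff P.L hL.ne').2, abs_of_nonneg (by linarith),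
      min_eq_left (by linarith)]
    rw [abs_of_nonneg (by linarith), abs_of_pos hL]; exact h
  · have e : ((s - t : ℝ) : AddCircle P.L) = ((s - t - P.L : ℝ) : AddCircle P.L) :=
      (coe_eq_coe_iff _ _).2 ⟨-1, by push_cast; ring⟩
    rw [cdist, e, (AddCircle.norm_coe_eq_abs_iff P.L hL.ne').2, abs_of_nonpos (by linarith),
      min_eq_right (by linarith)]
    · ring
    · rw [abs_of_nonpos (by linarith), abs_of_pos hL]; linarith

lemma cdist_eq_zero_iff {s t : ℝ} : cdist P s t = 0 ↔ ∃ k : ℤ, s = t + k * P.L := by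
  rw [cdist, norm_eq_zero, AddCircle.coe_sub, sub_eq_zero, eq_comm, coe_eq_coe_iff]

lemma clearance_comm (s₁ s₂ s : ℝ) : clearance P s₁ s₂ s = clearance P s₂ s₁ s := min_comm _ _

lemma clearance_sub_le (s₁ s₂ s t : ℝ) : clearance P s₁ s₂ s - clearance P s₁ s₂ t ≤ |s - t| := by
  have h1 := (cdist_triangle (P := P) s t s₁).trans (add_le_add_left (cdist_le s t) _)
  have h2 := (cdist_triangle (P := P) s t s₂).trans (add_le_add_left (cdist_le s t) _)
  rw [sub_le_iff_le_add, clearance, clearance, ← min_add_add_left]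
  exact min_le_min h1 h2

lemma clearance_sub_le' {s₁ s₂ s₁' s₂' δ : ℝ} (h₁ : |s₁' - s₁| ≤ δ) (h₂ : |s₂' - s₂| ≤ δ) (s : ℝ) :
    clearance P s₁ s₂ s - clearance P s₁' s₂' s ≤ δ := by
  have h1 := (cdist_triangle (P := P) s s₁' s₁).trans
    (add_le_add_right ((cdist_le s₁' s₁).trans h₁) _)
  have h2 := (cdist_triangle (P := P) s s₂' s₂).trans
    (add_le_add_right ((cdist_le s₂' s₂).trans h₂) _)
  rw [sub_le_iff_le_add, clearance, clearance, ← min_add_add_left]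
  refine min_le_min ?_ ?_ <;> linarith

lemma continuous_of_sub_le {c : ℝ → ℝ} (hc : ∀ s t, c s - c t ≤ |s - t|) : Continuous c :=
  (LipschitzWith.of_dist_le_mul (K := 1) fun s t => by
    rw [Real.dist_eq, Real.dist_eq, NNReal.coe_one, one_mul, abs_le]
    have := hc t s
    rw [abs_sub_comm] at this
    exact ⟨by linarith, hc s t⟩).continuous

lemma clearance_add_int (s₁ s₂ s : ℝ) (k : ℤ) :
    clearance P s₁ s₂ (s + k * P.L) = clearance P s₁ s₂ s := by
  have h : ∀ t, cdist P (s + k * P.L) t = cdist P s t := fun t => by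
    rw [cdist_comm, cdist_congr ⟨k, rfl⟩, cdist_comm]
  rw [clearance, clearance, h, h]

lemma clearance_congr {s₁ s₂ s₁' s₂' : ℝ} (h₁ : ∃ k : ℤ, s₁' = s₁ + k * P.L)
    (h₂ : ∃ k : ℤ, s₂' = s₂ + k * P.L) (s : ℝ) :
    clearance P s₁' s₂' s = clearance P s₁ s₂ s := by
  rw [clearance, clearance, cdist_congr h₁, cdist_congr h₂]

lemma tent_sub_le (A B s t : ℝ) : tent A B s - tent A B t ≤ |s - t| := by
  rw [sub_le_iff_le_add, tent, tent, ← min_add_add_left]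
  have := abs_le.1 (le_refl |s - t|)
  refine min_le_min ?_ ?_ <;> linarith [this.1, this.2]

lemma concaveOn_tent (A B : ℝ) : ConcaveOn ℝ univ (tent A B) := by
  refine ConcaveOn.inf (f := fun s => s - A) (g := fun s => B - s) ?_ ?_
  · exact ⟨convex_univ, fun x _ y _ p q _ _ h => by
      obtain rfl : q = 1 - p := by linarith
      exact le_of_eq (by simp only [smul_eq_mul]; ring)⟩
  · exact ⟨convex_univ, fun x _ y _ p q _ _ h => by
      obtain rfl : q = 1 - p := by linarith
      exact le_of_eq (by simp only [smul_eq_mul]; ring)⟩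

/-- Between two adjacent defenders the clearance is a tent function. -/
lemma clearance_eq_tent {A B s : ℝ} (h : B ≤ A + P.L) (hs : s ∈ Icc A B) :
    clearance P A B s = tent A B s := by
  have h2 : cdist P s B = min (s - (B - P.L)) (B - s) := by
    rw [cdist_congr (t := B - P.L) ⟨1, by push_cast; ring⟩,
      cdist_eq (by linarith [hs.1]) (by linarith [hs.2]), sub_add_cancel]
  rw [clearance, cdist_eq hs.1 (by linarith [hs.2]), h2, tent, min_min_min_comm,
    min_eq_left (show s - A ≤ s - (B - P.L) by linarith),
    min_eq_right (show B - s ≤ A + P.L - s by linarith)]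

/-- `A` and `B` are positions of the two defenders, `A` on the clockwise side. -/
def Adjacent (P : Target) (s₁ s₂ A B : ℝ) : Prop :=
  B ≤ A + P.L ∧ (((∃ k : ℤ, A = s₁ + k * P.L) ∧ ∃ k : ℤ, B = s₂ + k * P.L) ∨
    (B < A + P.L ∧ (∃ k : ℤ, A = s₂ + k * P.L) ∧ ∃ k : ℤ, B = s₁ + k * P.L))

lemma Adjacent.clearance_eq {s₁ s₂ A B : ℝ} (h : Adjacent P s₁ s₂ A B) (s : ℝ) :
    clearance P s₁ s₂ s = clearance P A B s := by
  rcases h.2 with h' | h'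
  · exact (clearance_congr h'.1 h'.2 s).symm
  · rw [clearance_comm, clearance_congr h'.2.1 h'.2.2]

lemma exists_adjacent {s₁ s₂ s : ℝ} (h : 0 < clearance P s₁ s₂ s) :
    ∃ A B, Adjacent P s₁ s₂ A B ∧ s ∈ Ioo A B := by
  have key : ∀ t, 0 < cdist P s t → ∃ k : ℤ, t + k * P.L ∈ Ioo (s - P.L) s := fun t ht => by
    obtain ⟨k, hk⟩ := exists_int_add_mem_Ico P (s - P.L) t
    refine ⟨k, lt_of_le_of_ne hk.1 fun h0 => ?_, by linarith [hk.2]⟩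
    exact ht.ne' (cdist_eq_zero_iff.2 ⟨k + 1, by push_cast; linarith⟩)
  rw [clearance, lt_min_iff] at h
  obtain ⟨k, hk⟩ := key s₁ h.1
  obtain ⟨l, hl⟩ := key s₂ h.2
  -- Of the two representatives in the period below `s`, the nearer one becomes `A`, and the other
  -- one, moved on by `L`, becomes `B`. Coinciding defenders fall into the first case, where `B = A
  -- + L` is allowed.
  rcases le_or_gt (s₂ + l * P.L) (s₁ + k * P.L) with hle | hlt
  · exact ⟨s₁ + k * P.L, s₂ + l * P.L + P.L, ⟨by linarith, Or.inl ⟨⟨k, rfl⟩, l + 1, by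
      push_cast; ring⟩⟩, hk.2, by linarith [hl.1]⟩
  · exact ⟨s₂ + l * P.L, s₁ + k * P.L + P.L, ⟨by linarith, Or.inr ⟨by linarith, ⟨l, rfl⟩, k + 1, by
      push_cast; ring⟩⟩, hl.2, by linarith [hk.1]⟩

end Clearance

/-! ### The margin, its Lipschitz estimates and the regularity of the heading -/

section Margin

variable {P : Target} {ν : ℝ} {x y : Plane} {a b a' b' s₁ s₂ : ℝ}

/-- Points that the intruder reaches before the defenders are not separated by a defender. -/
lemma mem_Ioo_of_clearance (h : Chart P x a b) (hν : 0 < ν) (hν' : ν ≤ 1) {A B s t : ℝ}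
    (hAB : B ≤ A + P.L) (hs : s ∈ Icc a b) (ht : t ∈ Icc a b) (hsAB : s ∈ Ioo A B)
    (hs0 : dist (P.γ s) x / ν < clearance P A B s)
    (ht0 : dist (P.γ t) x / ν < clearance P A B t) : t ∈ Ioo A B := by
  have hA : clearance P A B A = 0 := by
    rw [clearance_eq_tent hAB (left_mem_Icc.2 (hsAB.1.trans hsAB.2).le), tent, sub_self,
      min_eq_left (by linarith [hsAB.1, hsAB.2])]
  have hB : clearance P A B B = 0 := by
    rw [clearance_eq_tent hAB (right_mem_Icc.2 (hsAB.1.trans hsAB.2).le), tent, sub_self,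
      min_eq_right (by linarith [hsAB.1, hsAB.2])]
  have h1 := h.abs_sub_le_dist_add_dist hs ht
  have h2 : dist (P.γ s) x ≤ dist (P.γ s) x / ν := le_div_self dist_nonneg hν hν'
  have h3 : dist (P.γ t) x ≤ dist (P.γ t) x / ν := le_div_self dist_nonneg hν hν'
  constructor
  -- The clearance vanishes at `A`, so each of the two points is farther from `A` along the
  -- perimeter than from `x` in the plane. On opposite sides of `A` they would be farther apart than
  -- the way through `x`.
  · by_contra hle
    push Not at hle
    have h4 := clearance_sub_le (P := P) A B s A
    have h5 := clearance_sub_le (P := P) A B t A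
    rw [hA, sub_zero, abs_of_pos (by linarith [hsAB.1])] at h4
    rw [hA, sub_zero, abs_of_nonpos (by linarith)] at h5
    rw [abs_of_nonpos (by linarith [hsAB.1])] at h1
    linarith
  · by_contra hle
    push Not at hle
    have h4 := clearance_sub_le (P := P) A B s B
    have h5 := clearance_sub_le (P := P) A B t B
    rw [hB, sub_zero, abs_of_neg (by linarith [hsAB.2])] at h4
    rw [hB, sub_zero, abs_of_nonneg (by linarith)] at h5
    rw [abs_of_nonneg (by linarith [hsAB.2])] at h1
    linarith

/-- Outside `[A, B]` the tent is at most zero and cannot compete with a positive lead. The tent is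
concave, which the clearance need not be; this gives access to `IsOpt.unique` and `IsOpt.backward`.
-/
lemma IsOpt.tent_of_clearance (hν : 0 < ν) {A B s : ℝ}
    (hAB : B ≤ A + P.L) (hs : IsOpt P ν (clearance P A B) x a b s) (hsAB : s ∈ Ioo A B)
    (hpos : dist (P.γ s) x / ν < clearance P A B s) : IsOpt P ν (tent A B) x a b s := by
  refine ⟨hs.1, fun t ht => ?_⟩
  rw [← clearance_eq_tent hAB (Ioo_subset_Icc_self hsAB)]
  by_cases hmem : t ∈ Icc A B
  · rw [← clearance_eq_tent hAB hmem]; exact hs.2 t ht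
  · have h1 : tent A B t ≤ 0 := by
      rw [mem_Icc, not_and_or, not_le, not_le] at hmem
      rcases hmem with h | h
      · exact (min_le_left _ _).trans (by linarith)
      · exact (min_le_right _ _).trans (by linarith)
    have h2 : 0 ≤ dist (P.γ t) x / ν := div_nonneg dist_nonneg hν.le
    linarith

lemma mem_Ioo_of_tent_pos {A B s d : ℝ} (hd : 0 ≤ d) (h : d < tent A B s) : s ∈ Ioo A B := by
  rw [tent, lt_min_iff] at h
  exact ⟨by linarith, by linarith⟩

/-- A competitor with a positive lead lies between the same two defenders by `mem_Ioo_of_clearance`,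
where clearance and tent agree. -/
lemma IsOpt.clearance_of_tent (h : Chart P x a b) (hν : 0 < ν) (hν' : ν ≤ 1) {A B s : ℝ}
    (hAB : B ≤ A + P.L) (hs : IsOpt P ν (tent A B) x a b s)
    (hpos : dist (P.γ s) x / ν < tent A B s) : IsOpt P ν (clearance P A B) x a b s := by
  have hsAB := mem_Ioo_of_tent_pos (div_nonneg dist_nonneg hν.le) hpos
  have hs' := clearance_eq_tent hAB (Ioo_subset_Icc_self hsAB)
  refine ⟨hs.1, fun t ht => ?_⟩
  rcases le_or_gt (clearance P A B t) (dist (P.γ t) x / ν) with h1 | h1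
  · rw [hs']; linarith
  · have := mem_Ioo_of_clearance h hν hν' hAB hs.1 ht hsAB (by rwa [hs']) h1
    rw [hs', clearance_eq_tent hAB (Ioo_subset_Icc_self this)]
    exact hs.2 t ht

variable (P ν) in
/-- The largest lead with which the intruder can reach a visible perimeter point. -/
noncomputable def margin (s₁ s₂ : ℝ) (x : Plane) : ℝ :=
  sSup ((fun s => clearance P s₁ s₂ s - dist (P.γ s) x / ν) '' visible P x)

lemma IsOpt.margin_eq (h : Chart P x a b) {s : ℝ}
    (hs : IsOpt P ν (clearance P s₁ s₂) x a b s) :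
    margin P ν s₁ s₂ x = clearance P s₁ s₂ s - dist (P.γ s) x / ν := by
  refine IsGreatest.csSup_eq ⟨⟨s, h.visible_of_mem hs.1, rfl⟩, ?_⟩
  rintro _ ⟨t, ht, rfl⟩
  obtain ⟨k, hk⟩ := h.exists_mem ht
  have := hs.2 _ hk
  rwa [clearance_add_int, γ_add_int] at this

lemma exists_isOpt_clearance (ν : ℝ) (h : Chart P x a b) (s₁ s₂ : ℝ) :
    ∃ s, IsOpt P ν (clearance P s₁ s₂) x a b s :=
  exists_isOpt h.le (continuous_of_sub_le (clearance_sub_le s₁ s₂))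

lemma margin_sub_le_of_linked (hν : 0 < ν) (hν' : ν ≤ 1) {ℓ : ℝ} (h : Chart P x a b)
    (h' : Chart P y a' b') (hl : Reach P ℓ x a b y a' b') :
    margin P ν s₁ s₂ x - ℓ / ν ≤ margin P ν s₁ s₂ y := by
  obtain ⟨s, hs⟩ := exists_isOpt_clearance ν h s₁ s₂
  obtain ⟨s', hs'⟩ := exists_isOpt_clearance ν h' s₁ s₂
  rw [hs.margin_eq h, hs'.margin_eq h']
  exact hl.opt_le hν hν' (clearance_sub_le s₁ s₂) hs.1 hs'

/-- The margin is Lipschitz continuous along segments outside the target. -/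
lemma margin_sub_le (hν : 0 < ν) (hν' : ν ≤ 1)
    (hseg : ∀ z ∈ segment ℝ x y, z ∉ interior P.region) :
    margin P ν s₁ s₂ x - dist x y / ν ≤ margin P ν s₁ s₂ y := by
  obtain ⟨a, b, h⟩ := exists_chart (hseg x (left_mem_segment _ _ _))
  obtain ⟨a', b', h', hl⟩ := exists_linked_of_segment h hseg
  exact margin_sub_le_of_linked hν hν' h h' hl.1

lemma margin_sub_le' {s₁' s₂' δ : ℝ} (hx : x ∉ interior P.region) (h₁ : |s₁' - s₁| ≤ δ)
    (h₂ : |s₂' - s₂| ≤ δ) : margin P ν s₁ s₂ x - δ ≤ margin P ν s₁' s₂' x := by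
  obtain ⟨a, b, h⟩ := exists_chart hx
  obtain ⟨s, hs⟩ := exists_isOpt_clearance ν h s₁ s₂
  obtain ⟨s', hs'⟩ := exists_isOpt_clearance ν h s₁' s₂'
  rw [hs.margin_eq h, hs'.margin_eq h]
  have := hs'.2 s hs.1
  have := clearance_sub_le' (P := P) h₁ h₂ s
  linarith

/-- `e` is the direction from `x` to an optimal perimeter point at distance `R`. -/
structure IsHeading (P : Target) (ν s₁ s₂ : ℝ) (x e : Plane) (R : ℝ) : Prop where
  pos : 0 < R
  norm_eq : ‖e‖ = 1
  exists_opt : ∃ a b s, Chart P x a b ∧ IsOpt P ν (clearance P s₁ s₂) x a b s ∧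
    P.γ s = x + R • e

lemma exists_isHeading (ν : ℝ) (hx : x ∉ P.region) (s₁ s₂ : ℝ) :
    ∃ e R, IsHeading P ν s₁ s₂ x e R := by
  obtain ⟨a, b, h⟩ := exists_chart (fun h => hx (interior_subset h))
  obtain ⟨s, hs⟩ := exists_isOpt_clearance ν h s₁ s₂
  have hR : 0 < ‖P.γ s - x‖ := norm_pos_iff.2 (Chart.γ_sub_ne hx s)
  refine ⟨‖P.γ s - x‖⁻¹ • (P.γ s - x), ‖P.γ s - x‖, hR, ?_, a, b, s, h, hs, ?_⟩
  · rw [norm_smul, norm_inv, norm_norm, inv_mul_cancel₀ hR.ne']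
  · rw [smul_smul, mul_inv_cancel₀ hR.ne', one_smul, add_sub_cancel]

namespace IsHeading

variable {e : Plane} {R : ℝ}

lemma dist_eq (h : IsHeading P ν s₁ s₂ x e R) {s : ℝ} (hs : P.γ s = x + R • e) :
    dist (P.γ s) x = R := by
  rw [dist_eq_norm, hs, add_sub_cancel_left, norm_smul, h.norm_eq, mul_one,
    Real.norm_of_nonneg h.pos.le]

lemma infDist_le (h : IsHeading P ν s₁ s₂ x e R) : Metric.infDist x P.region ≤ R := by
  obtain ⟨a, b, s, -, -, hs⟩ := h.exists_opt
  rw [← h.dist_eq hs, dist_comm]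
  exact Metric.infDist_le_dist_of_mem (γ_mem P s)

/-- Moving straight ahead increases the margin at the highest possible rate. -/
lemma margin_forward (h : IsHeading P ν s₁ s₂ x e R) (hx : x ∉ P.region) (hν : 0 < ν)
    (hν' : ν ≤ 1) {q : ℝ} (hq0 : 0 ≤ q) (hq : q < R) :
    margin P ν s₁ s₂ (x + q • e) = margin P ν s₁ s₂ x + q / ν ∧
      IsHeading P ν s₁ s₂ (x + q • e) e (R - q) ∧ x + q • e ∉ P.region := by
  obtain ⟨a, b, s, hc, hs, hγ⟩ := h.exists_opt
  have hR := h.pos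
  have hr : q / R ∈ Ico (0 : ℝ) 1 := ⟨by positivity, (div_lt_one hR).2 hq⟩
  have hz : x + q • e = x + (q / R) • (P.γ s - x) := by
    rw [hγ, add_sub_cancel_left, smul_smul, div_mul_cancel₀ _ hR.ne']
  have hzT : x + q • e ∉ P.region := by rw [hz]; exact hc.sees hx hs.1 _ hr.1 hr.2
  have hvis := mem_visible_of_ray hx (hc.visible_of_mem hs.1) hr
  rw [← hz] at hvis
  obtain ⟨a', b', hc', hs'⟩ := exists_chart_mem (fun h' => hzT (interior_subset h')) hvis
  have hopt := hs.forward hc hx hν hν' (clearance_sub_le s₁ s₂) hr hz hc' hs'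
  have hγ' : P.γ s = x + q • e + (R - q) • e := by rw [hγ]; module
  have hh : IsHeading P ν s₁ s₂ (x + q • e) e (R - q) :=
    ⟨by linarith, h.norm_eq, a', b', s, hc', hopt, hγ'⟩
  refine ⟨?_, hh, hzT⟩
  rw [hopt.margin_eq hc', hs.margin_eq hc, h.dist_eq hγ, hh.dist_eq hγ']
  ring

/-- Receding from the optimal point decreases the margin at the highest possible rate. -/
lemma margin_backward (h : IsHeading P ν s₁ s₂ x e R) (hx : x ∉ P.region) (hν : 0 < ν)
    (hν' : ν ≤ 1) {q : ℝ} (hq0 : 0 ≤ q) (hq : q / ν < margin P ν s₁ s₂ x) :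
    margin P ν s₁ s₂ (x - q • e) = margin P ν s₁ s₂ x - q / ν := by
  obtain ⟨a, b, s, hc, hs, hγ⟩ := h.exists_opt
  have hR := h.pos
  have hmx := hs.margin_eq hc
  rw [h.dist_eq hγ] at hmx
  have hz : x - q • e = x + (-(q / R)) • (P.γ s - x) := by
    rw [hγ, add_sub_cancel_left, smul_smul, neg_mul, div_mul_cancel₀ _ hR.ne']; module
  have hr : 0 ≤ q / R := by positivity
  have hzT : x - q • e ∉ P.region := by rw [hz]; exact not_mem_of_backward hx hr
  have hvis := mem_visible_backward hx hr (hc.visible_of_mem hs.1)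
  rw [← hz] at hvis
  obtain ⟨a', b', hc', hs'⟩ := exists_chart_mem (fun h' => hzT (interior_subset h')) hvis
  have hqν : 0 ≤ q / ν := by positivity
  have hRν : 0 ≤ R / ν := by positivity
  obtain ⟨A, B, hadj, hsAB⟩ := exists_adjacent (P := P) (s₁ := s₁) (s₂ := s₂) (s := s) (by linarith)
  -- `IsOpt.backward` needs a concave function, so the argument passes to the tent and back. The
  -- bound on `q` keeps the lead positive at the new point, which the way back requires.
  have hfun : clearance P s₁ s₂ = clearance P A B := funext hadj.clearance_eq
  rw [hfun] at hs hmx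
  have htent := hs.tent_of_clearance hν hadj.1 hsAB (by rw [h.dist_eq hγ]; linarith)
  have hb := htent.backward hc hx hν (concaveOn_tent A B) hr hz hc' hs'
  have hd : dist (P.γ s) (x - q • e) = R + q := by
    rw [dist_eq_norm, hγ, show x + R • e - (x - q • e) = (R + q) • e by module, norm_smul,
      h.norm_eq, mul_one, Real.norm_of_nonneg (by linarith)]
  have heq := clearance_eq_tent hadj.1 (Ioo_subset_Icc_self hsAB)
  have hb' := hb.clearance_of_tent hc' hν hν' hadj.1 (by rw [hd, ← heq, add_div]; linarith)
  rw [← hfun] at hb' hmx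
  rw [hb'.margin_eq hc', hd, hmx, add_div]
  ring

end IsHeading

/-- Two straight lines along which a function has slope one, up to `η`, the function being Lipschitz
continuous with constant one. -/
lemma norm_sub_sq_le_of_slope {E : Type*} [NormedAddCommGroup E] [InnerProductSpace ℝ E]
    {x x' e e' : E} {R Δ η : ℝ} (hR : 0 < R) (he : ‖e‖ = 1) (he' : ‖e'‖ = 1)
    (h1 : 2 * R + Δ - η ≤ dist (x - R • e) (x' + R • e'))
    (h2 : 2 * R - Δ - η ≤ dist (x' - R • e') (x + R • e)) :
    ‖e - e'‖ ^ 2 ≤ (dist x x' / R) ^ 2 + 4 * η / R := by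
  set S := R • (e + e')
  set d := x' - x
  have hd : dist x x' = ‖d‖ := by rw [dist_comm, dist_eq_norm]
  have e1 : dist (x - R • e) (x' + R • e') = ‖S + d‖ := by
    rw [dist_comm, dist_eq_norm]; congr 1; simp only [S, d]; module
  have e2 : dist (x' - R • e') (x + R • e) = ‖S - d‖ := by
    rw [dist_comm, dist_eq_norm]; congr 1; simp only [S, d]; module
  rw [e1] at h1
  rw [e2] at h2
  -- The two crossing distances are `‖S + d‖` and `‖S - d‖` with sum at least `4 R - 2 η`. This
  -- forces `‖e + e'‖` close to `2`, hence `e` close to `e'`.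
  have hpar := parallelogram_law_with_norm ℝ S d
  have hpar2 := parallelogram_law_with_norm ℝ e e'
  have hS : ‖S‖ = R * ‖e + e'‖ := by rw [norm_smul, Real.norm_of_nonneg hR.le]
  rw [he, he'] at hpar2
  rw [hS] at hpar
  have hkey : R ^ 2 * ‖e - e'‖ ^ 2 ≤ ‖d‖ ^ 2 + 4 * R * η := by
    -- For larger `η` the trivial bound `‖e - e'‖ ^ 2 ≤ 4` suffices.
    rcases le_or_gt η (2 * R) with h | h
    · have h3 : (4 * R - 2 * η) ^ 2 ≤ (‖S + d‖ + ‖S - d‖) ^ 2 :=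
        pow_le_pow_left₀ (by linarith) (by linarith) 2
      nlinarith [sq_nonneg (‖S + d‖ - ‖S - d‖), sq_nonneg η]
    · have h4 : ‖e - e'‖ * ‖e - e'‖ ≤ 4 := by nlinarith [mul_self_nonneg ‖e + e'‖]
      nlinarith [sq_nonneg ‖d‖]
  rw [hd, div_pow]
  have : ‖d‖ ^ 2 / R ^ 2 + 4 * η / R = (‖d‖ ^ 2 + 4 * R * η) / R ^ 2 := by field_simp
  rw [this, le_div_iff₀ (by positivity)]
  linarith

lemma segment_not_mem_interior {x₀ x y : Plane} {D : ℝ} (hD : D ≤ Metric.infDist x₀ P.region)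
    (hx : dist x x₀ < D) (hy : dist y x₀ < D) :
    ∀ z ∈ segment ℝ x y, z ∉ interior P.region := by
  intro z hz hi
  have h1 := (convex_ball x₀ D).segment_subset (Metric.mem_ball.2 hx) (Metric.mem_ball.2 hy) hz
  rw [Metric.mem_ball, dist_comm] at h1
  have := Metric.infDist_le_dist_of_mem (x := x₀) (interior_subset hi)
  linarith

/-- Regularity of the optimal heading. -/
lemma IsHeading.norm_sub_sq_le (hν : 0 < ν) (hν' : ν ≤ 1) {s₁' s₂' δ R₀ R R' : ℝ}
    {x₀ x x' e e' : Plane} (hR₀ : 0 < R₀) (hinf : 4 * R₀ ≤ Metric.infDist x₀ P.region)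
    (hx : dist x x₀ < R₀) (hx' : dist x' x₀ < R₀)
    (h : IsHeading P ν s₁ s₂ x e R) (h' : IsHeading P ν s₁' s₂' x' e' R')
    (hm : R₀ / ν < margin P ν s₁ s₂ x) (hm' : R₀ / ν < margin P ν s₁' s₂' x')
    (h₁ : |s₁' - s₁| ≤ δ) (h₂ : |s₂' - s₂| ≤ δ) :
    ‖e - e'‖ ^ 2 ≤ (dist x x' / R₀) ^ 2 + 4 * (ν * δ) / R₀ := by
  have hδ : 0 ≤ δ := (abs_nonneg _).trans h₁
  have notmem : ∀ z, dist z x₀ < R₀ → z ∉ P.region := fun z hz hzT => by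
    have := Metric.infDist_le_dist_of_mem (x := x₀) hzT
    rw [dist_comm] at hz; linarith
  have large : ∀ {z : Plane} {t₁ t₂ e R}, dist z x₀ < R₀ → IsHeading P ν t₁ t₂ z e R → R₀ < R :=
    fun {z t₁ t₂ e R} hz hh => by
      have h1 := hh.infDist_le
      have h2 := Metric.infDist_le_infDist_add_dist (s := P.region) (x := x₀) (y := z)
      rw [dist_comm] at h2
      linarith
  have hxT := notmem x hx
  have hxT' := notmem x' hx'
  -- The margin has slope exactly `1 / ν` on the lines of length `2 R₀` through `x` and `x'`. Its
  -- Lipschitz bound between the rear end of one and the front end of the other gives the two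
  -- distance estimates; different defender positions cost `δ` in margin, that is `ν δ` in distance.
  -- All four ends stay within `2 R₀` of `x₀`, away from the target.
  have f1 := (h.margin_forward hxT hν hν' hR₀.le (large hx h)).1
  have f2 := (h'.margin_forward hxT' hν hν' hR₀.le (large hx' h')).1
  have b1 := h.margin_backward hxT hν hν' hR₀.le hm
  have b2 := h'.margin_backward hxT' hν hν' hR₀.le hm'
  have ball : ∀ {z v : Plane}, dist z x₀ < R₀ → ‖v‖ = 1 →
      dist (z + R₀ • v) x₀ < 2 * R₀ ∧ dist (z - R₀ • v) x₀ < 2 * R₀ := fun {z v} hz hv => by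
    have e1 : dist (z + R₀ • v) z = R₀ := by
      rw [dist_eq_norm, add_sub_cancel_left, norm_smul, hv, mul_one, Real.norm_of_nonneg hR₀.le]
    have e2 : dist (z - R₀ • v) z = R₀ := by
      rw [dist_eq_norm, sub_sub_cancel_left, norm_neg, norm_smul, hv, mul_one,
        Real.norm_of_nonneg hR₀.le]
    have t1 := dist_triangle (z + R₀ • v) z x₀
    have t2 := dist_triangle (z - R₀ • v) z x₀
    constructor <;> linarith
  have hb := ball hx h.norm_eq
  have hb' := ball hx' h'.norm_eq
  have hseg1 := segment_not_mem_interior (P := P) (D := 2 * R₀) (by linarith) hb.2 hb'.1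
  have hseg2 := segment_not_mem_interior (P := P) (D := 2 * R₀) (by linarith) hb'.2 hb.1
  have l1 := margin_sub_le (s₁ := s₁') (s₂ := s₂') hν hν' (x := x' + R₀ • e') (y := x - R₀ • e)
    (by rwa [segment_symm])
  have l2 := margin_sub_le (s₁ := s₁) (s₂ := s₂) hν hν' (x := x + R₀ • e) (y := x' - R₀ • e')
    (by rwa [segment_symm])
  have hni : ∀ z, dist z x₀ < 2 * R₀ → z ∉ interior P.region := fun z hz hzT => by
    have := Metric.infDist_le_dist_of_mem (x := x₀) (interior_subset hzT)
    rw [dist_comm] at hz; linarith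
  have m1 := margin_sub_le' (ν := ν) (s₁ := s₁') (s₂ := s₂') (s₁' := s₁) (s₂' := s₂) (δ := δ)
    (hni _ hb.2) (by rwa [abs_sub_comm]) (by rwa [abs_sub_comm])
  have m2 := margin_sub_le' (ν := ν) (δ := δ) (hni _ hb'.2) h₁ h₂
  rw [b1] at m1
  rw [b2] at m2
  rw [f2] at l1
  rw [f1] at l2
  have hRν : R₀ / ν * ν = R₀ := div_mul_cancel₀ _ hν.ne'
  refine norm_sub_sq_le_of_slope hR₀
    (Δ := ν * (margin P ν s₁' s₂' x' - margin P ν s₁ s₂ x)) h.norm_eq h'.norm_eq ?_ ?_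
  · rw [dist_comm]
    have : dist (x' + R₀ • e') (x - R₀ • e) = dist (x' + R₀ • e') (x - R₀ • e) / ν * ν :=
      (div_mul_cancel₀ _ hν.ne').symm
    rw [this]
    nlinarith
  · rw [dist_comm]
    have : dist (x + R₀ • e) (x' - R₀ • e') = dist (x + R₀ • e) (x' - R₀ • e') / ν * ν :=
      (div_mul_cancel₀ _ hν.ne').symm
    rw [this]
    nlinarith

end Margin

end PerimeterDefense

namespace PerimeterDefense

open Filter Topology RealInnerProductSpace

/-! ### Representatives of arc lengths -/

section Arc

variable {P : Target}

lemma arc_eq {a b t : ℝ} (k : ℤ) (h : b - a = t + k * P.L) (h0 : 0 ≤ t) (h1 : t < P.L) :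
    arc P a b = t :=
  (toIcoMod_eq_iff P.L_pos).2 ⟨⟨h0, by linarith⟩, k, by rw [zsmul_eq_mul]; exact h⟩

lemma exists_arc_eq (P : Target) (a b : ℝ) :
    0 ≤ arc P a b ∧ arc P a b < P.L ∧ ∃ k : ℤ, b - a = arc P a b + k * P.L := by
  obtain ⟨h, k, hk⟩ := (toIcoMod_eq_iff P.L_pos).1 (rfl : arc P a b = arc P a b)
  exact ⟨h.1, by linarith [h.2], k, by rw [hk, zsmul_eq_mul]⟩

lemma gap_eq {a b t : ℝ} (k : ℤ) (h : b - a = t + k * P.L) (h0 : 0 < t) (h1 : t ≤ P.L) :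
    gap P a b = t :=
  (toIocMod_eq_iff P.L_pos).2 ⟨⟨h0, by linarith⟩, k, by rw [zsmul_eq_mul]; exact h⟩

lemma exists_gap_eq (P : Target) (a b : ℝ) :
    0 < gap P a b ∧ gap P a b ≤ P.L ∧ ∃ k : ℤ, b - a = gap P a b + k * P.L := by
  obtain ⟨h, k, hk⟩ := (toIocMod_eq_iff P.L_pos).1 (rfl : gap P a b = gap P a b)
  exact ⟨h.1, by linarith [h.2], k, by rw [hk, zsmul_eq_mul]⟩

lemma arc_congr {a b a' b' : ℝ} (ha : ∃ k : ℤ, a' = a + k * P.L) (hb : ∃ k : ℤ, b' = b + k * P.L) :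
    arc P a' b' = arc P a b := by
  obtain ⟨k, rfl⟩ := ha
  obtain ⟨l, rfl⟩ := hb
  obtain ⟨h0, h1, m, hm⟩ := exists_arc_eq P a b
  exact arc_eq (m + l - k) (by push_cast; linarith) h0 h1

lemma congr_refl (s : ℝ) : ∃ k : ℤ, s = s + k * P.L := ⟨0, by simp⟩

lemma congr_symm {s t : ℝ} (h : ∃ k : ℤ, t = s + k * P.L) : ∃ k : ℤ, s = t + k * P.L := by
  obtain ⟨k, rfl⟩ := h
  exact ⟨-k, by push_cast; ring⟩

lemma congr_trans {s t r : ℝ} (h : ∃ k : ℤ, t = s + k * P.L) (h' : ∃ k : ℤ, r = t + k * P.L) :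
    ∃ k : ℤ, r = s + k * P.L := by
  obtain ⟨k, rfl⟩ := h
  obtain ⟨l, rfl⟩ := h'
  exact ⟨k + l, by push_cast; ring⟩

lemma not_congr {s t : ℝ} (h1 : s < t) (h2 : t < s + P.L) : ¬ ∃ k : ℤ, t = s + k * P.L := by
  rintro ⟨k, hk⟩
  have hL := P.L_pos
  have : (0 : ℝ) < k := pos_of_mul_pos_left (b := P.L) (by linarith) hL.le
  have h3 : (k : ℝ) < 1 := lt_of_mul_lt_mul_right (a := P.L) (by linarith) hL.le
  have h4 : (0 : ℤ) < k := by exact_mod_cast this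
  have h5 : k < (1 : ℤ) := by exact_mod_cast h3
  omega

end Arc

/-- The visible part of the perimeter together with the left and the right breaching point. -/
structure Frame (P : Target) (ν : ℝ) (x : Plane) (a b ℓ r : ℝ) : Prop where
  chart : Chart P x a b
  left : IsOpt P ν (fun s => s) x a b ℓ
  right : IsOpt P ν (fun s => -s) x a b r

/-! ### Breaching points, feet, parts and the value function -/

section Frame

variable {P : Target} {ν : ℝ} {x : Plane} {a b ℓ r : ℝ}

lemma Chart.exists_frame (ν : ℝ) (h : Chart P x a b) : ∃ ℓ r, Frame P ν x a b ℓ r := by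
  obtain ⟨ℓ, hℓ⟩ := exists_isOpt (P := P) (ν := ν) (x := x) (c := fun s => s) h.le continuous_id
  obtain ⟨r, hr⟩ := exists_isOpt (P := P) (ν := ν) (x := x) (c := fun s => -s) h.le continuous_neg
  exact ⟨ℓ, r, h, hℓ, hr⟩

lemma exists_frame (ν : ℝ) (hx : x ∉ interior P.region) : ∃ a b ℓ r, Frame P ν x a b ℓ r := by
  obtain ⟨a, b, h⟩ := exists_chart hx
  exact ⟨a, b, h.exists_frame ν⟩

lemma concaveOn_self : ConcaveOn ℝ univ fun s : ℝ => s := concaveOn_id convex_univ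

lemma concaveOn_neg_self : ConcaveOn ℝ univ fun s : ℝ => -s := (convexOn_id convex_univ).neg

namespace Frame

variable (h : Frame P ν x a b ℓ r)
include h

lemma right_le_left : r ≤ ℓ := by
  have h1 := h.left.2 r h.right.1
  have h2 := h.right.2 ℓ h.left.1
  linarith

lemma left_lt : ℓ < r + P.L := by
  linarith [h.chart.lt, h.left.1.2, h.right.1.1]

/-- The left side is the position from which a defender moving counter-clockwise arrives at `ℓ`
together with the intruder; the right side is the analogue for `r`. The way from `r` through `x` to
`ℓ` is no shorter than the arc. -/
lemma lam_le_rho (hν : 0 < ν) (hν' : ν ≤ 1) :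
    ℓ - dist (P.γ ℓ) x / ν ≤ r + dist (P.γ r) x / ν := by
  have h1 := (le_abs_self _).trans (h.chart.abs_sub_le_dist_add_dist h.right.1 h.left.1)
  have h2 : dist (P.γ ℓ) x ≤ dist (P.γ ℓ) x / ν := le_div_self dist_nonneg hν hν'
  have h3 : dist (P.γ r) x ≤ dist (P.γ r) x / ν := le_div_self dist_nonneg hν hν'
  linarith

omit h in
/-- The perimeter point from which the afferent surface extends. -/
noncomputable def _root_.PerimeterDefense.base (P : Target) (ν : ℝ) (x : Plane) (ℓ r : ℝ) : ℝ :=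
  ((ℓ - dist (P.γ ℓ) x / ν) + (r + dist (P.γ r) x / ν)) / 2

lemma base_mem : base P ν x ℓ r ∈ Icc r ℓ := by
  have h1 := h.left.2 r h.right.1
  have h2 := h.right.2 ℓ h.left.1
  rw [base]
  constructor <;> linarith

omit h in
lemma exists_lift_not_visible (hc : Chart P x a b) {s : ℝ} (hs : s ∉ visible P x) :
    ∃ k : ℤ, b - P.L < s + k * P.L ∧ s + k * P.L < a := by
  obtain ⟨k, hk⟩ := exists_int_add_mem_Ico P (b - P.L) s
  rw [hc.mem_visible, not_exists] at hs
  refine ⟨k, lt_of_le_of_ne hk.1 fun h0 => ?_, ?_⟩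
  · refine hs (k + 1) ?_
    have : s + ((k + 1 : ℤ) : ℝ) * P.L = b := by push_cast; linarith
    rw [this]
    exact right_mem_Icc.2 hc.le
  · by_contra hge
    exact hs k ⟨not_lt.1 hge, by linarith [hk.2]⟩

omit h in
lemma exists_not_visible (hc : Chart P x a b) : ∃ s, s ∉ visible P x := by
  refine ⟨(b + a - P.L) / 2, fun hv => ?_⟩
  obtain ⟨k, hk⟩ := hc.exists_mem hv
  have hL := P.L_pos
  have h1 := hc.lt
  have h3 : (0 : ℝ) < k := pos_of_mul_pos_left (b := P.L) (by linarith [hk.1]) hL.le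
  have h4 : (k : ℝ) < 1 := lt_of_mul_lt_mul_right (a := P.L) (by linarith [hk.2]) hL.le
  have h5 : (0 : ℤ) < k := by exact_mod_cast h3
  have h6 : k < (1 : ℤ) := by exact_mod_cast h4
  omega

/-- A hidden defender has a representative in the gap before `a`, so on the chart its arc length to
`s` is `s` minus a constant. The maximizer is unique by strict concavity, so the chosen `sL` agrees
with `ℓ` up to periods. -/
lemma exists_sL (hν : 0 < ν) : ∃ k : ℤ, sL P ν x = ℓ + k * P.L := by
  have key : ∀ {sD s k m}, b - P.L < sD + (k : ℤ) * P.L → sD + k * P.L < a →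
      s + (m : ℤ) * P.L ∈ Icc a b →
      JL P ν s sD x = (s + m * P.L - dist (P.γ (s + m * P.L)) x / ν) - (sD + k * P.L) :=
    fun {sD s k m} h1 h2 h3 => by
      rw [JL, arc_eq (t := s + m * P.L - (sD + k * P.L)) (k - m) (by push_cast; ring)
        (by linarith [h3.1]) (by linarith [h3.2]), γ_add_int]
      ring
  have hex : IsLeftBreachingPoint P ν x ℓ := by
    refine ⟨h.chart.visible_of_mem h.left.1, fun sD hD s' hs' => ?_⟩
    obtain ⟨k, hk⟩ := exists_lift_not_visible h.chart hD
    obtain ⟨m, hm⟩ := h.chart.exists_mem hs'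
    rw [key hk.1 hk.2 hm, key (s := ℓ) (m := 0) hk.1 hk.2 (by simpa using h.left.1)]
    simpa using h.left.2 _ hm
  obtain ⟨hv, hopt⟩ := Classical.epsilon_spec ⟨ℓ, hex⟩
  change sL P ν x ∈ visible P x at hv
  obtain ⟨m, hm⟩ := h.chart.exists_mem hv
  obtain ⟨sD, hD⟩ := exists_not_visible h.chart
  obtain ⟨k, hk⟩ := exists_lift_not_visible h.chart hD
  have : IsOpt P ν (fun s => s) x a b (sL P ν x + m * P.L) := by
    refine ⟨hm, fun s' hs' => ?_⟩
    have := hopt sD hD s' (h.chart.visible_of_mem hs')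
    change JL P ν s' sD x ≤ JL P ν (sL P ν x) sD x at this
    rw [key hk.1 hk.2 hm, key (s := s') (m := 0) hk.1 hk.2 (by simpa using hs')] at this
    simpa using this
  have heq := this.unique h.chart hν concaveOn_self h.left
  exact ⟨-m, by push_cast; linarith⟩

lemma exists_sR (hν : 0 < ν) : ∃ k : ℤ, sR P ν x = r + k * P.L := by
  have key : ∀ {sD s k m}, b - P.L < sD + (k : ℤ) * P.L → sD + k * P.L < a →
      s + (m : ℤ) * P.L ∈ Icc a b →
      JR P ν s sD x =
        (-(s + m * P.L) - dist (P.γ (s + m * P.L)) x / ν) + (sD + k * P.L + P.L) :=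
    fun {sD s k m} h1 h2 h3 => by
      rw [JR, arc_eq (t := sD + k * P.L + P.L - (s + m * P.L)) (m - k - 1) (by push_cast; ring)
        (by linarith [h3.2]) (by linarith [h3.1]), γ_add_int]
      ring
  have hex : IsRightBreachingPoint P ν x r := by
    refine ⟨h.chart.visible_of_mem h.right.1, fun sD hD s' hs' => ?_⟩
    obtain ⟨k, hk⟩ := exists_lift_not_visible h.chart hD
    obtain ⟨m, hm⟩ := h.chart.exists_mem hs'
    rw [key hk.1 hk.2 hm, key (s := r) (m := 0) hk.1 hk.2 (by simpa using h.right.1)]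
    simpa using h.right.2 _ hm
  obtain ⟨hv, hopt⟩ := Classical.epsilon_spec ⟨r, hex⟩
  change sR P ν x ∈ visible P x at hv
  obtain ⟨m, hm⟩ := h.chart.exists_mem hv
  obtain ⟨sD, hD⟩ := exists_not_visible h.chart
  obtain ⟨k, hk⟩ := exists_lift_not_visible h.chart hD
  have : IsOpt P ν (fun s => -s) x a b (sR P ν x + m * P.L) := by
    refine ⟨hm, fun s' hs' => ?_⟩
    have := hopt sD hD s' (h.chart.visible_of_mem hs')
    change JR P ν s' sD x ≤ JR P ν (sR P ν x) sD x at this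
    rw [key hk.1 hk.2 hm, key (s := s') (m := 0) hk.1 hk.2 (by simpa using hs')] at this
    simpa using this
  have heq := this.unique h.chart hν concaveOn_neg_self h.right
  exact ⟨-m, by push_cast; linarith⟩

lemma JLstar_eq (hν : 0 < ν) (sD : ℝ) :
    JLstar P ν sD x = arc P sD ℓ - dist (P.γ ℓ) x / ν := by
  obtain ⟨k, hk⟩ := h.exists_sL hν
  rw [JLstar, JL, hk, arc_congr (congr_refl _) ⟨k, rfl⟩, γ_add_int]

lemma JRstar_eq (hν : 0 < ν) (sD : ℝ) :
    JRstar P ν sD x = arc P r sD - dist (P.γ r) x / ν := by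
  obtain ⟨k, hk⟩ := h.exists_sR hν
  rw [JRstar, JR, hk, arc_congr ⟨k, rfl⟩ (congr_refl _), γ_add_int]

/-- For a defender on the arc from `r` to `ℓ` both arc lengths are affine in its position, and
`J_L^* = J_R^*` is a linear equation whose only solution is the base. -/
lemma mem_afferent_iff (hν : 0 < ν) (sD : ℝ) :
    x ∈ afferent P ν sD ↔ ∃ k : ℤ, sD = base P ν x ℓ r + k * P.L := by
  have hrl := h.right_le_left
  have hlt := h.left_lt
  have hm := h.base_mem
  have e1 : arc P (sR P ν x) sD = arc P r sD := arc_congr (h.exists_sR hν) (congr_refl _)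
  have e2 : arc P (sR P ν x) (sL P ν x) = ℓ - r := by
    rw [arc_congr (h.exists_sR hν) (h.exists_sL hν)]
    exact arc_eq 0 (by simp) (by linarith) (by linarith)
  have e3 : ∀ k : ℤ, sD + k * P.L ∈ Icc r ℓ → arc P r sD = sD + k * P.L - r ∧
      arc P sD ℓ = ℓ - (sD + k * P.L) := fun k hk =>
    ⟨arc_eq (-k) (by push_cast; ring) (by linarith [hk.1]) (by linarith [hk.2]),
      arc_eq k (by ring) (by linarith [hk.2]) (by linarith [hk.1])⟩
  rw [afferent, mem_ofPred_eq, e1, e2, h.JLstar_eq hν, h.JRstar_eq hν]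
  constructor
  · rintro ⟨-, h1, h2⟩
    obtain ⟨h3, h4, k, hk⟩ := exists_arc_eq P r sD
    obtain ⟨e4, e5⟩ := e3 (-k) (by push_cast; constructor <;> linarith)
    rw [e4, e5] at h2
    refine ⟨k, ?_⟩
    push_cast at h2
    rw [base]
    linarith
  · rintro ⟨k, hk⟩
    have hk' : sD + ((-k : ℤ) : ℝ) * P.L = base P ν x ℓ r := by push_cast; linarith
    obtain ⟨e4, e5⟩ := e3 (-k) (by rwa [hk'])
    refine ⟨h.chart.not_mem_interior, ?_, ?_⟩
    · rw [e4, hk']; linarith [hm.2]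
    · rw [e4, e5, hk', base]; ring

lemma exists_foot (hν : 0 < ν) : ∃ k : ℤ, foot P ν x = base P ν x ℓ r + k * P.L :=
  (h.mem_afferent_iff hν _).1 <| Classical.epsilon_spec (p := fun s => x ∈ afferent P ν s)
    ⟨base P ν x ℓ r, (h.mem_afferent_iff hν _).2 ⟨0, by simp⟩⟩

lemma mem_part_iff (hν : 0 < ν) (s₁ s₂ : ℝ) :
    x ∈ part P ν s₁ s₂ ↔ ∃ A B, (∃ k : ℤ, A = s₁ + k * P.L) ∧ (∃ k : ℤ, B = s₂ + k * P.L) ∧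
      A < base P ν x ℓ r ∧ base P ν x ℓ r < B ∧ B ≤ A + P.L := by
  obtain ⟨k, hk⟩ := h.exists_foot hν
  rw [part, mem_ofPred_eq]
  constructor
  · rintro ⟨-, h1, h2⟩
    obtain ⟨-, -, m, hm⟩ := exists_arc_eq P s₁ (foot P ν x)
    obtain ⟨h3, h4, n, hn⟩ := exists_gap_eq P s₁ s₂
    refine ⟨base P ν x ℓ r - arc P s₁ (foot P ν x),
      base P ν x ℓ r - arc P s₁ (foot P ν x) + gap P s₁ s₂, ⟨m - k, ?_⟩, ⟨m - k - n, ?_⟩, ?_, ?_, ?_⟩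
    · push_cast; linarith
    · push_cast; linarith
    · linarith
    · linarith
    · linarith
  · rintro ⟨A, B, ⟨m, hm⟩, ⟨n, hn⟩, h1, h2, h3⟩
    have e1 : arc P s₁ (foot P ν x) = base P ν x ℓ r - A :=
      arc_eq (k + m) (by push_cast; linarith) (by linarith) (by linarith)
    have e2 : gap P s₁ s₂ = B - A :=
      gap_eq (m - n) (by push_cast; linarith) (by linarith) (by linarith)
    exact ⟨h.chart.not_mem_interior, by linarith, by linarith⟩

/-- In a part of the game space, `s_opt` maximizes the lead of the intruder. -/
lemma sOpt_spec (hν : 0 < ν) {s₁ s₂ A B : ℝ} (hA : ∃ k : ℤ, A = s₁ + k * P.L)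
    (hB : ∃ k : ℤ, B = s₂ + k * P.L) (h1 : A < base P ν x ℓ r) (h2 : base P ν x ℓ r < B)
    (h3 : B ≤ A + P.L) :
    ∃ s, IsOpt P ν (tent A B) x a b s ∧ P.γ (sOpt P ν s₁ s₂ x) = P.γ s ∧
      Vij P ν s₁ s₂ x = tent A B s - dist (P.γ s) x / ν := by
  have hL := P.L_pos
  have hm := h.base_mem
  have hrl := h.right_le_left
  have hlt := h.left_lt
  have hfoot := h.exists_foot hν
  obtain ⟨m, hm'⟩ := hA
  obtain ⟨n, hn⟩ := hB
  have eg : gap P s₁ s₂ = B - A :=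
    gap_eq (m - n) (by push_cast; linarith) (by linarith) (by linarith)
  have ea : ∀ s, arc P s₁ s = arc P A s := fun s => (arc_congr ⟨m, hm'⟩ (congr_refl _)).symm
  have eb : ∀ s, arc P s s₂ = arc P s B := fun s => (arc_congr (congr_refl _) ⟨n, hn⟩).symm
  have emid : ∃ k : ℤ, sMid P s₁ s₂ = (A + B) / 2 + k * P.L :=
    ⟨-m, by rw [sMid, eg]; push_cast; linarith⟩
  have e1 : arc P s₁ (foot P ν x) = base P ν x ℓ r - A := by
    rw [ea, arc_congr (congr_refl _) hfoot]; exact arc_eq 0 (by simp) (by linarith) (by linarith)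
  have e2 : arc P (foot P ν x) s₂ = B - base P ν x ℓ r := by
    rw [eb, arc_congr hfoot (congr_refl _)]; exact arc_eq 0 (by simp) (by linarith) (by linarith)
  have e3 : arc P s₁ (sL P ν x) = arc P A ℓ := by
    rw [ea, arc_congr (congr_refl _) (h.exists_sL hν)]
  have e4 : arc P (sR P ν x) s₂ = arc P r B := by
    rw [eb, arc_congr (h.exists_sR hν) (congr_refl _)]
  have e5 : arc P s₁ (sMid P s₁ s₂) = (B - A) / 2 := by
    rw [ea, arc_congr (congr_refl _) emid]; exact arc_eq 0 (by ring) (by linarith) (by linarith)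
  have e6 : arc P (sMid P s₁ s₂) s₂ = (B - A) / 2 := by
    rw [eb, arc_congr emid (congr_refl _)]; exact arc_eq 0 (by ring) (by linarith) (by linarith)
  have hI : x ∈ regionI P ν s₁ s₂ ↔ ℓ < (A + B) / 2 := by
    rw [regionI, mem_ofPred_eq, e1, e3, e5]
    -- If `ℓ` lies at or beyond `A + L`, its arc length from `A` wraps around and becomes small. The
    -- first inequality in `regionI` then fails, because `ℓ - L < r ≤ base`. The same happens at `r`
    -- below.
    rcases lt_or_ge ℓ (A + P.L) with hl | hl
    · rw [arc_eq (P := P) (a := A) (b := ℓ) (t := ℓ - A) 0 (by simp) (by linarith [hm.2])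
        (by linarith)]
      exact ⟨fun h => by linarith [h.2], fun h => ⟨by linarith [hm.2], by linarith⟩⟩
    · rw [arc_eq (P := P) (a := A) (b := ℓ) (t := ℓ - A - P.L) 1 (by push_cast; ring) (by linarith)
        (by linarith [hm.1])]
      exact ⟨fun h => by linarith [h.1, hm.1], fun h => by linarith⟩
  have hJ : x ∈ regionJ P ν s₁ s₂ ↔ (A + B) / 2 < r := by
    rw [regionJ, mem_ofPred_eq, e2, e4, e6]
    rcases lt_or_ge (B - P.L) r with hl | hl
    · rw [arc_eq (P := P) (a := r) (b := B) (t := B - r) 0 (by simp) (by linarith [hm.1])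
        (by linarith)]
      exact ⟨fun h => by linarith [h.2], fun h => ⟨by linarith [hm.1], by linarith⟩⟩
    · rw [arc_eq (P := P) (a := r) (b := B) (t := B - r - P.L) 1 (by push_cast; ring) (by linarith)
        (by linarith [hm.2])]
      exact ⟨fun h => by linarith [h.1, hm.2], fun h => by linarith⟩
  -- The tent lies below both `s - A` and `B - s`. A maximizer `ℓ` for the rising branch that is
  -- left of the peak therefore maximizes for the tent, likewise `r` right of the peak. Otherwise `r
  -- ≤ (A + B) / 2 ≤ ℓ`, and concavity makes the objective increase up to the peak and decrease
  -- after it.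
  by_cases hi : x ∈ regionI P ν s₁ s₂
  · have hl := hI.1 hi
    have ht : tent A B ℓ = ℓ - A := min_eq_left (by linarith)
    refine ⟨ℓ, ⟨h.left.1, fun t htm => ?_⟩, ?_, ?_⟩
    · have h4 := h.left.2 t htm
      have h5 : tent A B t ≤ t - A := min_le_left _ _
      rw [ht]; linarith
    · obtain ⟨k, hk⟩ := h.exists_sL hν
      rw [sOpt, if_pos hi, hk, γ_add_int]
    · rw [Vij, if_pos hi, h.JLstar_eq hν, ea, ht,
        arc_eq (P := P) (a := A) (b := ℓ) (t := ℓ - A) 0 (by simp) (by linarith [hm.2])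
        (by linarith)]
  by_cases hj : x ∈ regionJ P ν s₁ s₂
  · have hr := hJ.1 hj
    have ht : tent A B r = B - r := min_eq_right (by linarith)
    refine ⟨r, ⟨h.right.1, fun t htm => ?_⟩, ?_, ?_⟩
    · have h4 := h.right.2 t htm
      have h5 : tent A B t ≤ B - t := min_le_right _ _
      rw [ht]; linarith
    · obtain ⟨k, hk⟩ := h.exists_sR hν
      rw [sOpt, if_neg hi, if_pos hj, hk, γ_add_int]
    · rw [Vij, if_neg hi, if_pos hj, h.JRstar_eq hν, eb, ht,
        arc_eq (P := P) (a := r) (b := B) (t := B - r) 0 (by simp) (by linarith [hm.1])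
        (by linarith)]
  rw [hI, not_lt] at hi
  have hi' : x ∉ regionI P ν s₁ s₂ := fun h' => by linarith [hI.1 h']
  rw [hJ, not_lt] at hj
  have hj' : x ∉ regionJ P ν s₁ s₂ := fun h' => by linarith [hJ.1 h']
  have ht : tent A B ((A + B) / 2) = (B - A) / 2 := by
    rw [tent, min_eq_left (by linarith)]; ring
  obtain ⟨k, hk⟩ := emid
  refine ⟨(A + B) / 2, ⟨⟨h.right.1.1.trans hj, hi.trans h.left.1.2⟩, fun t htm => ?_⟩, ?_, ?_⟩
  · rw [ht]
    rcases le_total t ((A + B) / 2) with hle | hle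
    · have h4 := (strictConcaveOn_obj h.chart hν concaveOn_self).concaveOn.min_le_of_mem_Icc
        htm h.left.1 ⟨hle, hi⟩
      rw [min_eq_left (h.left.2 t htm)] at h4
      have h5 : tent A B t ≤ t - A := min_le_left _ _
      linarith
    · have h4 := (strictConcaveOn_obj h.chart hν concaveOn_neg_self).concaveOn.min_le_of_mem_Icc
        h.right.1 htm ⟨hj, hle⟩
      rw [min_eq_right (h.right.2 t htm)] at h4
      have h5 : tent A B t ≤ B - t := min_le_right _ _
      linarith
  · rw [sOpt, if_neg hi', if_neg hj', hk, γ_add_int]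
  · rw [Vij, if_neg hi', if_neg hj', Jmid, eg, hk, γ_add_int, ht]

lemma lam_base_rho (hν : 0 < ν) (hν' : ν ≤ 1) :
    ℓ - dist (P.γ ℓ) x / ν ≤ base P ν x ℓ r ∧ base P ν x ℓ r ≤ r + dist (P.γ r) x / ν := by
  have := h.lam_le_rho hν hν'
  rw [base]
  constructor <;> linarith

/-- If the margin is positive, the intruder is between two adjacent defenders. -/
lemma exists_adjacent_of_margin_pos (hν : 0 < ν) {s₁ s₂ : ℝ} (hm : 0 < margin P ν s₁ s₂ x) :
    ∃ A B s, Adjacent P s₁ s₂ A B ∧ A < ℓ - dist (P.γ ℓ) x / ν ∧ r + dist (P.γ r) x / ν < B ∧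
      IsOpt P ν (tent A B) x a b s ∧ IsOpt P ν (clearance P s₁ s₂) x a b s := by
  obtain ⟨s, hs⟩ := exists_isOpt_clearance ν h.chart s₁ s₂
  rw [hs.margin_eq h.chart] at hm
  have hd : 0 ≤ dist (P.γ s) x / ν := div_nonneg dist_nonneg hν.le
  obtain ⟨A, B, hadj, hsAB⟩ := exists_adjacent (P := P) (s₁ := s₁) (s₂ := s₂) (s := s) (by linarith)
  have hfun : clearance P s₁ s₂ = clearance P A B := funext hadj.clearance_eq
  have hs' := hs
  rw [hfun] at hs' hm
  have htent := clearance_eq_tent hadj.1 (Ioo_subset_Icc_self hsAB)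
  have hpos : dist (P.γ s) x / ν < tent A B s := by linarith
  have h1 := h.left.2 s hs.1
  have h2 := h.right.2 s hs.1
  rw [tent, lt_min_iff] at hpos
  exact ⟨A, B, s, hadj, by linarith, by linarith,
    hs'.tent_of_clearance hν hadj.1 hsAB (by linarith), hs⟩

end Frame

/-- A positive margin puts `A` strictly below `lam` and `B` strictly above `rho`, the two bounds of
`Frame.lam_base_rho`. The base lies between these, so it differs from both defenders. -/
lemma not_captured_of_margin_pos (hν : 0 < ν) (hν' : ν ≤ 1) (hx : x ∉ interior P.region)
    {s₁ s₂ : ℝ} (hm : 0 < margin P ν s₁ s₂ x) : ¬ Captured P ν s₁ s₂ x := by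
  obtain ⟨a, b, ℓ, r, h⟩ := exists_frame ν hx
  obtain ⟨A, B, s, hadj, hA, hB, -⟩ := h.exists_adjacent_of_margin_pos hν hm
  obtain ⟨h1, h2⟩ := h.lam_base_rho hν hν'
  have hAB := hadj.1
  have nA : ¬ ∃ k : ℤ, base P ν x ℓ r = A + k * P.L := not_congr (by linarith) (by linarith)
  have nB : ¬ ∃ k : ℤ, B = base P ν x ℓ r + k * P.L := not_congr (by linarith) (by linarith)
  rw [Captured, h.mem_afferent_iff hν, h.mem_afferent_iff hν]
  rintro (hc | hc) <;> rcases hadj.2 with ⟨ha, hb⟩ | ⟨-, ha, hb⟩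
  · exact nA (congr_symm (congr_trans hc ha))
  · exact nB (congr_trans hc hb)
  · exact nB (congr_trans hc hb)
  · exact nA (congr_symm (congr_trans hc ha))

/-- The roles are unambiguous. When they are exchanged, representatives in the order `s₁`, `s₂`
around the base would have to enclose more than a full period; this uses the strict inequality in
`Adjacent`. -/
lemma Frame.mem_part_of_adjacent (h : Frame P ν x a b ℓ r) (hν : 0 < ν) {s₁ s₂ A B : ℝ}
    (hadj : Adjacent P s₁ s₂ A B) (hA : A < base P ν x ℓ r) (hB : base P ν x ℓ r < B) :
    (x ∈ part P ν s₁ s₂ ∧ (∃ k : ℤ, A = s₁ + k * P.L) ∧ ∃ k : ℤ, B = s₂ + k * P.L) ∨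
    (x ∉ part P ν s₁ s₂ ∧ (∃ k : ℤ, A = s₂ + k * P.L) ∧ ∃ k : ℤ, B = s₁ + k * P.L) := by
  rcases hadj with ⟨hAB, ⟨ha, hb⟩ | ⟨hlt, ha, hb⟩⟩
  · exact Or.inl ⟨(h.mem_part_iff hν _ _).2 ⟨A, B, ha, hb, hA, hB, hAB⟩, ha, hb⟩
  · refine Or.inr ⟨fun hp => ?_, ha, hb⟩
    obtain ⟨A', B', ha', hb', h1, h2, h3⟩ := (h.mem_part_iff hν _ _).1 hp
    have hL := P.L_pos
    have k1 : A' ≤ B - P.L := by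
      by_contra hgt
      exact not_congr (by linarith) (by linarith) (congr_trans (congr_symm ha') hb)
    have k2 : A + P.L ≤ B' := by
      by_contra hgt
      exact not_congr (by linarith) (by linarith) (congr_trans (congr_symm ha) hb')
    linarith

/-- The feedback strategy prescribes the direction of the largest lead. -/
lemma Frame.exists_intruderFeedback_eq (h : Frame P ν x a b ℓ r) (hν : 0 < ν) (hν' : ν ≤ 1)
    {s₁ s₂ : ℝ} (hm : 0 < margin P ν s₁ s₂ x) :
    ∃ A B s, IsOpt P ν (tent A B) x a b s ∧ IsOpt P ν (clearance P s₁ s₂) x a b s ∧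
      intruderFeedback P ν s₁ s₂ x = ν • ‖P.γ s - x‖⁻¹ • (P.γ s - x) := by
  obtain ⟨A, B, s, hadj, hA, hB, hs, hs'⟩ := h.exists_adjacent_of_margin_pos hν hm
  obtain ⟨h1, h2⟩ := h.lam_base_rho hν hν'
  refine ⟨A, B, s, hs, hs', ?_⟩
  rw [smul_smul, ← div_eq_mul_inv]
  have main : ∀ {t₁ t₂}, (∃ k : ℤ, A = t₁ + k * P.L) → (∃ k : ℤ, B = t₂ + k * P.L) →
      P.γ (sOpt P ν t₁ t₂ x) = P.γ s := fun ha hb => by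
    obtain ⟨s', hs', hγ, -⟩ := h.sOpt_spec hν ha hb (by linarith) (by linarith) hadj.1
    rw [hγ, hs'.unique h.chart hν (concaveOn_tent A B) hs]
  rcases h.mem_part_of_adjacent hν hadj (by linarith) (by linarith) with ⟨hp, ha, hb⟩ | ⟨hp, ha, hb⟩
  · rw [intruderFeedback, if_pos hp, main ha hb]
  · rw [intruderFeedback, if_neg hp, main ha hb]

lemma exists_intruderFeedback_eq (hν : 0 < ν) (hν' : ν ≤ 1) (hx : x ∉ P.region) {s₁ s₂ : ℝ}
    (hm : 0 < margin P ν s₁ s₂ x) :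
    ∃ e R, IsHeading P ν s₁ s₂ x e R ∧ intruderFeedback P ν s₁ s₂ x = ν • e := by
  obtain ⟨a, b, ℓ, r, h⟩ := exists_frame (P := P) ν (fun h => hx (interior_subset h))
  obtain ⟨A, B, s, -, hs, heq⟩ := h.exists_intruderFeedback_eq hν hν' hm
  have hR : 0 < ‖P.γ s - x‖ := norm_pos_iff.2 (Chart.γ_sub_ne hx s)
  refine ⟨_, ‖P.γ s - x‖, ⟨hR, ?_, a, b, s, h.chart, hs, ?_⟩, heq⟩
  · rw [norm_smul, norm_inv, norm_norm, inv_mul_cancel₀ hR.ne']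
  · rw [smul_smul, mul_inv_cancel₀ hR.ne', one_smul, add_sub_cancel]

/-- The value function is the margin, where it is positive. -/
lemma margin_eq_Vij (hν : 0 < ν) (hν' : ν ≤ 1) {s₁ s₂ : ℝ} (hx : x ∈ part P ν s₁ s₂)
    (hV : 0 < Vij P ν s₁ s₂ x) : margin P ν s₁ s₂ x = Vij P ν s₁ s₂ x := by
  obtain ⟨a, b, ℓ, r, h⟩ := exists_frame (P := P) ν hx.1
  obtain ⟨A, B, ha, hb, h1, h2, h3⟩ := (h.mem_part_iff hν _ _).1 hx
  obtain ⟨s, hs, -, hVs⟩ := h.sOpt_spec hν ha hb h1 h2 h3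
  rw [hVs] at hV ⊢
  have hmem := mem_Ioo_of_tent_pos (A := A) (B := B) (s := s)
    (div_nonneg (dist_nonneg (x := P.γ s) (y := x)) hν.le) (by linarith)
  have hopt := hs.clearance_of_tent h.chart hν hν' h3 (by linarith)
  have hfun : clearance P A B = clearance P s₁ s₂ := funext fun s => clearance_congr ha hb s
  rw [hfun] at hopt
  rw [hopt.margin_eq h.chart, ← hfun, clearance_eq_tent h3 (Ioo_subset_Icc_self hmem)]

/-- On the perimeter, the margin is the distance to the nearest defender. -/
lemma margin_eq_clearance (ν s₁ s₂ : ℝ) {θ : ℝ} :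
    margin P ν s₁ s₂ (P.γ θ) = clearance P s₁ s₂ θ := by
  have hv : θ ∈ visible P (P.γ θ) := (mem_visible_iff_of_mem (γ_mem P θ)).2 rfl
  obtain ⟨a, b, hc, hθ⟩ := exists_chart_mem ((mem_frontier_iff P).1 (γ_mem_frontier P θ)).2 hv
  obtain ⟨s, hs⟩ := exists_isOpt_clearance ν hc s₁ s₂
  rw [hs.margin_eq hc, hc.eq_of_mem (γ_mem P θ) hs.1 hθ, dist_self, zero_div, sub_zero]

lemma Frame.eq_of_mem (h : Frame P ν (P.γ ℓ) a b ℓ r) : r = ℓ ∧ base P ν (P.γ ℓ) ℓ r = ℓ := by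
  have := h.chart.eq_of_mem (γ_mem P ℓ) h.right.1 h.left.1
  refine ⟨this, ?_⟩
  rw [base, this, dist_self]
  ring

lemma exists_frame_γ (P : Target) (ν θ : ℝ) : ∃ a b, Frame P ν (P.γ θ) a b θ θ := by
  have hv : θ ∈ visible P (P.γ θ) := (mem_visible_iff_of_mem (γ_mem P θ)).2 rfl
  obtain ⟨a, b, hc, hθ⟩ := exists_chart_mem ((mem_frontier_iff P).1 (γ_mem_frontier P θ)).2 hv
  obtain ⟨ℓ, r, h⟩ := hc.exists_frame ν
  have h1 := hc.eq_of_mem (γ_mem P θ) h.left.1 hθ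
  have h2 := hc.eq_of_mem (γ_mem P θ) h.right.1 hθ
  subst h1 h2
  exact ⟨a, b, h⟩

/-- At a breach, the safe distance is the margin, and it is positive. -/
lemma safeDistance_eq_margin (hν : 0 < ν) {s₁ s₂ : ℝ} (hx : x ∈ P.region)
    (hx' : x ∉ interior P.region) (hc : ¬ Captured P ν s₁ s₂ x) :
    safeDistance P ν s₁ s₂ x = margin P ν s₁ s₂ x ∧ 0 < margin P ν s₁ s₂ x := by
  obtain ⟨θ, rfl⟩ := exists_γ_eq P ((mem_frontier_iff P).2 ⟨hx, hx'⟩)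
  obtain ⟨a, b, h⟩ := exists_frame_γ P ν θ
  have hb := h.eq_of_mem.2
  rw [Captured, h.mem_afferent_iff hν, h.mem_afferent_iff hν, not_or, hb] at hc
  have hpos : 0 < clearance P s₁ s₂ θ := by
    refine lt_min ?_ ?_
    · exact lt_of_le_of_ne (cdist_nonneg _ _)
        fun h0 => hc.1 (congr_symm (cdist_eq_zero_iff.1 h0.symm))
    · exact lt_of_le_of_ne (cdist_nonneg _ _)
        fun h0 => hc.2 (congr_symm (cdist_eq_zero_iff.1 h0.symm))
  rw [margin_eq_clearance]
  refine ⟨?_, hpos⟩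
  obtain ⟨A, B, hadj, hAB⟩ := exists_adjacent hpos
  have hε : P.γ (Classical.epsilon fun s => P.γ s = P.γ θ) = P.γ θ :=
    Classical.epsilon_spec (p := fun s => P.γ s = P.γ θ) ⟨θ, rfl⟩
  have hε' := (γ_eq_iff P _ _).1 hε.symm
  rw [hadj.clearance_eq, clearance_eq_tent hadj.1 (Ioo_subset_Icc_self hAB), tent]
  have eA : arc P A θ = θ - A :=
    arc_eq 0 (by simp) (by linarith [hAB.1]) (by linarith [hAB.2, hadj.1])
  have eB : arc P θ B = B - θ :=
    arc_eq 0 (by simp) (by linarith [hAB.2]) (by linarith [hAB.1, hadj.1])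
  rcases h.mem_part_of_adjacent hν hadj (by rw [hb]; exact hAB.1) (by rw [hb]; exact hAB.2) with
    ⟨hp, ha, hb⟩ | ⟨hp, ha, hb⟩
  · rw [safeDistance, if_pos hp, ← eA, ← eB, arc_congr ha (congr_symm hε'),
      arc_congr (congr_symm hε') hb]
  · rw [safeDistance, if_neg hp, ← eA, ← eB, arc_congr ha (congr_symm hε'),
      arc_congr (congr_symm hε') hb]

end Frame

end PerimeterDefense

namespace PerimeterDefense

open Filter Topology RealInnerProductSpace

/-! ### Lower derivatives and motions with bounded velocity -/

section Calculus

/-- A Lipschitz function whose lower right derivative is at least `c` almost everywhere grows at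
least linearly. -/
lemma le_sub_of_ae_lower_derivative {f : ℝ → ℝ} {t₀ t₁ K c : ℝ} (h01 : t₀ ≤ t₁)
    (hf : ∀ t ∈ Icc t₀ t₁, ∀ t' ∈ Icc t₀ t₁, |f t - f t'| ≤ K * |t - t'|)
    (hc : ∀ᵐ t, t ∈ Ioo t₀ t₁ → ∀ ε > 0, ∀ᶠ h in 𝓝[>] (0 : ℝ), f t + (c - ε) * h ≤ f (t + h)) :
    c * (t₁ - t₀) ≤ f t₁ - f t₀ := by
  have hlip : LipschitzOnWith K.toNNReal f (uIcc t₀ t₁) := by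
    rw [uIcc_of_le h01]
    refine LipschitzOnWith.of_dist_le_mul fun t ht t' ht' => ?_
    rw [Real.dist_eq, Real.dist_eq]
    exact (hf t ht t' ht').trans
      (mul_le_mul_of_nonneg_right (Real.le_coe_toNNReal K) (abs_nonneg _))
  have hac := hlip.absolutelyContinuousOnInterval
  have hle : ∀ᵐ t, t ∈ Ioo t₀ t₁ → c ≤ deriv f t := by
    filter_upwards [hc, hac.ae_differentiableAt] with t h1 h2 ht
    have hd := (h2 (by rw [uIcc_of_le h01]; exact Ioo_subset_Icc_self ht)).hasDerivAt
    have hs := hd.tendsto_slope_zero_right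
    refine le_of_forall_pos_le_add fun ε hε => ?_
    rw [← sub_le_iff_le_add]
    refine ge_of_tendsto hs ?_
    filter_upwards [h1 ht ε hε, self_mem_nhdsWithin] with h hh hpos
    have hpos' : 0 < h := hpos
    rw [smul_eq_mul, ← div_eq_inv_mul, le_div_iff₀ hpos']
    linarith
  rw [← hac.integral_deriv_eq_sub, mul_comm, ← smul_eq_mul, ← intervalIntegral.integral_const]
  have hle' : (fun _ => c) ≤ᵐ[volume.restrict (Ioo t₀ t₁)] deriv f :=
    (ae_restrict_iff' measurableSet_Ioo).2 hle
  refine intervalIntegral.integral_mono_ae_restrict h01 intervalIntegrable_const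
    hac.intervalIntegrable_deriv ?_
  rwa [← restrict_Ioo_eq_restrict_Icc]

variable {E : Type*} [NormedAddCommGroup E] [NormedSpace ℝ E]

omit [NormedSpace ℝ E] in
lemma intervalIntegrable_of_bounded [MeasurableSpace E] [BorelSpace E] [SecondCountableTopology E]
    {v : ℝ → E} {K : ℝ} (hm : Measurable v) (hv : ∀ t, ‖v t‖ ≤ K) (t₀ t₁ : ℝ) :
    IntervalIntegrable v volume t₀ t₁ :=
  (intervalIntegrable_const (c := K)).mono_fun hm.aestronglyMeasurable
    (Eventually.of_forall fun t => (hv t).trans (Real.le_norm_self _))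

lemma position_zero (a : E) (v : ℝ → E) : position a v 0 = a := by
  rw [position, intervalIntegral.integral_same, add_zero]

lemma dist_position_le [MeasurableSpace E] [BorelSpace E] [SecondCountableTopology E]
    {v : ℝ → E} {K : ℝ} (hm : Measurable v) (hv : ∀ t, ‖v t‖ ≤ K) (a : E) (t t' : ℝ) :
    dist (position a v t) (position a v t') ≤ K * |t - t'| := by
  have hi := intervalIntegrable_of_bounded hm hv
  rw [dist_eq_norm, position, position, add_sub_add_left_eq_sub,
    intervalIntegral.integral_interval_sub_left (hi _ _) (hi _ _)]
  exact intervalIntegral.norm_integral_le_of_norm_le_const fun τ _ => hv τ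

lemma ae_hasDerivAt_position [MeasurableSpace E] [BorelSpace E] [SecondCountableTopology E]
    [CompleteSpace E] {v : ℝ → E} {K : ℝ} (hm : Measurable v) (hv : ∀ t, ‖v t‖ ≤ K) (a : E) :
    ∀ᵐ t, HasDerivAt (position a v) (v t) t := by
  have hl : LocallyIntegrable v volume := fun t => by
    refine ⟨Icc (t - 1) (t + 1), Icc_mem_nhds (by linarith) (by linarith), ?_⟩
    have := intervalIntegrable_of_bounded hm hv (t - 1) (t + 1)
    rwa [intervalIntegrable_iff_integrableOn_Icc_of_le (by linarith)] at this
  filter_upwards [LocallyIntegrable.ae_hasDerivAt_integral hl] with t ht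
  exact (ht 0).const_add a

end Calculus

/-! ### Evolution of the margin -/

section Motion

variable {P : Target} {ν : ℝ} {s₁ s₂ : ℝ → ℝ} {X : ℝ → Plane}

lemma exists_path_lift {Y : ℝ → Plane} {t₀ t₁ θ₀ : ℝ} (h01 : t₀ ≤ t₁)
    (hY : ContinuousOn Y (Icc t₀ t₁)) (hint : ∀ t ∈ Icc t₀ t₁, Y t ∉ interior P.region)
    (h0 : P.γ θ₀ = proj P (Y t₀)) :
    ∃ θ : ℝ → ℝ, ContinuousOn θ (Icc t₀ t₁) ∧ θ t₀ = θ₀ ∧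
      ∀ t ∈ Icc t₀ t₁, P.γ (θ t) = proj P (Y t) := by
  have hm : MapsTo (fun r => t₀ + r) (Icc 0 (t₁ - t₀)) (Icc t₀ t₁) := fun r hr =>
    ⟨by linarith [hr.1], by linarith [hr.2]⟩
  have hm' : MapsTo (fun t => t - t₀) (Icc t₀ t₁) (Icc 0 (t₁ - t₀)) := fun r hr =>
    ⟨by linarith [hr.1], by linarith [hr.2]⟩
  obtain ⟨θ, hθ, hθ0, hθp⟩ := exists_lift P (T := t₁ - t₀) (by linarith)
    (Y := fun r => proj P (Y (t₀ + r)))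
    ((continuous_proj P).comp_continuousOn (hY.comp (by fun_prop) hm))
    (fun r hr => proj_mem_frontier P (hint _ (hm hr))) θ₀ (by simpa using h0)
  refine ⟨fun t => θ (t - t₀), hθ.comp (by fun_prop) hm', by simpa using hθ0, fun t ht => ?_⟩
  simpa using hθp _ (hm' ht)

lemma exists_linked_of_path {Y : ℝ → Plane} {t₀ t₁ K a b : ℝ} (h01 : t₀ ≤ t₁) (hK : 0 ≤ K)
    (hY : ∀ t ∈ Icc t₀ t₁, ∀ t' ∈ Icc t₀ t₁, dist (Y t) (Y t') ≤ K * |t - t'|)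
    (hint : ∀ t ∈ Icc t₀ t₁, Y t ∉ interior P.region) (h : Chart P (Y t₀) a b) :
    ∃ a' b', Chart P (Y t₁) a' b' ∧ Linked P (K * (t₁ - t₀)) (Y t₀) a b (Y t₁) a' b' := by
  obtain ⟨θ₀, hθ₀, hp0⟩ := exists_lift_mem_chart h
  have hYc : ContinuousOn Y (Icc t₀ t₁) := (LipschitzOnWith.of_dist_le_mul (K := K.toNNReal)
    fun t ht t' ht' => by
      rw [Real.coe_toNNReal K hK, Real.dist_eq]; exact hY t ht t' ht').continuousOn
  obtain ⟨θ, hθ, hθ0, hθp⟩ := exists_path_lift h01 hYc hint hp0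
  have h1 := right_mem_Icc.2 h01
  obtain ⟨a', b', hc, hm⟩ := exists_chart_mem (hint _ h1) (mem_visible_of_γ_eq_proj (hθp _ h1))
  exact ⟨a', b', hc, linked_of_path h01 hK hY hθ hθp h (hθ0 ▸ hθ₀) hc hm⟩

/-- Motions of the players with speed bounds `1`, `1` and `ν`. -/
structure Motion (ν : ℝ) (s₁ s₂ : ℝ → ℝ) (X : ℝ → Plane) : Prop where
  lip₁ : ∀ t t', |s₁ t - s₁ t'| ≤ |t - t'|
  lip₂ : ∀ t t', |s₂ t - s₂ t'| ≤ |t - t'|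
  lip : ∀ t t', dist (X t) (X t') ≤ ν * |t - t'|

lemma motion_position (a₁ a₂ : ℝ) (x₀ : Plane) (ω : DefenderControl) (u : IntruderControl ν) :
    Motion ν (position a₁ ω.1.1) (position a₂ ω.1.2) (position x₀ u.1) where
  lip₁ t t' := by simpa [Real.dist_eq] using dist_position_le ω.2.1.1 ω.2.1.2 a₁ t t'
  lip₂ t t' := by simpa [Real.dist_eq] using dist_position_le ω.2.2.1 ω.2.2.2 a₂ t t'
  lip := dist_position_le u.2.1 u.2.2 x₀

namespace Motion

lemma continuous (h : Motion ν s₁ s₂ X) : Continuous X :=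
  (LipschitzWith.of_dist_le_mul (K := ν.toNNReal) fun t t' => by
    rw [Real.dist_eq]
    exact (h.lip t t').trans (mul_le_mul_of_nonneg_right (Real.le_coe_toNNReal ν)
      (abs_nonneg _))).continuous

lemma not_mem_interior (h : Motion ν s₁ s₂ X) {T : ℝ} (hT : 0 ≤ T) (h0 : X 0 ∉ interior P.region)
    (hX : ∀ t ∈ Ico 0 T, X t ∉ P.region) : ∀ t ∈ Icc 0 T, X t ∉ interior P.region := by
  intro t ht hi
  rcases ht.2.lt_or_eq with hlt | rfl
  · exact hX t ⟨ht.1, hlt⟩ (interior_subset hi)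
  rcases hT.eq_or_lt with rfl | hpos
  · exact h0 hi
  have h1 : ∀ᶠ τ in 𝓝[<] t, X τ ∈ interior P.region :=
    (h.continuous.continuousAt.eventually (isOpen_interior.mem_nhds hi)).filter_mono
      nhdsWithin_le_nhds
  obtain ⟨τ, hτ, hτ'⟩ := (h1.and (Ioo_mem_nhdsLT hpos)).exists
  exact hX τ ⟨hτ'.1.le, hτ'.2⟩ (interior_subset hτ)

/-- One unit of the rate is due to the intruder, who covers `ν` per unit of time at `1 / ν` each,
the other one to the defenders. -/
lemma margin_sub_le_margin (h : Motion ν s₁ s₂ X) (hν : 0 < ν) (hν' : ν ≤ 1) {t₀ t₁ : ℝ}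
    (h01 : t₀ ≤ t₁) (hint : ∀ t ∈ Icc t₀ t₁, X t ∉ interior P.region) :
    |margin P ν (s₁ t₁) (s₂ t₁) (X t₁) - margin P ν (s₁ t₀) (s₂ t₀) (X t₀)| ≤ 2 * (t₁ - t₀) := by
  obtain ⟨a, b, hc⟩ := exists_chart (hint t₀ (left_mem_Icc.2 h01))
  obtain ⟨a', b', hc', hl⟩ := exists_linked_of_path h01 hν.le (fun t _ t' _ => h.lip t t') hint hc
  have e : ν * (t₁ - t₀) / ν = t₁ - t₀ := mul_div_cancel_left₀ _ hν.ne'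
  have h1 := margin_sub_le_of_linked (s₁ := s₁ t₀) (s₂ := s₂ t₀) hν hν' hc hc' hl.1
  have h2 := margin_sub_le_of_linked (s₁ := s₁ t₀) (s₂ := s₂ t₀) hν hν' hc' hc hl.2
  rw [e] at h1 h2
  have hx := hint t₁ (right_mem_Icc.2 h01)
  have ha : |t₁ - t₀| = t₁ - t₀ := abs_of_nonneg (by linarith)
  have k1 := h.lip₁ t₁ t₀
  have k2 := h.lip₂ t₁ t₀
  have k3 := h.lip₁ t₀ t₁
  have k4 := h.lip₂ t₀ t₁
  rw [ha] at k1 k2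
  rw [abs_sub_comm t₀, ha] at k3 k4
  have h3 := margin_sub_le' (ν := ν) hx k1 k2
  have h4 := margin_sub_le' (ν := ν) hx k3 k4
  rw [abs_le]
  constructor <;> linarith

lemma abs_margin_sub_le (h : Motion ν s₁ s₂ X) (hν : 0 < ν) (hν' : ν ≤ 1) {t₀ t₁ : ℝ}
    (hint : ∀ t ∈ Icc t₀ t₁, X t ∉ interior P.region) :
    ∀ t ∈ Icc t₀ t₁, ∀ t' ∈ Icc t₀ t₁, |margin P ν (s₁ t) (s₂ t) (X t) -
      margin P ν (s₁ t') (s₂ t') (X t')| ≤ 2 * |t - t'| := by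
  intro t ht t' ht'
  rcases le_total t t' with hle | hle
  · rw [abs_sub_comm, abs_sub_comm t, abs_of_nonneg (sub_nonneg.2 hle)]
    exact h.margin_sub_le_margin hν hν' hle fun τ hτ => hint τ ⟨ht.1.trans hτ.1, hτ.2.trans ht'.2⟩
  · rw [abs_of_nonneg (sub_nonneg.2 hle)]
    exact h.margin_sub_le_margin hν hν' hle fun τ hτ => hint τ ⟨ht'.1.trans hτ.1, hτ.2.trans ht.2⟩

lemma margin_continuousOn (h : Motion ν s₁ s₂ X) (hν : 0 < ν) (hν' : ν ≤ 1) {t₀ t₁ : ℝ}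
    (hint : ∀ t ∈ Icc t₀ t₁, X t ∉ interior P.region) :
    ContinuousOn (fun t => margin P ν (s₁ t) (s₂ t) (X t)) (Icc t₀ t₁) :=
  (LipschitzOnWith.of_dist_le_mul (K := 2) fun t ht t' ht' => by
    rw [Real.dist_eq, Real.dist_eq]
    exact h.abs_margin_sub_le hν hν' hint t ht t' ht').continuousOn

/-- The defenders cannot decrease the margin while the intruder follows an optimal heading. -/
lemma margin_lower_derivative (h : Motion ν s₁ s₂ X) (hν : 0 < ν) (hν' : ν ≤ 1) {t R : ℝ}
    {e : Plane} (hX : X t ∉ P.region) (he : IsHeading P ν (s₁ t) (s₂ t) (X t) e R)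
    (hd : HasDerivAt X (ν • e) t) {ε : ℝ} (hε : 0 < ε) :
    ∀ᶠ r in 𝓝[>] (0 : ℝ), margin P ν (s₁ t) (s₂ t) (X t) + (0 - ε) * r ≤
      margin P ν (s₁ (t + r)) (s₂ (t + r)) (X (t + r)) := by
  have hpos : 0 < Metric.infDist (X t) P.region :=
    (P.isCompact_region.isClosed.notMem_iff_infDist_pos
      ⟨_, interior_subset P.interior_nonempty.some_mem⟩).1 hX
  have h1 : ∀ᶠ r in 𝓝[>] (0 : ℝ), dist (X (t + r)) (X t) < Metric.infDist (X t) P.region := by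
    have hc : Tendsto (fun r => dist (X (t + r)) (X t)) (𝓝[>] (0 : ℝ)) (𝓝 0) := by
      have : Continuous fun r => dist (X (t + r)) (X t) :=
        (h.continuous.comp (by fun_prop)).dist continuous_const
      have := this.tendsto 0
      simp only [add_zero, dist_self] at this
      exact this.mono_left nhdsWithin_le_nhds
    exact hc.eventually (gt_mem_nhds hpos)
  have h2 : ∀ᶠ r in 𝓝[>] (0 : ℝ), r * ν < Metric.infDist (X t) P.region := by
    filter_upwards [Ioo_mem_nhdsGT (div_pos hpos hν)] with r hr
    exact (lt_div_iff₀ hν).1 hr.2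
  have h3 : ∀ᶠ r in 𝓝[>] (0 : ℝ), ‖X (t + r) - X t - r • ν • e‖ ≤ (ν * ε) * ‖r‖ := by
    have := (hasDerivAt_iff_isLittleO_nhds_zero.1 hd).def (mul_pos hν hε)
    exact this.filter_mono nhdsWithin_le_nhds
  filter_upwards [h1, h2, h3, self_mem_nhdsWithin] with r k1 k2 k3 k4
  have hr : 0 < r := k4
  have hq : 0 ≤ r * ν := by positivity
  -- The straight motion along the heading would gain `r`. The actual position differs by at most `ν
  -- ε r`, which costs `ε r`, and the defenders take away at most `r`.
  obtain ⟨f1, -, -⟩ := he.margin_forward hX hν hν' hq (k2.trans_le he.infDist_le)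
  have hz : dist (X t + (r * ν) • e) (X t) < Metric.infDist (X t) P.region := by
    rwa [dist_eq_norm, add_sub_cancel_left, norm_smul, he.norm_eq, mul_one,
      Real.norm_of_nonneg hq]
  have f2 := margin_sub_le (s₁ := s₁ t) (s₂ := s₂ t) hν hν'
    (segment_not_mem_interior le_rfl hz k1)
  have hx : X (t + r) ∉ interior P.region := fun hi => by
    have := Metric.infDist_le_dist_of_mem (x := X t) (interior_subset hi)
    rw [dist_comm] at this
    linarith
  have l1 := h.lip₁ (t + r) t
  have l2 := h.lip₂ (t + r) t
  rw [add_sub_cancel_left, abs_of_pos hr] at l1 l2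
  have f3 := margin_sub_le' (ν := ν) hx l1 l2
  have f4 : dist (X t + (r * ν) • e) (X (t + r)) / ν ≤ ε * r := by
    rw [div_le_iff₀ hν, dist_comm, dist_eq_norm,
      show X (t + r) - (X t + (r * ν) • e) = X (t + r) - X t - r • ν • e by module]
    rw [Real.norm_of_nonneg hr.le] at k3
    linarith
  rw [f1, mul_div_cancel_right₀ _ hν.ne'] at f2
  linarith

lemma margin_mono (h : Motion ν s₁ s₂ X) (hν : 0 < ν) (hν' : ν ≤ 1) {t₀ t₁ : ℝ} (h01 : t₀ ≤ t₁)
    (hint : ∀ t ∈ Icc t₀ t₁, X t ∉ interior P.region) (hX : ∀ t ∈ Ioo t₀ t₁, X t ∉ P.region)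
    (hd : ∀ᵐ t, t ∈ Ioo t₀ t₁ → ∃ e R, IsHeading P ν (s₁ t) (s₂ t) (X t) e R ∧
      HasDerivAt X (ν • e) t) :
    margin P ν (s₁ t₀) (s₂ t₀) (X t₀) ≤ margin P ν (s₁ t₁) (s₂ t₁) (X t₁) := by
  have := le_sub_of_ae_lower_derivative (c := 0) h01 (h.abs_margin_sub_le hν hν' hint) (by
    filter_upwards [hd] with t ht hmem ε hε
    obtain ⟨e, R, he, hde⟩ := ht hmem
    exact h.margin_lower_derivative hν hν' (hX t hmem) he hde hε)
  linarith

/-- Under the feedback strategy the margin does not decrease. -/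
lemma le_margin (h : Motion ν s₁ s₂ X) (hν : 0 < ν) (hν' : ν ≤ 1) {T : ℝ} (hT : 0 ≤ T)
    (h0 : X 0 ∉ interior P.region) (hX : ∀ t ∈ Ico 0 T, X t ∉ P.region)
    (hpos : 0 < margin P ν (s₁ 0) (s₂ 0) (X 0))
    (hd : ∀ᵐ t, t ∈ Ioo 0 T → (∀ τ ∈ Icc 0 t, margin P ν (s₁ 0) (s₂ 0) (X 0) / 2 <
      margin P ν (s₁ τ) (s₂ τ) (X τ)) →
      HasDerivAt X (intruderFeedback P ν (s₁ t) (s₂ t) (X t)) t) :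
    ∀ t ∈ Icc 0 T, margin P ν (s₁ 0) (s₂ 0) (X 0) ≤ margin P ν (s₁ t) (s₂ t) (X t) := by
  have hint := h.not_mem_interior hT h0 hX
  set W := fun t => margin P ν (s₁ t) (s₂ t) (X t)
  have hW : ContinuousOn W (Icc 0 T) := h.margin_continuousOn hν hν' hint
  -- The feedback is known to follow an optimal heading only while the margin is positive. As long
  -- as the margin exceeds half its initial value it does not decrease, so by continuity it never
  -- falls to one half.
  have step : ∀ t ∈ Icc 0 T, (∀ τ ∈ Ico 0 t, W 0 / 2 < W τ) → W 0 ≤ W t := by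
    intro t ht hτ
    refine h.margin_mono hν hν' ht.1 (fun τ hτ' => hint τ ⟨hτ'.1, hτ'.2.trans ht.2⟩)
      (fun τ hτ' => hX τ ⟨hτ'.1.le, hτ'.2.trans_le ht.2⟩) ?_
    filter_upwards [hd] with r hr hr'
    have hWr : W 0 / 2 < W r := hτ r ⟨hr'.1.le, hr'.2⟩
    obtain ⟨e, R, he, heq⟩ := exists_intruderFeedback_eq (s₁ := s₁ r) (s₂ := s₂ r) hν hν'
      (hX r ⟨hr'.1.le, hr'.2.trans_le ht.2⟩) (show 0 < W r by linarith [show 0 < W 0 from hpos])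
    refine ⟨e, R, he, ?_⟩
    rw [← heq]
    exact hr ⟨hr'.1, hr'.2.trans_le ht.2⟩ fun τ hτ' => hτ τ ⟨hτ'.1, hτ'.2.trans_lt hr'.2⟩
  have hlt : ∀ t ∈ Icc 0 T, W 0 / 2 < W t := by
    by_contra hcon
    push Not at hcon
    have hne : (Icc 0 T ∩ W ⁻¹' Iic (W 0 / 2)).Nonempty := by
      obtain ⟨t, ht, hle⟩ := hcon; exact ⟨t, ht, hle⟩
    have hcpt : IsCompact (Icc 0 T ∩ W ⁻¹' Iic (W 0 / 2)) :=
      isCompact_Icc.of_isClosed_subset (hW.preimage_isClosed_of_isClosed isClosed_Icc isClosed_Iic)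
        inter_subset_left
    obtain ⟨t, ⟨ht, htW⟩, hmin⟩ := hcpt.exists_isLeast hne
    have h1 := step t ht fun τ hτ => by
      by_contra hle
      exact absurd (hmin ⟨⟨hτ.1, hτ.2.le.trans ht.2⟩, not_lt.1 hle⟩) (not_le.2 hτ.2)
    have h2 : W t ≤ W 0 / 2 := htW
    have h3 : 0 < W 0 := hpos
    linarith
  exact fun t ht => step t ht fun τ hτ => hlt τ ⟨hτ.1, hτ.2.le.trans ht.2⟩

end Motion

end Motion

/-! ### Payoff of feedback responses -/

section Payoff

variable {P : Target} {ν : ℝ} {s₁ s₂ : ℝ → ℝ} {X : ℝ → Plane}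

/-- A breach is terminal, so the choice of its time in `motionPayoff` is harmless. -/
lemma BreachAt.eq {t t' : ℝ} (h : BreachAt P ν s₁ s₂ X t) (h' : BreachAt P ν s₁ s₂ X t') :
    t = t' := by
  rcases lt_trichotomy t t' with hlt | heq | hlt
  · exact absurd (Or.inl h.2.2.1) (h'.2.1 t ⟨h.1, hlt⟩)
  · exact heq
  · exact absurd (Or.inl h'.2.2.1) (h.2.1 t' ⟨h'.1, hlt⟩)

lemma BreachAt.not_mem_interior {t : ℝ} (h : BreachAt P ν s₁ s₂ X t) (hm : Motion ν s₁ s₂ X)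
    (h0 : X 0 ∉ interior P.region) : ∀ τ ∈ Icc 0 t, X τ ∉ interior P.region :=
  hm.not_mem_interior h.1 h0 fun τ hτ hT => h.2.1 τ hτ (Or.inl hT)

lemma BreachAt.motionPayoff_eq {t : ℝ} (h : BreachAt P ν s₁ s₂ X t) (hm : Motion ν s₁ s₂ X)
    (hν : 0 < ν) (h0 : X 0 ∉ interior P.region) :
    motionPayoff P ν s₁ s₂ X = margin P ν (s₁ t) (s₂ t) (X t) := by
  have hex : ∃ t, BreachAt P ν s₁ s₂ X t := ⟨t, h⟩
  rw [motionPayoff, dif_pos hex, hex.choose_spec.eq h]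
  exact (safeDistance_eq_margin hν h.2.2.1 (h.not_mem_interior hm h0 t (right_mem_Icc.2 h.1))
    h.2.2.2).1

lemma motionPayoff_of_not_exists (h : ¬ ∃ t, BreachAt P ν s₁ s₂ X t) :
    motionPayoff P ν s₁ s₂ X = 0 := by rw [motionPayoff, dif_neg h]

/-- An intruder that keeps a positive margin breaches the perimeter as soon as it reaches it. -/
lemma Motion.le_motionPayoff (h : Motion ν s₁ s₂ X) (hν : 0 < ν) (hν' : ν ≤ 1)
    (h0 : X 0 ∉ interior P.region) {V : ℝ} (hV : 0 < V)
    (hle : ∀ T, 0 ≤ T → (∀ t ∈ Ico 0 T, X t ∉ P.region) → V ≤ margin P ν (s₁ T) (s₂ T) (X T))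
    (hex : ∃ t, 0 ≤ t ∧ X t ∈ P.region) : V ≤ motionPayoff P ν s₁ s₂ X := by
  have hcl : IsClosed (Ici 0 ∩ X ⁻¹' P.region) :=
    isClosed_Ici.inter (P.isCompact_region.isClosed.preimage h.continuous)
  have hleast := hcl.isLeast_csInf (by obtain ⟨t, h1, h2⟩ := hex; exact ⟨t, h1, h2⟩)
    ⟨0, fun t ht => ht.1⟩
  set T := sInf (Ici 0 ∩ X ⁻¹' P.region)
  have hT : 0 ≤ T := hleast.1.1
  have hX : ∀ t ∈ Ico 0 T, X t ∉ P.region := fun t ht hmem =>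
    absurd (hleast.2 ⟨ht.1, hmem⟩) (not_le.2 ht.2)
  have hint := h.not_mem_interior hT h0 hX
  have hnc : ∀ t ∈ Icc 0 T, ¬ Captured P ν (s₁ t) (s₂ t) (X t) := fun t ht =>
    not_captured_of_margin_pos hν hν' (hint t ht)
      (hV.trans_le (hle t ht.1 fun τ hτ => hX τ ⟨hτ.1, hτ.2.trans_le ht.2⟩))
  have hb : BreachAt P ν s₁ s₂ X T := by
    refine ⟨hT, fun τ hτ => ?_, hleast.1.2, hnc T (right_mem_Icc.2 hT)⟩
    rintro (hr | hc)
    · exact hX τ hτ hr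
    · exact hnc τ ⟨hτ.1, hτ.2.le⟩ hc
  rw [hb.motionPayoff_eq h hν h0]
  exact hle T hT hX

/-- The margin under a feedback response. -/
lemma IsFeedbackResponse.le_margin {a₁ a₂ : ℝ} {x₀ : Plane} {ω : DefenderControl}
    {u : IntruderControl ν} (hu : IsFeedbackResponse P ν a₁ a₂ x₀ ω u) (hν : 0 < ν) (hν' : ν ≤ 1)
    (hx₀ : x₀ ∉ interior P.region) (hm : 0 < margin P ν a₁ a₂ x₀) {T : ℝ} (hT : 0 ≤ T)
    (hX : ∀ t ∈ Ico 0 T, position x₀ u.1 t ∉ P.region) :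
    margin P ν a₁ a₂ x₀ ≤
      margin P ν (position a₁ ω.1.1 T) (position a₂ ω.1.2 T) (position x₀ u.1 T) := by
  have hmot := motion_position a₁ a₂ x₀ ω u
  have e : margin P ν (position a₁ ω.1.1 0) (position a₂ ω.1.2 0) (position x₀ u.1 0) =
      margin P ν a₁ a₂ x₀ := by rw [position_zero, position_zero, position_zero]
  have h0 : position x₀ u.1 0 ∉ interior P.region := by rwa [position_zero]
  have hint := hmot.not_mem_interior hT h0 hX
  have := hmot.le_margin hν hν' hT h0 hX (by rwa [e]) (by
    filter_upwards [hu, ae_hasDerivAt_position u.2.1 u.2.2 x₀] with t h1 h2 ht hW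
    rw [← h1 ht.1.le]
    · exact h2
    · intro τ hτ
      rintro (hr | hc)
      · exact hX τ ⟨hτ.1, hτ.2.trans_lt ht.2⟩ hr
      · exact not_captured_of_margin_pos hν hν' (hint τ ⟨hτ.1, hτ.2.trans ht.2.le⟩)
          (by linarith [hW τ hτ]) hc) T (right_mem_Icc.2 hT)
  rwa [e] at this

/-- A feedback response that reaches the target secures the initial margin. -/
lemma IsFeedbackResponse.le_payoff {a₁ a₂ : ℝ} {x₀ : Plane} {ω : DefenderControl}
    {u : IntruderControl ν} (hu : IsFeedbackResponse P ν a₁ a₂ x₀ ω u) (hν : 0 < ν) (hν' : ν ≤ 1)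
    (hx₀ : x₀ ∉ interior P.region) (hm : 0 < margin P ν a₁ a₂ x₀)
    (hex : ∃ t, 0 ≤ t ∧ position x₀ u.1 t ∈ P.region) :
    margin P ν a₁ a₂ x₀ ≤ payoff P ν a₁ a₂ x₀ ω u :=
  (motion_position a₁ a₂ x₀ ω u).le_motionPayoff hν hν' (by rwa [position_zero]) hm
    (fun _ hT hX => hu.le_margin hν hν' hx₀ hm hT hX) hex

/-- The feedback response that never reaches the target is never captured. -/
lemma IsFeedbackResponse.neverEnds {a₁ a₂ : ℝ} {x₀ : Plane} {ω : DefenderControl}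
    {u : IntruderControl ν} (hu : IsFeedbackResponse P ν a₁ a₂ x₀ ω u) (hν : 0 < ν) (hν' : ν ≤ 1)
    (hx₀ : x₀ ∉ interior P.region) (hm : 0 < margin P ν a₁ a₂ x₀)
    (hX : ∀ t, 0 ≤ t → position x₀ u.1 t ∉ P.region) : NeverEnds P ν a₁ a₂ x₀ ω u := by
  intro t _ τ hτ
  rintro (hr | hc)
  · exact hX τ hτ.1 hr
  · exact not_captured_of_margin_pos hν hν' (fun h => hX τ hτ.1 (interior_subset h))
      (hm.trans_le (hu.le_margin hν hν' hx₀ hm hτ.1 fun r hr => hX r hr.1)) hc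

end Payoff

end PerimeterDefense

namespace PerimeterDefense

open Filter Topology RealInnerProductSpace

/-! ### The pincer maneuver -/

section Pincer

variable {P : Target} {ν : ℝ} {x y : Plane} {a b ℓ r a' b' ℓ' r' : ℝ}

lemma Frame.lam_rho_le (h : Frame P ν x a b ℓ r) (h' : Frame P ν y a' b' ℓ' r') (hν : 0 < ν)
    (hν' : ν ≤ 1) {d : ℝ} (hl : Reach P d x a b y a' b') :
    ℓ - dist (P.γ ℓ) x / ν - d / ν ≤ ℓ' - dist (P.γ ℓ') y / ν ∧
      r' + dist (P.γ r') y / ν ≤ r + dist (P.γ r) x / ν + d / ν := by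
  have h1 := hl.opt_le hν hν' (c := fun s => s) (fun s t => le_abs_self _) h.left.1 h'.left
  have h2 := hl.opt_le hν hν' (c := fun s => -s)
    (fun s t => by rw [abs_sub_comm]; linarith [le_abs_self (t - s)]) h.right.1 h'.right
  exact ⟨h1, by linarith⟩

/-- The base is the mean of two quantities that each change by at most `d / ν`. So the foot of an
intruder of speed `ν` moves no faster than the defenders. -/
lemma Frame.abs_base_sub_le (h : Frame P ν x a b ℓ r) (h' : Frame P ν y a' b' ℓ' r') (hν : 0 < ν)
    (hν' : ν ≤ 1) {d : ℝ} (hl : Linked P d x a b y a' b') :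
    |base P ν x ℓ r - base P ν y ℓ' r'| ≤ d / ν := by
  have h1 := h.lam_rho_le h' hν hν' hl.1
  have h2 := h'.lam_rho_le h hν hν' hl.2
  rw [base, base, abs_le]
  constructor <;> linarith [h1.1, h1.2, h2.1, h2.2]

lemma exists_frame_mem (ν : ℝ) (hx : x ∉ interior P.region) {θ : ℝ} (hθ : P.γ θ = proj P x) :
    ∃ a b ℓ r, Frame P ν x a b ℓ r ∧ θ ∈ Icc a b := by
  obtain ⟨a, b, hc, hm⟩ := exists_chart_mem hx (mem_visible_of_γ_eq_proj hθ)
  obtain ⟨ℓ, r, h⟩ := hc.exists_frame ν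
  exact ⟨a, b, ℓ, r, h, hm⟩

lemma pos_of_ne_zero {g : ℝ → ℝ} {T : ℝ} (hT : 0 ≤ T) (hg : ContinuousOn g (Icc 0 T))
    (hne : ∀ t ∈ Icc 0 T, g t ≠ 0) (h0 : 0 < g 0) : 0 < g T := by
  by_contra hle
  obtain ⟨t, ht, h⟩ := intermediate_value_Icc' hT hg ⟨not_lt.1 hle, h0.le⟩
  exact hne t ht h

/-- An uncaptured intruder stays between two closing defenders. -/
lemma exists_frame_of_not_captured (hν : 0 < ν) (hν' : ν ≤ 1) {s₁ s₂ A B T : ℝ} (hT : 0 ≤ T)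
    {X : ℝ → Plane} (hX : ∀ t t', dist (X t) (X t') ≤ ν * |t - t'|)
    (hint : ∀ t ∈ Icc 0 T, X t ∉ interior P.region) (h : Frame P ν (X 0) a b ℓ r)
    (hA : ∃ k : ℤ, A = s₁ + k * P.L) (hB : ∃ k : ℤ, B = s₂ + k * P.L)
    (hA' : A < base P ν (X 0) ℓ r) (hB' : base P ν (X 0) ℓ r < B)
    (hc : ∀ t ∈ Icc 0 T, ¬ Captured P ν (s₁ + t) (s₂ - t) (X t)) :
    ∃ a' b' ℓ' r', Frame P ν (X T) a' b' ℓ' r' ∧ Linked P (ν * T) (X 0) a b (X T) a' b' ∧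
      A + T < base P ν (X T) ℓ' r' ∧ base P ν (X T) ℓ' r' < B - T := by
  have hXc : Continuous X := (LipschitzWith.of_dist_le_mul (K := ν.toNNReal) fun t t' => by
    rw [Real.dist_eq, Real.coe_toNNReal ν hν.le]; exact hX t t').continuous
  have m0 : (0 : ℝ) ∈ Icc 0 T := left_mem_Icc.2 hT
  have mT : T ∈ Icc 0 T := right_mem_Icc.2 hT
  obtain ⟨θ₀, hθ₀, hp0⟩ := exists_lift_mem_chart h.chart
  obtain ⟨θ, hθ, hθ0, hθp⟩ := exists_path_lift hT hXc.continuousOn hint hp0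
  -- Charts are determined only up to periods. Requiring that they contain the lifted projection `θ
  -- t` makes the base a Lipschitz function of time.
  have hex : ∀ t, ∃ a' b' ℓ' r', t ∈ Icc 0 T → Frame P ν (X t) a' b' ℓ' r' ∧ θ t ∈ Icc a' b' := by
    intro t
    by_cases ht : t ∈ Icc 0 T
    · obtain ⟨a', b', ℓ', r', hf⟩ := exists_frame_mem ν (hint t ht) (hθp t ht)
      exact ⟨a', b', ℓ', r', fun _ => hf⟩
    · exact ⟨0, 0, 0, 0, fun h => absurd h ht⟩
  choose ca cb cl cr hf using hex
  set σ := fun t => base P ν (X t) (cl t) (cr t)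
  have hlink : ∀ t ∈ Icc 0 T, ∀ t' ∈ Icc 0 T, t ≤ t' →
      Linked P (ν * (t' - t)) (X t) (ca t) (cb t) (X t') (ca t') (cb t') := fun t ht t' ht' hle =>
    linked_of_path hle hν.le (fun τ _ τ' _ => hX τ τ')
      (hθ.mono (Icc_subset_Icc ht.1 ht'.2)) (fun τ hτ => hθp τ ⟨ht.1.trans hτ.1, hτ.2.trans ht'.2⟩)
      (hf t ht).1.chart (hf t ht).2 (hf t' ht').1.chart (hf t' ht').2
  have hlink0 := linked_of_path hT hν.le (fun τ _ τ' _ => hX τ τ') hθ hθp h.chart (hθ0 ▸ hθ₀)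
    (hf T mT).1.chart (hf T mT).2
  have h00 := linked_of_path le_rfl hν.le (fun τ _ τ' _ => hX τ τ')
    (hθ.mono (Icc_subset_Icc_right hT)) (fun τ hτ => hθp τ ⟨hτ.1, hτ.2.trans hT⟩) h.chart
    (hθ0 ▸ hθ₀) (hf 0 m0).1.chart (hf 0 m0).2
  -- A link of length zero shows that the frame chosen at time `0` has the same base as the given
  -- one.
  have hσ0 : base P ν (X 0) ℓ r = σ 0 := by
    have := h.abs_base_sub_le (hf 0 m0).1 hν hν' h00
    rw [sub_self, mul_zero, zero_div] at this
    exact sub_eq_zero.1 (abs_eq_zero.1 (le_antisymm this (abs_nonneg _)))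
  have hσlip : ∀ t ∈ Icc 0 T, ∀ t' ∈ Icc 0 T, t ≤ t' → |σ t - σ t'| ≤ t' - t :=
    fun t ht t' ht' hle => by
      have := (hf t ht).1.abs_base_sub_le (hf t' ht').1 hν hν' (hlink t ht t' ht' hle)
      rwa [mul_div_cancel_left₀ _ hν.ne'] at this
  have hσ : ContinuousOn σ (Icc 0 T) := (LipschitzOnWith.of_dist_le_mul (K := 1)
    fun t ht t' ht' => by
      rw [Real.dist_eq, Real.dist_eq, NNReal.coe_one, one_mul]
      rcases le_total t t' with hle | hle
      · rw [abs_sub_comm t, abs_of_nonneg (sub_nonneg.2 hle)]; exact hσlip t ht t' ht' hle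
      · rw [abs_sub_comm, abs_of_nonneg (sub_nonneg.2 hle)]
        exact hσlip t' ht' t ht hle).continuousOn
  have hnc : ∀ t ∈ Icc 0 T, σ t ≠ A + t ∧ σ t ≠ B - t := fun t ht => by
    have h1 := hc t ht
    rw [Captured, (hf t ht).1.mem_afferent_iff hν, (hf t ht).1.mem_afferent_iff hν, not_or] at h1
    obtain ⟨m, hm⟩ := hA
    obtain ⟨n, hn⟩ := hB
    refine ⟨fun heq => h1.1 ⟨-m, ?_⟩, fun heq => h1.2 ⟨-n, ?_⟩⟩
    · change s₁ + t = σ t + _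
      rw [heq]; push_cast; linarith
    · change s₂ - t = σ t + _
      rw [heq]; push_cast; linarith
  -- Capture means that the base meets a defender. Without capture these continuous differences
  -- never vanish and keep their signs.
  have e1 := pos_of_ne_zero hT (g := fun t => σ t - (A + t)) (hσ.sub (by fun_prop))
    (fun t ht => sub_ne_zero.2 (hnc t ht).1) (by simp only [add_zero]; linarith)
  have e2 := pos_of_ne_zero hT (g := fun t => B - t - σ t)
    ((show ContinuousOn (fun t => B - t) (Icc 0 T) by fun_prop).sub hσ)
    (fun t ht => sub_ne_zero.2 (hnc t ht).2.symm) (by simp only [sub_zero]; linarith)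
  refine ⟨ca T, cb T, cl T, cr T, (hf T mT).1, by simpa using hlink0, ?_, ?_⟩
  · exact sub_pos.1 e1
  · exact sub_pos.1 e2

variable {si sj : ℝ} {xA : Plane}

lemma position_pincer_fst (si t : ℝ) : position si pincer.1.1 t = si + t := by
  simp [position, pincer]

lemma position_pincer_snd (sj t : ℝ) : position sj pincer.1.2 t = sj - t := by
  simp [position, pincer, sub_eq_add_neg]

/-- The pincer maneuver keeps the payoff below the value. -/
lemma payoff_pincer_le (hν : 0 < ν) (hν' : ν ≤ 1) (hx : xA ∈ intruderWinning P ν si sj)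
    (u : IntruderControl ν) : payoff P ν si sj xA pincer u ≤ Vij P ν si sj xA := by
  have hmot := motion_position si sj xA pincer u
  set X := position xA u.1
  have hX0 : X 0 = xA := position_zero _ _
  have h0 : X 0 ∉ interior P.region := by rw [hX0]; exact hx.1.1
  rw [payoff]
  by_cases hex : ∃ t, BreachAt P ν (position si pincer.1.1) (position sj pincer.1.2) X t
  swap
  · rw [motionPayoff_of_not_exists hex]; exact hx.2.le
  obtain ⟨T, hb⟩ := hex
  rw [hb.motionPayoff_eq hmot hν h0]
  have hint := hb.not_mem_interior hmot h0
  obtain ⟨a, b, ℓ, r, h⟩ := exists_frame (P := P) ν h0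
  obtain ⟨A, B, hA, hB, h1, h2, h3⟩ := (h.mem_part_iff hν _ _).1 (by rw [hX0]; exact hx.1)
  obtain ⟨s, hs, -, hV⟩ := h.sOpt_spec hν hA hB h1 h2 h3
  obtain ⟨a', b', ℓ', r', h', hl, k1, k2⟩ := exists_frame_of_not_captured hν hν' hb.1 hmot.lip hint
    h hA hB h1 h2 fun t ht => by
      rcases ht.2.lt_or_eq with hlt | rfl
      · have := hb.2.1 t ⟨ht.1, hlt⟩
        rw [position_pincer_fst, position_pincer_snd] at this
        exact fun hc => this (Or.inr hc)
      · have := hb.2.2.2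
        rwa [position_pincer_fst, position_pincer_snd] at this
  have hℓ : P.γ ℓ' = X T := by
    obtain ⟨e1, e2⟩ := h'.chart.exists_eq_of_mem hb.2.2.1
    have hm := h'.left.1
    rw [e1, Icc_self, mem_singleton_iff] at hm
    rw [hm, e2]
  rw [← hℓ] at h' k1 k2
  rw [h'.eq_of_mem.2] at k1 k2
  have hT := hb.1
  have hcl : clearance P (position si pincer.1.1 T) (position sj pincer.1.2 T) ℓ' =
      tent A B ℓ' - T := by
    obtain ⟨m, rfl⟩ := hA
    obtain ⟨n, rfl⟩ := hB
    rw [position_pincer_fst, position_pincer_snd,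
      ← clearance_congr (s₁' := si + m * P.L + T) (s₂' := sj + n * P.L - T) ⟨m, by ring⟩
      ⟨n, by ring⟩, clearance_eq_tent (by linarith) ⟨k1.le, k2.le⟩, tent, tent, ← min_sub_sub_right]
    congr 1 <;> ring
  rw [← hℓ, margin_eq_clearance, hcl, ← hX0, hV]
  -- Seen from the start, the breach point can be replaced by a visible point at a cost of at most
  -- `ν T / ν = T`, which is just what the tent loses while both defenders close in.
  have := hl.2.opt_le hν hν' (tent_sub_le A B) h'.left.1 hs
  rw [mul_div_cancel_left₀ _ hν.ne', hℓ, dist_self, zero_div] at this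
  linarith

/-- The pincer maneuver ends the game in finite time. -/
lemma not_neverEnds_pincer (hν : 0 < ν) (hν' : ν ≤ 1) (hx : xA ∈ part P ν si sj)
    (u : IntruderControl ν) : ¬ NeverEnds P ν si sj xA pincer u := by
  intro hn
  have hmot := motion_position si sj xA pincer u
  set X := position xA u.1
  have hX0 : X 0 = xA := position_zero _ _
  have h0 : X 0 ∉ interior P.region := by rw [hX0]; exact hx.1
  obtain ⟨a, b, ℓ, r, h⟩ := exists_frame (P := P) ν h0
  obtain ⟨A, B, hA, hB, h1, h2, h3⟩ := (h.mem_part_iff hν _ _).1 (by rw [hX0]; exact hx)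
  have hL := P.L_pos
  have hrun := hn P.L hL.le
  obtain ⟨a', b', ℓ', r', h', hl, k1, k2⟩ := exists_frame_of_not_captured hν hν' hL.le hmot.lip
    (fun t ht hi => hrun t ht (Or.inl (interior_subset hi)))
    h hA hB h1 h2 fun t ht hc => by
      have := hrun t ht
      rw [position_pincer_fst, position_pincer_snd] at this
      exact this (Or.inr hc)
  linarith

end Pincer

/-! ### The value of the game -/

section OpenLoop

variable {P : Target} {ν : ℝ}

/-- A straight motion towards an optimal point secures the margin against every control of the
defenders. -/
lemma exists_control_le_payoff (hν : 0 < ν) (hν' : ν ≤ 1) {a₁ a₂ : ℝ} {x₀ : Plane}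
    (hx₀ : x₀ ∉ interior P.region) (hm : 0 < margin P ν a₁ a₂ x₀) :
    ∃ u : IntruderControl ν, ∀ ω, margin P ν a₁ a₂ x₀ ≤ payoff P ν a₁ a₂ x₀ ω u := by
  by_cases hT : x₀ ∈ P.region
  · refine ⟨⟨fun _ => 0, measurable_const, fun _ => by simpa using hν.le⟩, fun ω => ?_⟩
    refine (motion_position a₁ a₂ x₀ ω _).le_motionPayoff hν hν' (by rwa [position_zero]) hm
      (fun T hT' hX => ?_) ⟨0, le_rfl, by rwa [position_zero]⟩
    rcases hT'.eq_or_lt with rfl | hpos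
    · rw [position_zero, position_zero, position_zero]
    · exact absurd (by rwa [position_zero]) (hX 0 ⟨le_rfl, hpos⟩)
  obtain ⟨e, R, he⟩ := exists_isHeading ν hT a₁ a₂
  have hu : ∀ t : ℝ, ‖(fun _ => ν • e) t‖ ≤ ν := fun t => by
    rw [norm_smul, he.norm_eq, mul_one, Real.norm_of_nonneg hν.le]
  refine ⟨⟨fun _ => ν • e, measurable_const, hu⟩, fun ω => ?_⟩
  have hpos : ∀ t, position x₀ (fun _ => ν • e) t = x₀ + (t * ν) • e := fun t => by
    rw [position, intervalIntegral.integral_const, sub_zero, smul_smul]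
  have hmot := motion_position a₁ a₂ x₀ ω (⟨fun _ => ν • e, measurable_const, hu⟩ :
    IntruderControl ν)
  have hR := he.pos
  obtain ⟨a, b, s, hc, hs, hγ⟩ := he.exists_opt
  have hhit : position x₀ (fun _ => ν • e) (R / ν) = P.γ s := by
    rw [hpos, hγ, div_mul_cancel₀ _ hν.ne']
  have hsh : ∀ T, 0 ≤ T → |position a₁ ω.1.1 T - a₁| ≤ T ∧ |position a₂ ω.1.2 T - a₂| ≤ T :=
    fun T hT' => by
      have h1 := hmot.lip₁ T 0
      have h2 := hmot.lip₂ T 0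
      rw [position_zero, sub_zero, abs_of_nonneg hT'] at h1 h2
      exact ⟨h1, h2⟩
  refine hmot.le_motionPayoff hν hν' (by rwa [position_zero]) hm (fun T hT' hX => ?_)
    ⟨R / ν, by positivity, by rw [hhit]; exact γ_mem P s⟩
  change _ ≤ margin P ν _ _ (position x₀ (fun _ => ν • e) T)
  rcases lt_trichotomy T (R / ν) with hlt | rfl | hgt
  · have hq : T * ν < R := (lt_div_iff₀ hν).1 hlt
    obtain ⟨f1, -, f3⟩ := he.margin_forward hT hν hν' (by positivity) hq
    rw [← hpos] at f1 f3
    have f2 := margin_sub_le' (ν := ν) (fun hi => f3 (interior_subset hi)) (hsh T hT').1 (hsh T hT').2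
    rw [f1, mul_div_cancel_right₀ _ hν.ne'] at f2
    linarith
  · have f2 := clearance_sub_le' (P := P) (hsh _ hT').1 (hsh _ hT').2 s
    rw [hhit, margin_eq_clearance, hs.margin_eq hc, he.dist_eq hγ]
    linarith
  · exact absurd (by
      change position x₀ (fun _ => ν • e) (R / ν) ∈ P.region
      rw [hhit]; exact γ_mem P s) (hX (R / ν) ⟨by positivity, hgt⟩)

/-- The value of the game. -/
lemma isGameValue_Vij (hν : 0 < ν) (hν' : ν ≤ 1) {si sj : ℝ} {xA : Plane}
    (hx : xA ∈ intruderWinning P ν si sj) :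
    IsGameValue P ν si sj xA (Vij P ν si sj xA) := by
  have hm := margin_eq_Vij hν hν' hx.1 hx.2
  obtain ⟨u, hu⟩ := exists_control_le_payoff hν hν' hx.1.1 (by rw [hm]; exact hx.2)
  rw [hm] at hu
  -- Optimal strategies may be constant: a straight motion for the intruder, the pincer for the
  -- defenders. Each one played against an arbitrary strategy of the other side gives the matching
  -- bound.
  refine ⟨⟨⟨⟨fun _ => u, fun _ _ _ _ _ => EventuallyEq.rfl⟩, hu⟩, ?_⟩,
    ⟨⟨⟨fun _ => pincer, fun _ _ _ _ => ⟨EventuallyEq.rfl, EventuallyEq.rfl⟩⟩,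
      payoff_pincer_le hν hν' hx⟩, ?_⟩⟩
  · rintro c ⟨α, hα⟩
    exact (hα pincer).trans (payoff_pincer_le hν hν' hx _)
  · rintro c ⟨β, hβ⟩
    exact (hu _).trans (hβ u)

end OpenLoop

end PerimeterDefense

namespace PerimeterDefense

open Filter Topology RealInnerProductSpace

/-! ### Cut-off feedback fields and closed-loop solutions -/

section ClosedLoop

variable {P : Target} {ν : ℝ} {s₁ s₂ s₁' s₂' R δ : ℝ} {x x' : Plane}

lemma div_mul_self_le {p q : ℝ} (hp : 0 ≤ p) (hq : 0 ≤ q) : p / q * q ≤ p := by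
  rcases hq.eq_or_lt with rfl | hq
  · rwa [mul_zero]
  · rw [div_mul_cancel₀ _ hq.ne']

lemma norm_intruderFeedback_le (hν : 0 < ν) (s₁ s₂ : ℝ) (x : Plane) :
    ‖intruderFeedback P ν s₁ s₂ x‖ ≤ ν := by
  rw [intruderFeedback, norm_smul, norm_div, norm_norm, Real.norm_of_nonneg hν.le]
  exact div_mul_self_le hν.le (norm_nonneg _)

variable (P ν) in
/-- Cutoff function, equal to one where the intruder is far from the target and the margin is
large. -/
noncomputable def cutoff (R s₁ s₂ : ℝ) (x : Plane) : ℝ :=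
  max 0 (min 1 (min (Metric.infDist x P.region / R - 4) (ν * margin P ν s₁ s₂ x / R - 1)))

lemma cutoff_nonneg : 0 ≤ cutoff P ν R s₁ s₂ x := le_max_left _ _

lemma cutoff_le_one : cutoff P ν R s₁ s₂ x ≤ 1 := max_le zero_le_one (min_le_left _ _)

lemma of_cutoff_pos (hν : 0 < ν) (hR : 0 < R) (h : 0 < cutoff P ν R s₁ s₂ x) :
    4 * R < Metric.infDist x P.region ∧ R / ν < margin P ν s₁ s₂ x := by
  rw [cutoff, lt_max_iff, lt_min_iff, lt_min_iff] at h
  obtain ⟨-, h1, h2⟩ := h.resolve_left (lt_irrefl _)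
  rw [sub_pos, lt_div_iff₀ hR] at h1 h2
  exact ⟨h1, by rw [div_lt_iff₀ hν]; linarith⟩

lemma cutoff_eq_one (hν : 0 < ν) (hR : 0 < R) (h1 : 5 * R ≤ Metric.infDist x P.region)
    (h2 : 2 * R / ν ≤ margin P ν s₁ s₂ x) : cutoff P ν R s₁ s₂ x = 1 := by
  have e1 : 5 ≤ Metric.infDist x P.region / R := (le_div_iff₀ hR).2 h1
  have e2 : 2 ≤ ν * margin P ν s₁ s₂ x / R := by
    rw [le_div_iff₀ hR]; rw [div_le_iff₀ hν] at h2; linarith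
  rw [cutoff, min_eq_left (le_min (by linarith) (by linarith)), max_eq_right zero_le_one]

lemma not_mem_of_infDist_pos (h : 0 < Metric.infDist x P.region) : x ∉ P.region := fun hx =>
  h.ne' (Metric.infDist_zero_of_mem hx)

lemma cutoff_le_add (hν : 0 < ν) (hν' : ν ≤ 1) (hR : 0 < R) (hd : dist x x' < R)
    (h₁ : |s₁' - s₁| ≤ δ) (h₂ : |s₂' - s₂| ≤ δ) :
    cutoff P ν R s₁ s₂ x ≤ cutoff P ν R s₁' s₂' x' + (dist x x' + ν * δ) / R := by
  have hδ : 0 ≤ δ := (abs_nonneg _).trans h₁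
  have hη : 0 ≤ (dist x x' + ν * δ) / R := by positivity
  rcases (cutoff_nonneg (P := P) (ν := ν) (R := R) (s₁ := s₁) (s₂ := s₂) (x := x)).eq_or_lt with
    h0 | hpos
  · rw [← h0]; exact add_nonneg cutoff_nonneg hη
  obtain ⟨k1, k2⟩ := of_cutoff_pos hν hR hpos
  have hseg := segment_not_mem_interior (P := P) (x₀ := x) (x := x) (y := x') (D := 4 * R) k1.le
    (by rw [dist_self]; linarith) (by rw [dist_comm]; linarith)
  have m1 := margin_sub_le (s₁ := s₁) (s₂ := s₂) hν hν' hseg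
  have m2 := margin_sub_le' (ν := ν) (hseg _ (right_mem_segment _ _ _)) h₁ h₂
  have m3 := Metric.infDist_le_infDist_add_dist (s := P.region) (x := x) (y := x')
  have e1 : Metric.infDist x P.region / R - 4 ≤
      Metric.infDist x' P.region / R - 4 + (dist x x' + ν * δ) / R := by
    rw [sub_add_eq_add_sub, ← add_div]
    have : 0 ≤ ν * δ := by positivity
    gcongr
    linarith
  have e2 : ν * margin P ν s₁ s₂ x / R - 1 ≤
      ν * margin P ν s₁' s₂' x' / R - 1 + (dist x x' + ν * δ) / R := by
    rw [sub_add_eq_add_sub, ← add_div]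
    have h3 : dist x x' / ν * ν = dist x x' := div_mul_cancel₀ _ hν.ne'
    have h4 : margin P ν s₁ s₂ x ≤ margin P ν s₁' s₂' x' + δ + dist x x' / ν := by linarith
    have h5 := mul_le_mul_of_nonneg_left h4 hν.le
    gcongr
    linarith
  rw [cutoff, cutoff, ← max_add_add_right, ← min_add_add_right, ← min_add_add_right]
  exact max_le_max (by linarith) (min_le_min (by linarith) (min_le_min e1 e2))

lemma abs_cutoff_sub_le (hν : 0 < ν) (hν' : ν ≤ 1) (hR : 0 < R) (hd : dist x x' < R)
    (h₁ : |s₁' - s₁| ≤ δ) (h₂ : |s₂' - s₂| ≤ δ) :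
    |cutoff P ν R s₁ s₂ x - cutoff P ν R s₁' s₂' x'| ≤ (dist x x' + ν * δ) / R := by
  have e1 := cutoff_le_add (P := P) hν hν' hR hd h₁ h₂
  rw [dist_comm] at hd
  rw [abs_sub_comm] at h₁ h₂
  have e2 := cutoff_le_add (P := P) hν hν' hR hd h₁ h₂
  rw [dist_comm x' x] at e2
  rw [abs_le]
  constructor <;> linarith

variable (P ν) in
/-- The feedback strategy, multiplied by the cutoff function. -/
noncomputable def cutoffField (R s₁ s₂ : ℝ) (x : Plane) : Plane :=
  cutoff P ν R s₁ s₂ x • intruderFeedback P ν s₁ s₂ x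

lemma norm_cutoffField_le (hν : 0 < ν) : ‖cutoffField P ν R s₁ s₂ x‖ ≤ ν := by
  rw [cutoffField, norm_smul, Real.norm_of_nonneg cutoff_nonneg]
  have h1 := norm_intruderFeedback_le (P := P) hν s₁ s₂ x
  calc _ ≤ 1 * ν := mul_le_mul cutoff_le_one h1 (norm_nonneg _) zero_le_one
    _ = ν := one_mul _

/-- For `δ = 0` the bound is linear in the displacement of the intruder; for `x = x'` it tends to
zero with `δ`, which yields continuity in time. Where one cutoff vanishes, only the difference of
the cutoffs matters. Where both are positive, there is enough room for `IsHeading.norm_sub_sq_le`.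
-/
lemma norm_cutoffField_sub_le (hν : 0 < ν) (hν' : ν ≤ 1) (hR : 0 < R) (hd : dist x x' < R)
    (h₁ : |s₁' - s₁| ≤ δ) (h₂ : |s₂' - s₂| ≤ δ) :
    ‖cutoffField P ν R s₁ s₂ x - cutoffField P ν R s₁' s₂' x'‖ ≤
      ν * ((dist x x' + ν * δ) / R) + ν * √((dist x x' / R) ^ 2 + 4 * (ν * δ) / R) := by
  have hχ := abs_cutoff_sub_le (P := P) hν hν' hR hd h₁ h₂
  have hg := norm_intruderFeedback_le (P := P) hν s₁ s₂ x
  have hg' := norm_intruderFeedback_le (P := P) hν s₁' s₂' x'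
  have hr : 0 ≤ ν * √((dist x x' / R) ^ 2 + 4 * (ν * δ) / R) := by positivity
  set χ := cutoff P ν R s₁ s₂ x with hχdef
  set χ' := cutoff P ν R s₁' s₂' x' with hχdef'
  set g := intruderFeedback P ν s₁ s₂ x with hgdef
  set g' := intruderFeedback P ν s₁' s₂' x' with hgdef'
  have hχ0 : 0 ≤ χ := cutoff_nonneg
  have hχ0' : 0 ≤ χ' := cutoff_nonneg
  have hχ1 : χ ≤ 1 := cutoff_le_one
  have hdiff : ‖(χ - χ') • g'‖ ≤ ν * ((dist x x' + ν * δ) / R) := by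
    rw [norm_smul, mul_comm]
    exact mul_le_mul hg' hχ (abs_nonneg _) hν.le
  have hdiff' : ‖(χ - χ') • g‖ ≤ ν * ((dist x x' + ν * δ) / R) := by
    rw [norm_smul, mul_comm]
    exact mul_le_mul hg hχ (abs_nonneg _) hν.le
  change ‖χ • g - χ' • g'‖ ≤ _
  rcases hχ0.eq_or_lt with h0 | hpos
  · rw [← h0, zero_smul, ← zero_smul ℝ g', h0, ← sub_smul]; linarith
  rcases hχ0'.eq_or_lt with h0' | hpos'
  · rw [← h0', zero_smul, ← zero_smul ℝ g, h0', ← sub_smul]; linarith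
  obtain ⟨k1, k2⟩ := of_cutoff_pos hν hR hpos
  obtain ⟨k1', k2'⟩ := of_cutoff_pos hν hR hpos'
  have hRν : 0 < R / ν := div_pos hR hν
  obtain ⟨e, r, he, heq⟩ := exists_intruderFeedback_eq hν hν' (not_mem_of_infDist_pos
    (by linarith : 0 < Metric.infDist x P.region)) (hRν.trans k2)
  obtain ⟨e', r', he', heq'⟩ := exists_intruderFeedback_eq hν hν' (not_mem_of_infDist_pos
    (by linarith : 0 < Metric.infDist x' P.region)) (hRν.trans k2')
  have hsq := he.norm_sub_sq_le hν hν' hR k1.le (by rwa [dist_self]) (by rwa [dist_comm]) he' k2 k2'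
    h₁ h₂
  have hgg : ‖g - g'‖ ≤ ν * √((dist x x' / R) ^ 2 + 4 * (ν * δ) / R) := by
    rw [hgdef, hgdef', heq, heq', ← smul_sub, norm_smul, Real.norm_of_nonneg hν.le]
    exact mul_le_mul_of_nonneg_left (Real.le_sqrt_of_sq_le hsq) hν.le
  calc ‖χ • g - χ' • g'‖ = ‖(χ - χ') • g' + χ • (g - g')‖ := by congr 1; module
    _ ≤ ‖(χ - χ') • g'‖ + ‖χ • (g - g')‖ := norm_add_le _ _
    _ ≤ _ := by
      refine add_le_add hdiff ?_
      rw [norm_smul, Real.norm_of_nonneg hχ0]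
      exact (mul_le_of_le_one_left (norm_nonneg _) hχ1).trans hgg

lemma lipschitzWith_cutoffField (hν : 0 < ν) (hν' : ν ≤ 1) (hR : 0 < R) (s₁ s₂ : ℝ) :
    LipschitzWith (2 * ν / R).toNNReal (cutoffField P ν R s₁ s₂) := by
  refine LipschitzWith.of_dist_le_mul fun x x' => ?_
  rw [Real.coe_toNNReal _ (by positivity), dist_eq_norm (cutoffField _ _ _ _ _ _)]
  rcases lt_or_ge (dist x x') R with hd | hd
  · have := norm_cutoffField_sub_le (P := P) (δ := 0) (s₁ := s₁) (s₂ := s₂) (s₁' := s₁) (s₂' := s₂)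
      hν hν' hR hd (by simp) (by simp)
    simp only [mul_zero, add_zero, zero_div] at this
    rw [Real.sqrt_sq (by positivity)] at this
    calc _ ≤ _ := this
      _ = _ := by ring
  · have h1 := norm_cutoffField_le (P := P) (R := R) (s₁ := s₁) (s₂ := s₂) (x := x) hν
    have h2 := norm_cutoffField_le (P := P) (R := R) (s₁ := s₁) (s₂ := s₂) (x := x') hν
    have h3 := (norm_sub_le (cutoffField P ν R s₁ s₂ x) (cutoffField P ν R s₁ s₂ x'))
    have h4 : 2 * ν ≤ 2 * ν / R * dist x x' := by
      rw [div_mul_eq_mul_div, le_div_iff₀ hR]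
      exact mul_le_mul_of_nonneg_left hd (by linarith)
    linarith

lemma continuous_cutoffField (hν : 0 < ν) (hν' : ν ≤ 1) (hR : 0 < R) {s₁ s₂ : ℝ → ℝ}
    (h₁ : ∀ t t', |s₁ t - s₁ t'| ≤ |t - t'|) (h₂ : ∀ t t', |s₂ t - s₂ t'| ≤ |t - t'|) (x : Plane) :
    Continuous fun t => cutoffField P ν R (s₁ t) (s₂ t) x := by
  rw [continuous_iff_continuousAt]
  intro t
  have hb : Continuous fun t' : ℝ => ν * (ν * |t' - t| / R) + ν * √(4 * (ν * |t' - t|) / R) := by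
    fun_prop
  rw [ContinuousAt, tendsto_iff_norm_sub_tendsto_zero]
  refine squeeze_zero (fun _ => norm_nonneg _) (fun t' => ?_) (by simpa using hb.tendsto t)
  have := norm_cutoffField_sub_le (P := P) (x := x) (x' := x) hν hν' hR (by rwa [dist_self])
    (h₁ t' t) (h₂ t' t)
  rw [norm_sub_rev]
  simpa using this

variable {E : Type*} [NormedAddCommGroup E] [NormedSpace ℝ E]

/-- A bounded vector field that is Lipschitz in the state and continuous in time has closed-loop
controls on every bounded time interval. -/
lemma exists_closed_loop [CompleteSpace E] {F : ℝ → E → E} {L K : ℝ} (hL : 0 ≤ L)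
    (hF : ∀ t, LipschitzWith K.toNNReal (F t)) (hFt : ∀ x, Continuous fun t => F t x)
    (hFb : ∀ t x, ‖F t x‖ ≤ L) (x₀ : E) {N : ℝ} (hN : 0 ≤ N) :
    ∃ v : ℝ → E, Continuous v ∧ (∀ t, ‖v t‖ ≤ L) ∧
      ∀ t ∈ Icc 0 N, v t = F t (position x₀ v t) := by
  have hPL : IsPicardLindelof F (tmin := 0) (tmax := N) ⟨0, left_mem_Icc.2 hN⟩ x₀
      (L * N).toNNReal 0 L.toNNReal K.toNNReal := by
    refine ⟨fun t _ => (hF t).lipschitzOnWith, fun x _ => (hFt x).continuousOn, fun t _ x _ => ?_,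
      ?_⟩
    · rw [Real.coe_toNNReal L hL]; exact hFb t x
    · rw [Real.coe_toNNReal L hL, Real.coe_toNNReal _ (mul_nonneg hL hN)]
      simp [hN]
  obtain ⟨X, hX0, hX⟩ := hPL.exists_eq_forall_mem_Icc_hasDerivWithinAt₀
  have hXc : ContinuousOn X (Icc 0 N) := fun t ht => (hX t ht).continuousWithinAt
  have hFc : Continuous (Function.uncurry F) :=
    continuous_prod_of_continuous_lipschitzWith' _ K.toNNReal hF hFt
  set v := fun t => F (projIcc 0 N hN t) (X (projIcc 0 N hN t))
  have hv : Continuous v := by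
    have h1 : Continuous fun t => X (projIcc 0 N hN t) :=
      (continuousOn_iff_continuous_domRestrict.1 hXc).comp continuous_projIcc
    have h2 : Continuous fun t => ((projIcc 0 N hN t : Icc 0 N) : ℝ) :=
      continuous_subtype_val.comp continuous_projIcc
    exact hFc.comp (h2.prodMk h1)
  have hve : ∀ t ∈ Icc 0 N, v t = F t (X t) := fun t ht => by
    simp only [v, projIcc_of_mem hN ht]
  refine ⟨v, hv, fun t => hFb _ _, fun t ht => ?_⟩
  rw [hve t ht]
  congr 1
  have hint := intervalIntegral.integral_eq_sub_of_hasDeriv_right_of_le (f := X) (f' := v) ht.1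
    (hXc.mono (Icc_subset_Icc_right ht.2)) (fun τ hτ => by
      have hτ' : τ ∈ Icc 0 N := ⟨hτ.1.le, hτ.2.le.trans ht.2⟩
      rw [hve τ hτ']
      exact ((hX τ hτ').hasDerivAt (Icc_mem_nhds hτ.1 (hτ.2.trans_le ht.2))).hasDerivWithinAt)
    (hv.intervalIntegrable _ _)
  have hX0' : X 0 = x₀ := hX0
  rw [position, hint, hX0', add_sub_cancel]

lemma hasDerivAt_position [CompleteSpace E] {v : ℝ → E} (hv : Continuous v) (a : E) (t : ℝ) :
    HasDerivAt (position a v) (v t) t :=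
  (intervalIntegral.integral_hasDerivAt_right (hv.intervalIntegrable _ _)
    (hv.stronglyMeasurableAtFilter _ _) hv.continuousAt).const_add a

end ClosedLoop

/-! ### Existence of feedback responses -/

section Response

variable {P : Target} {ν : ℝ}

/-- Every control of the defenders has a feedback response. -/
lemma exists_isFeedbackResponse (hν : 0 < ν) (hν' : ν ≤ 1) {a₁ a₂ : ℝ} {x₀ : Plane}
    (hm : 0 < margin P ν a₁ a₂ x₀) (ω : DefenderControl) :
    ∃ u : IntruderControl ν, IsFeedbackResponse P ν a₁ a₂ x₀ ω u := by
  by_cases hT : x₀ ∈ P.region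
  · refine ⟨⟨fun _ => 0, measurable_const, fun _ => by simpa using hν.le⟩,
      Eventually.of_forall fun t ht hr => ?_⟩
    exact absurd (Or.inl (by rwa [position_zero])) (hr 0 ⟨le_rfl, ht⟩)
  set s₁ := position a₁ ω.1.1
  set s₂ := position a₂ ω.1.2
  set V := margin P ν a₁ a₂ x₀
  have hs₁ : ∀ t t', |s₁ t - s₁ t'| ≤ |t - t'| := fun t t' => by
    simpa [Real.dist_eq] using dist_position_le ω.2.1.1 ω.2.1.2 a₁ t t'
  have hs₂ : ∀ t t', |s₂ t - s₂ t'| ≤ |t - t'| := fun t t' => by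
    simpa [Real.dist_eq] using dist_position_le ω.2.2.1 ω.2.2.2 a₂ t t'
  -- The cutoff radii tend to zero and satisfy `2 R n / ν ≤ V / 2`. Hence the cutoff equals one
  -- while the margin exceeds `V / 2` and the target is farther than `5 R n`.
  set R : ℕ → ℝ := fun n => ν * V / 4 / (n + 1)
  have hR : ∀ n, 0 < R n := fun n => by positivity
  have hRV : ∀ n, 2 * R n / ν ≤ V / 2 := fun n => by
    have h1 : R n ≤ ν * V / 4 := div_le_self (by positivity) (by linarith [n.cast_nonneg (α := ℝ)])
    rw [div_le_iff₀ hν]; linarith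
  have hRanti : ∀ n m, n ≤ m → R m ≤ R n := fun n m h => by
    have : (n : ℝ) ≤ m := by exact_mod_cast h
    exact div_le_div_of_nonneg_left (by positivity) (by positivity) (by linarith)
  have hR0 : Tendsto R atTop (𝓝 0) := by
    have := (tendsto_one_div_add_atTop_nhds_zero_nat (𝕜 := ℝ)).const_mul (ν * V / 4)
    simpa [R, div_eq_mul_inv] using this
  set F : ℕ → ℝ → Plane → Plane := fun n t => cutoffField P ν (R n) (s₁ t) (s₂ t)
  have hFlip : ∀ n t, LipschitzWith (2 * ν / R n).toNNReal (F n t) := fun n t =>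
    lipschitzWith_cutoffField hν hν' (hR n) _ _
  have hex := fun n : ℕ => exists_closed_loop hν.le (hFlip n)
    (continuous_cutoffField hν hν' (hR n) hs₁ hs₂) (fun _ _ => norm_cutoffField_le hν) x₀
    (n.cast_nonneg (α := ℝ))
  choose v hvc hvb hvF using hex
  set X : ℕ → ℝ → Plane := fun n => position x₀ (v n)
  have hX0 : ∀ n, X n 0 = x₀ := fun n => position_zero _ _
  have hmot : ∀ n, Motion ν s₁ s₂ (X n) := fun n =>
    ⟨hs₁, hs₂, dist_position_le (hvc n).measurable (hvb n) x₀⟩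
  have hd : ∀ n t, HasDerivAt (X n) (v n t) t := fun n t => hasDerivAt_position (hvc n) x₀ t
  have hW0 : ∀ n, margin P ν (s₁ 0) (s₂ 0) (X n 0) = V := fun n => by
    rw [hX0]; simp only [s₁, s₂, position_zero, V]
  -- The times up to which the solution of the cut-off problem follows the true feedback. On `S n`
  -- it also solves every later problem, so by uniqueness the solutions extend each other.
  set S : ℕ → Set ℝ := fun n => {t | 0 ≤ t ∧ t ≤ n ∧
    ∀ τ ∈ Icc 0 t, 5 * R n < Metric.infDist (X n τ) P.region}
  have hSmono : ∀ n t τ, t ∈ S n → 0 ≤ τ → τ ≤ t → τ ∈ S n := fun n t τ ht h0 hle =>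
    ⟨h0, hle.trans ht.2.1, fun r hr => ht.2.2 r ⟨hr.1, hr.2.trans hle⟩⟩
  have hmargin : ∀ n t, t ∈ S n → V ≤ margin P ν (s₁ t) (s₂ t) (X n t) := by
    intro n t ht
    have hnot : ∀ τ ∈ Icc 0 t, X n τ ∉ P.region := fun τ hτ =>
      not_mem_of_infDist_pos (by linarith [ht.2.2 τ hτ, hR n])
    have := (hmot n).le_margin (T := t) hν hν' ht.1
      (fun h => hnot 0 (left_mem_Icc.2 ht.1) (interior_subset h))
      (fun τ hτ => hnot τ ⟨hτ.1, hτ.2.le⟩) (by rw [hW0]; exact hm)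
      (Eventually.of_forall fun τ hτ hW => by
        have h1 := hW τ (right_mem_Icc.2 hτ.1.le)
        rw [hW0] at h1
        have h2 := hd n τ
        have hτ' : τ ∈ Icc 0 t := ⟨hτ.1.le, hτ.2.le⟩
        rwa [hvF n τ ⟨hτ.1.le, hτ.2.le.trans ht.2.1⟩, show F n τ (position x₀ (v n) τ) =
          intruderFeedback P ν (s₁ τ) (s₂ τ) (X n τ) by
            simp only [F, cutoffField]
            rw [cutoff_eq_one hν (hR n) (ht.2.2 τ hτ').le ((hRV n).trans h1.le), one_smul]] at h2)
      t (right_mem_Icc.2 ht.1)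
    rwa [hW0] at this
  have hfield : ∀ n m t, n ≤ m → t ∈ S n →
      F m t (X n t) = intruderFeedback P ν (s₁ t) (s₂ t) (X n t) := fun n m t hnm ht => by
    have h1 := ht.2.2 t (right_mem_Icc.2 ht.1)
    have h2 := hRanti n m hnm
    simp only [F, cutoffField]
    rw [cutoff_eq_one hν (hR m) (by linarith)
      ((hRV m).trans (by linarith [hmargin n t ht])), one_smul]
  have hvS : ∀ n t, t ∈ S n → v n t = intruderFeedback P ν (s₁ t) (s₂ t) (X n t) := fun n t ht => by
    rw [hvF n t ⟨ht.1, ht.2.1⟩]; exact hfield n n t le_rfl ht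
  have huniq : ∀ n m t, n ≤ m → t ∈ S n → X m t = X n t := fun n m t hnm ht => by
    have hnm' : (n : ℝ) ≤ m := by exact_mod_cast hnm
    exact ODE_solution_unique (v := F m) (hFlip m) (hmot m).continuous.continuousOn
      (fun τ hτ => by
        have h1 := (hd m τ).hasDerivWithinAt (s := Ici τ)
        rwa [hvF m τ ⟨hτ.1, (hτ.2.le.trans ht.2.1).trans hnm'⟩] at h1)
      (hmot n).continuous.continuousOn
      (fun τ hτ => by
        have hτS := hSmono n t τ ht hτ.1 hτ.2.le
        have h1 := (hd n τ).hasDerivWithinAt (s := Ici τ)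
        rwa [hvS n τ hτS, ← hfield n m τ hnm hτS] at h1)
      ((hX0 m).trans (hX0 n).symm) (right_mem_Icc.2 ht.1)
  have hSS : ∀ n m t, n ≤ m → t ∈ S n → t ∈ S m := fun n m t hnm ht => by
    have hnm' : (n : ℝ) ≤ m := by exact_mod_cast hnm
    refine ⟨ht.1, ht.2.1.trans hnm', fun τ hτ => ?_⟩
    rw [huniq n m τ hnm (hSmono n t τ ht hτ.1 hτ.2)]
    linarith [ht.2.2 τ hτ, hRanti n m hnm]
  have hvv : ∀ n m t, n ≤ m → t ∈ S n → v m t = v n t := fun n m t hnm ht => by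
    rw [hvS m t (hSS n m t hnm ht), hvS n t ht, huniq n m t hnm ht]
  have hSmeas : ∀ n, MeasurableSet (S n) := fun n =>
    (ordConnected_of_Ioo fun t ht t' ht' _ r hr =>
      hSmono n t' r ht' (ht.1.trans hr.1.le) hr.2.le).measurableSet
  -- The glued control is the pointwise limit of these, hence measurable; it is zero at the times
  -- that no `S n` contains.
  set w : ℕ → ℝ → Plane := fun n => (S n).indicator (v n)
  have hlim : ∀ t, ∃ y, ∃ n, ∀ m, n ≤ m → w m t = y := fun t => by
    by_cases h : ∃ n, t ∈ S n
    · obtain ⟨n, hn⟩ := h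
      exact ⟨v n t, n, fun m hm => by
        simp only [w]; rw [indicator_of_mem (hSS n m t hm hn), hvv n m t hm hn]⟩
    · push Not at h
      exact ⟨0, 0, fun m _ => by simp only [w]; rw [indicator_of_notMem (h m)]⟩
  choose u hu using hlim
  have hum : Measurable u := by
    refine measurable_of_tendsto_metrizable (fun n => (hvc n).measurable.indicator (hSmeas n))
      (tendsto_pi_nhds.2 fun t => ?_)
    obtain ⟨n, hn⟩ := hu t
    exact tendsto_const_nhds.congr' ((eventually_ge_atTop n).mono fun m hm => (hn m hm).symm)
  have hub : ∀ t, ‖u t‖ ≤ ν := fun t => by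
    obtain ⟨n, hn⟩ := hu t
    rw [← hn n le_rfl]
    exact (norm_indicator_le_norm_self _ _).trans (hvb n t)
  have huS : ∀ n t, t ∈ S n → u t = v n t := fun n t ht => by
    obtain ⟨m, hm⟩ := hu t
    rw [← hm _ (le_max_left m n)]
    simp only [w]
    rw [indicator_of_mem (hSS n _ t (le_max_right _ _) ht), hvv n _ t (le_max_right _ _) ht]
  have hpos : ∀ n t, t ∈ S n → position x₀ u t = X n t := fun n t ht => by
    simp only [X, position]
    congr 1
    refine intervalIntegral.integral_congr fun τ hτ => ?_
    rw [uIcc_of_le ht.1] at hτ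
    exact huS n τ (hSmono n t τ ht hτ.1 hτ.2)
  refine ⟨⟨u, hum, hub⟩, Eventually.of_forall fun t ht hr => ?_⟩
  have hcont : Continuous (position x₀ u) := (motion_position a₁ a₂ x₀ ω
    (⟨u, hum, hub⟩ : IntruderControl ν)).continuous
  have hne : P.region.Nonempty := ⟨_, interior_subset P.interior_nonempty.some_mem⟩
  -- While the game runs, the glued motion keeps a positive distance from the target on `[0, t]`.
  -- Take `n` with `5 R n` below this distance. If `t` were not in `S n`, then at the first time at
  -- which `X n` comes within `5 R n` of the target it would still agree with the glued motion.
  obtain ⟨t', ht', hmin⟩ := isCompact_Icc.exists_isMinOn (nonempty_Icc.2 ht)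
    ((Metric.continuous_infDist_pt P.region).comp hcont).continuousOn
  have hdpos : 0 < Metric.infDist (position x₀ u t') P.region :=
    (P.isCompact_region.isClosed.notMem_iff_infDist_pos hne).1 fun h => hr t' ht' (Or.inl h)
  have hev : ∀ᶠ n in atTop, 5 * R n < Metric.infDist (position x₀ u t') P.region := by
    have h5 := hR0.const_mul 5
    rw [mul_zero] at h5
    exact h5.eventually (gt_mem_nhds hdpos)
  obtain ⟨n, hn, hnt⟩ := (hev.and (eventually_ge_atTop ⌈t⌉₊)).exists
  have htn : t ≤ n := Nat.ceil_le.1 hnt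
  have hmem : t ∈ S n := by
    by_contra hcon
    have hset : (Icc 0 t ∩ (fun τ => Metric.infDist (X n τ) P.region) ⁻¹' Iic (5 * R n)).Nonempty := by
      by_contra hempty
      refine hcon ⟨ht, htn, fun τ hτ => ?_⟩
      by_contra hle
      exact hempty ⟨τ, hτ, not_lt.1 hle⟩
    have hcpt : IsCompact
        (Icc 0 t ∩ (fun τ => Metric.infDist (X n τ) P.region) ⁻¹' Iic (5 * R n)) :=
      isCompact_Icc.inter_right (isClosed_Iic.preimage
        ((Metric.continuous_infDist_pt P.region).comp (hmot n).continuous))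
    obtain ⟨τ, ⟨hτ, hτR⟩, hleast⟩ := hcpt.exists_isLeast hset
    have hbefore : ∀ r ∈ Ico 0 τ, r ∈ S n := fun r hr' =>
      ⟨hr'.1, (hr'.2.le.trans hτ.2).trans htn, fun q hq => by
        by_contra hle
        exact absurd (hleast ⟨⟨hq.1, (hq.2.trans hr'.2.le).trans hτ.2⟩, not_lt.1 hle⟩)
          (not_le.2 (hq.2.trans_lt hr'.2))⟩
    have heq : position x₀ u τ = X n τ := by
      rcases hτ.1.eq_or_lt with h0 | h0
      · rw [← h0, hX0, position_zero]
      · have hcl : EqOn (position x₀ u) (X n) (closure (Ioo 0 τ)) :=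
          EqOn.closure (fun r hr' => hpos n r (hbefore r ⟨hr'.1.le, hr'.2⟩)) hcont
            (hmot n).continuous
        exact hcl (by rw [closure_Ioo h0.ne]; exact right_mem_Icc.2 h0.le)
    have h1 : Metric.infDist (X n τ) P.region ≤ 5 * R n := hτR
    have h2 : Metric.infDist (position x₀ u t') P.region ≤
        Metric.infDist (position x₀ u τ) P.region := hmin hτ
    rw [heq] at h2
    linarith
  change u t = intruderFeedback P ν (s₁ t) (s₂ t) (position x₀ u t)
  rw [huS n t hmem, hvS n t hmem, hpos n t hmem]

end Response

end PerimeterDefense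

namespace PerimeterDefense

open Filter Topology RealInnerProductSpace

/-! ### First-order behaviour of the optimal lead -/

section Direction

variable {P : Target} {ν : ℝ} {x y : Plane} {a b a' b' ℓ r : ℝ} {c : ℝ → ℝ}

/-- Transport of chart intervals along a short segment. -/
lemma linked_of_segment (hseg : ∀ z ∈ segment ℝ x y, z ∉ interior P.region) (h : Chart P x a b)
    {θ₀ θ₁ : ℝ} (hθ₀ : θ₀ ∈ Icc a b) (hp₀ : P.γ θ₀ = proj P x) (h' : Chart P y a' b')
    (hθ₁ : θ₁ ∈ Icc a' b') (hp₁ : P.γ θ₁ = proj P y) (hlt : |θ₁ - θ₀| + dist x y < P.L) :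
    Linked P (dist x y) x a b y a' b' := by
  have hmem : ∀ t ∈ Icc (0 : ℝ) 1, x + t • (y - x) ∉ interior P.region := fun t ht =>
    hseg _ (by rw [segment_eq_image']; exact ⟨t, ht, rfl⟩)
  have hm1 : (1 : ℝ) ∈ Icc (0 : ℝ) 1 := right_mem_Icc.2 zero_le_one
  obtain ⟨θ, hθ, hθ0, hθp⟩ := exists_path_lift (Y := fun t => x + t • (y - x)) zero_le_one
    (by fun_prop) hmem (by simpa using hp₀)
  have hlen := dist_proj_lift_le (Z := fun t => x + t • (y - x)) zero_le_one (norm_nonneg _)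
    (fun t _ t' _ => dist_segment _ _ t t') hθ hθp
  rw [hθ0, sub_zero, mul_one, ← dist_eq_norm, dist_comm] at hlen
  -- Both parameters name the projection of `y`; being less than a period apart, they are equal.
  have heq : θ 1 = θ₁ := by
    refine eq_of_γ_eq P (by rw [hθp 1 hm1, hp₁]; simp) ?_
    have h1 := abs_sub_le (θ 1) θ₀ θ₁
    rw [abs_sub_comm θ₀] at h1
    linarith
  have := linked_of_path (P := P) (Y := fun t => x + t • (y - x)) zero_le_one (norm_nonneg _)
    (fun t _ t' _ => dist_segment _ _ t t') hθ hθp (by simpa using h) (hθ0 ▸ hθ₀)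
    (a' := a') (b' := b') (by simpa using h') (heq ▸ hθ₁)
  simpa [dist_comm x y, dist_eq_norm] using this

/-- The direction from `x` to a perimeter point. -/
noncomputable def dir (P : Target) (x : Plane) (s : ℝ) : Plane := ‖P.γ s - x‖⁻¹ • (P.γ s - x)

lemma norm_dir (hx : x ∉ P.region) (s : ℝ) : ‖dir P x s‖ = 1 := by
  rw [dir, norm_smul, norm_inv, norm_norm,
    inv_mul_cancel₀ (norm_ne_zero_iff.2 (Chart.γ_sub_ne hx s))]

lemma dist_smul_dir (hx : x ∉ P.region) (s : ℝ) : dist (P.γ s) x • dir P x s = P.γ s - x := by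
  rw [dir, dist_eq_norm, smul_smul,
    mul_inv_cancel₀ (norm_ne_zero_iff.2 (Chart.γ_sub_ne hx s)), one_smul]

lemma norm_sub_smul_le {E : Type*} [NormedAddCommGroup E] [InnerProductSpace ℝ E] {e d : E} {q : ℝ}
    (he : ‖e‖ = 1) (hq : 0 < q) (hd : ‖d‖ ≤ q) :
    ‖d - q • e‖ ≤ q - ⟪d, e⟫ + ‖d‖ ^ 2 / (2 * q) := by
  have h1 : ‖d - q • e‖ ^ 2 = ‖d‖ ^ 2 - 2 * q * ⟪d, e⟫ + q ^ 2 := by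
    rw [norm_sub_sq_real, inner_smul_right, norm_smul, he, Real.norm_of_nonneg hq.le]; ring
  have h2 : ⟪d, e⟫ ≤ ‖d‖ := by
    have := real_inner_le_norm d e
    rwa [he, mul_one] at this
  have h3 : 0 ≤ ‖d‖ ^ 2 / (2 * q) := by positivity
  have h4 : ‖d‖ ^ 2 / (2 * q) * (2 * q) = ‖d‖ ^ 2 := div_mul_cancel₀ _ (by positivity)
  refine le_of_sq_le_sq ?_ (by linarith)
  rw [h1]
  nlinarith [sq_nonneg (⟪d, e⟫ - ‖d‖ ^ 2 / (2 * q))]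

/-- First order lower bound for the largest lead. -/
lemma IsOpt.le_of_near (hν : 0 < ν) (hν' : ν ≤ 1) (hx : x ∉ P.region) (h : Chart P x a b)
    (hc : ∀ s t, c s - c t ≤ |s - t|) {s s' θ₀ θ₁ q : ℝ} (hs : IsOpt P ν c x a b s)
    (hθ₀ : θ₀ ∈ Icc a b) (hp₀ : P.γ θ₀ = proj P x) (h' : Chart P y a' b')
    (hs' : IsOpt P ν c y a' b' s') (hθ₁ : θ₁ ∈ Icc a' b') (hp₁ : P.γ θ₁ = proj P y)
    (hq : 0 < q) (hqx : q < Metric.infDist x P.region) (hqL : 4 * q < P.L)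
    (hd : dist x y < q) (hθ : |θ₁ - θ₀| ≤ q) :
    c s - dist (P.γ s) x / ν + (⟪y - x, dir P x s⟫ - dist x y ^ 2 / (2 * q)) / ν ≤
      c s' - dist (P.γ s') y / ν := by
  have he := norm_dir hx s
  set e := dir P x s with hedef
  have hR : 0 < dist (P.γ s) x := by
    rw [dist_eq_norm]; exact norm_pos_iff.2 (Chart.γ_sub_ne hx s)
  have hqR : q < dist (P.γ s) x := by
    rw [dist_comm]; exact hqx.trans_le (Metric.infDist_le_dist_of_mem (γ_mem P s))
  have hr : q / dist (P.γ s) x ∈ Ico (0 : ℝ) 1 := ⟨by positivity, (div_lt_one hR).2 hqR⟩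
  -- Comparison with the point at distance `q` ahead on the optimal line. There `s` is still
  -- optimal, and the distance from it to `y` is `q - ⟪y - x, e⟫` to first order, so the Lipschitz
  -- estimate becomes a first-order one. The condition `4 q < L` keeps the chart representatives in
  -- step.
  have hz : x + q • e = x + (q / dist (P.γ s) x) • (P.γ s - x) := by
    rw [← dist_smul_dir hx s, smul_smul, div_mul_cancel₀ _ hR.ne']
  have hxz : dist x (x + q • e) = q := by
    rw [dist_comm, dist_eq_norm, add_sub_cancel_left, norm_smul, he, mul_one,
      Real.norm_of_nonneg hq.le]
  have hzT : x + q • e ∉ P.region := by rw [hz]; exact h.sees hx hs.1 _ hr.1 hr.2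
  have hvis := mem_visible_of_ray hx (h.visible_of_mem hs.1) hr
  rw [← hz] at hvis
  obtain ⟨a₁, b₁, h₁, hs₁⟩ := exists_chart_mem (fun hi => hzT (interior_subset hi)) hvis
  have hopt := hs.forward h hx hν hν' hc hr hz h₁ hs₁
  obtain ⟨θ, hθm, hθp, hθd, -⟩ := exists_lift_ray h hx hs.1 hr hz h₁ hs₁ hθ₀ hp₀
  rw [hxz] at hθd
  have hzy : dist (x + q • e) y < 2 * q := by
    have := dist_triangle (x + q • e) x y
    rw [dist_comm (x + q • e) x, hxz] at this
    linarith
  have hseg : ∀ z ∈ segment ℝ (x + q • e) y, z ∉ interior P.region :=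
    segment_not_mem_interior le_rfl (by rwa [dist_comm, hxz]) (by rw [dist_comm]; linarith)
  have hl := linked_of_segment hseg h₁ hθm hθp h' hθ₁ hp₁ (by
    have := abs_sub_le θ₁ θ₀ θ
    rw [abs_sub_comm θ₀] at this
    linarith)
  have hle := hl.1.opt_le hν hν' hc hs₁ hs'
  have hdz : dist (P.γ s) (x + q • e) = dist (P.γ s) x - q := by
    have e1 : P.γ s - (x + q • e) = (dist (P.γ s) x - q) • e := by
      rw [sub_smul, dist_smul_dir hx s]; abel
    rw [dist_eq_norm, e1, norm_smul, he, mul_one, Real.norm_of_nonneg (by linarith)]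
  have hfin := norm_sub_smul_le he hq (d := y - x) (by rw [← dist_eq_norm, dist_comm]; exact hd.le)
  have e2 : dist (x + q • e) y = ‖y - x - q • e‖ := by
    rw [dist_comm, dist_eq_norm]; congr 1; abel
  have e3 : ‖y - x‖ = dist x y := by rw [dist_comm, dist_eq_norm]
  rw [e3, ← e2] at hfin
  have h5 := div_le_div_of_nonneg_right hfin hν.le
  rw [hdz] at hle
  have e4 : (q - ⟪y - x, e⟫ + dist x y ^ 2 / (2 * q)) / ν =
      q / ν - (⟪y - x, e⟫ - dist x y ^ 2 / (2 * q)) / ν := by ring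
  have e5 : (dist (P.γ s) x - q) / ν = dist (P.γ s) x / ν - q / ν := by ring
  rw [e4] at h5
  rw [e5] at hle
  linarith

/-- The optimal points of Lipschitz functions are between the breaching points. -/
lemma Frame.mem_of_isOpt (h : Frame P ν x a b ℓ r) (hν : 0 < ν)
    (hc : ∀ s t, c s - c t ≤ |s - t|) (hconc : ConcaveOn ℝ univ c) {s : ℝ}
    (hs : IsOpt P ν c x a b s) : s ∈ Icc r ℓ := by
  constructor
  · by_contra hlt
    push Not at hlt
    have h1 : IsOpt P ν c x a b r := by
      refine ⟨h.right.1, fun t ht => (hs.2 t ht).trans ?_⟩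
      have h2 := h.right.2 s hs.1
      have h3 := hc s r
      rw [abs_sub_comm, abs_of_pos (by linarith)] at h3
      linarith
    exact hlt.ne (hs.unique h.chart hν hconc h1)
  · by_contra hlt
    push Not at hlt
    have h1 : IsOpt P ν c x a b ℓ := by
      refine ⟨h.left.1, fun t ht => (hs.2 t ht).trans ?_⟩
      have h2 := h.left.2 s hs.1
      have h3 := hc s ℓ
      rw [abs_of_pos (by linarith)] at h3
      linarith
    exact hlt.ne' (hs.unique h.chart hν hconc h1)

lemma cr_dir (u : Plane) (s : ℝ) : cr u (dir P x s) = ‖P.γ s - x‖⁻¹ * cr u (P.γ s - x) :=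
  cr_smul_right _ _ _

/-- Every direction between two others has a component along their sum. -/
lemma Chart.one_add_inner_le (h : Chart P x a b) (hx : x ∉ P.region) {s : ℝ} (hr : r ∈ Icc a b)
    (hℓ : ℓ ∈ Icc a b) (hs : s ∈ Icc r ℓ) :
    1 + ⟪dir P x ℓ, dir P x r⟫ ≤ ⟪dir P x s, dir P x ℓ + dir P x r⟫ := by
  have h1 : ∀ t, ⟪dir P x t, dir P x t⟫ = 1 := fun t => by
    rw [real_inner_self_eq_norm_sq, norm_dir hx, one_pow]
  rw [inner_add_right]
  rcases hs.1.eq_or_lt with rfl | hrs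
  · rw [h1, real_inner_comm, add_comm]
  rcases hs.2.eq_or_lt with rfl | hsl
  · rw [h1]
  obtain ⟨ε, hε, hang⟩ := h.exists_angular hx
  have hsab : s ∈ Icc a b := ⟨hr.1.trans hs.1, hs.2.trans hℓ.2⟩
  have hang' : ∀ t ∈ Icc a b, ∀ t' ∈ Icc a b, t < t' → 0 < ε * cr (dir P x t) (dir P x t') :=
    fun t ht t' ht' hlt => by
      have hp : ∀ t, 0 < ‖P.γ t - x‖⁻¹ := fun t =>
        inv_pos.2 (norm_pos_iff.2 (Chart.γ_sub_ne hx t))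
      rw [cr_dir, dir, cr_smul_left]
      have := mul_pos (mul_pos (hp t) (hp t')) (hang t ht t' ht' hlt)
      linarith
  have k1 := hang' r hr s hsab hrs
  have k2 := hang' s hsab ℓ hℓ hsl
  have k3 := hang' r hr ℓ hℓ (hrs.trans hsl)
  set eR := dir P x r
  set eL := dir P x ℓ
  set e := dir P x s
  -- The coefficients are positive sines. By the triangle inequality those of `eR` and `eL` together
  -- are at least that of `e`.
  have hdec : (ε * cr eR eL) • e = (ε * cr e eL) • eR + (ε * cr eR e) • eL := by
    rw [mul_smul, mul_smul, mul_smul, ← smul_add, cr_smul_decomp]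
  have hc1 : -1 ≤ ⟪eL, eR⟫ := by
    have := abs_real_inner_le_norm eL eR
    rw [norm_dir hx, norm_dir hx, mul_one] at this
    exact (abs_le.1 this).1
  have hnorm : ε * cr eR eL ≤ ε * cr e eL + ε * cr eR e := by
    have h2 := norm_add_le ((ε * cr e eL) • eR) ((ε * cr eR e) • eL)
    rw [← hdec, norm_smul, norm_smul, norm_smul, norm_dir hx, norm_dir hx, norm_dir hx,
      Real.norm_of_nonneg k1.le, Real.norm_of_nonneg k2.le, Real.norm_of_nonneg k3.le] at h2
    linarith
  have hin : (ε * cr eR eL) * (⟪e, eL⟫ + ⟪e, eR⟫) =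
      (ε * cr e eL + ε * cr eR e) * (1 + ⟪eL, eR⟫) := by
    rw [mul_add, ← real_inner_smul_left, ← real_inner_smul_left, hdec, inner_add_left,
      inner_add_left, real_inner_smul_left, real_inner_smul_left, real_inner_smul_left,
      real_inner_smul_left, h1, h1, real_inner_comm eL eR]
    ring
  refine le_of_mul_le_mul_left ?_ k3
  rw [hin]
  exact mul_le_mul_of_nonneg_right hnorm (by linarith)

end Direction

/-! ### The spread and the angle between the breaching directions -/

section Spread

variable {P : Target} {ν : ℝ} {x y : Plane} {a b a' b' ℓ r ℓ' r' : ℝ}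

/-- The difference between the times at which defenders from the two sides meet the intruder. -/
noncomputable def spread (P : Target) (ν : ℝ) (x : Plane) (ℓ r : ℝ) : ℝ :=
  (r + dist (P.γ r) x / ν) - (ℓ - dist (P.γ ℓ) x / ν)

lemma Frame.spread_nonneg (h : Frame P ν x a b ℓ r) (hν : 0 < ν) (hν' : ν ≤ 1) :
    0 ≤ spread P ν x ℓ r := sub_nonneg.2 (h.lam_le_rho hν hν')

lemma Frame.spread_le (h : Frame P ν x a b ℓ r) (h' : Frame P ν y a' b' ℓ' r') (hν : 0 < ν)
    (hν' : ν ≤ 1) {d : ℝ} (hl : Reach P d x a b y a' b') :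
    spread P ν y ℓ' r' ≤ spread P ν x ℓ r + 2 * (d / ν) := by
  have h1 := h.lam_rho_le h' hν hν' hl
  rw [spread, spread]
  linarith [h1.1, h1.2]

/-- The spread is minus the sum of the optimal values for `c s = s` and `c s = -s`, and
`IsOpt.le_of_near` bounds each of them below. -/
lemma Frame.spread_le_of_near (h : Frame P ν x a b ℓ r) (h' : Frame P ν y a' b' ℓ' r')
    (hν : 0 < ν) (hν' : ν ≤ 1) (hx : x ∉ P.region) {θ₀ θ₁ q : ℝ}
    (hθ₀ : θ₀ ∈ Icc a b) (hp₀ : P.γ θ₀ = proj P x) (hθ₁ : θ₁ ∈ Icc a' b')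
    (hp₁ : P.γ θ₁ = proj P y) (hq : 0 < q) (hqx : q < Metric.infDist x P.region)
    (hqL : 4 * q < P.L) (hd : dist x y < q) (hθ : |θ₁ - θ₀| ≤ q) :
    spread P ν y ℓ' r' ≤ spread P ν x ℓ r -
      (⟪y - x, dir P x ℓ + dir P x r⟫ - dist x y ^ 2 / q) / ν := by
  have h1 := h.left.le_of_near hν hν' hx h.chart (c := fun s => s) (fun s t => le_abs_self _)
    hθ₀ hp₀ h'.chart h'.left hθ₁ hp₁ hq hqx hqL hd hθ
  have h2 := h.right.le_of_near hν hν' hx h.chart (c := fun s => -s)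
    (fun s t => by rw [abs_sub_comm]; linarith [le_abs_self (t - s)])
    hθ₀ hp₀ h'.chart h'.right hθ₁ hp₁ hq hqx hqL hd hθ
  have e : (⟪y - x, dir P x ℓ + dir P x r⟫ - dist x y ^ 2 / q) / ν =
      (⟪y - x, dir P x ℓ⟫ - dist x y ^ 2 / (2 * q)) / ν +
      (⟪y - x, dir P x r⟫ - dist x y ^ 2 / (2 * q)) / ν := by
    rw [inner_add_right]; field_simp; ring
  rw [spread, spread, e]
  linarith

/-- The angle between the optimal directions is bounded if the intruder is slow. -/
lemma Frame.le_one_add_inner (h : Frame P ν x a b ℓ r) (hν : 0 < ν) (hx : x ∉ P.region) :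
    2 * (1 - ν) ≤ 1 + ⟪dir P x ℓ, dir P x r⟫ := by
  have h1 := h.left.inner_le h.chart hx hν concaveOn_self continuous_id h.right.1
  have h2 := h.right.inner_le h.chart hx hν concaveOn_neg_self continuous_neg h.left.1
  change _ ≤ ⟪_, dir P x ℓ⟫ at h1
  change _ ≤ ⟪_, dir P x r⟫ at h2
  have n1 : ∀ t, ⟪dir P x t, dir P x t⟫ = 1 := fun t => by
    rw [real_inner_self_eq_norm_sq, norm_dir hx, one_pow]
  have e1 : P.γ r - P.γ ℓ = dist (P.γ r) x • dir P x r - dist (P.γ ℓ) x • dir P x ℓ := by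
    rw [dist_smul_dir hx, dist_smul_dir hx]; abel
  have e2 : P.γ ℓ - P.γ r = dist (P.γ ℓ) x • dir P x ℓ - dist (P.γ r) x • dir P x r := by
    rw [dist_smul_dir hx, dist_smul_dir hx]; abel
  rw [e1, inner_sub_left, real_inner_smul_left, real_inner_smul_left, n1,
    real_inner_comm (dir P x ℓ)] at h1
  rw [e2, inner_sub_left, real_inner_smul_left, real_inner_smul_left, n1] at h2
  have h3 := (le_abs_self _).trans (h.chart.abs_sub_le_dist_add_dist h.right.1 h.left.1)
  have hL : 0 < dist (P.γ ℓ) x := by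
    rw [dist_eq_norm]; exact norm_pos_iff.2 (Chart.γ_sub_ne hx ℓ)
  have hR : 0 < dist (P.γ r) x := by
    rw [dist_eq_norm]; exact norm_pos_iff.2 (Chart.γ_sub_ne hx r)
  set κ := ⟪dir P x ℓ, dir P x r⟫
  -- The sum of the two first-order conditions bounds `1 - κ` times the sum of the two distances by
  -- `2 ν (ℓ - r)`, and `ℓ - r` is at most that sum.
  have h4 := mul_le_mul_of_nonneg_left h3 hν.le
  have h5 : 0 ≤ (dist (P.γ ℓ) x + dist (P.γ r) x) * (1 + κ - 2 * (1 - ν)) := by nlinarith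
  have := nonneg_of_mul_nonneg_right h5 (by linarith)
  linarith

/-- For a fast intruder the breaching points are the ends of the visible part. -/
lemma Frame.eq_ends (h : Frame P 1 x a b ℓ r) : ℓ = b ∧ r = a := by
  have hb : IsOpt P 1 (fun s => s) x a b b := by
    refine ⟨right_mem_Icc.2 h.chart.le, fun s hs => ?_⟩
    have h1 := lipschitz_γ P b s
    have h2 := dist_triangle (P.γ b) (P.γ s) x
    rw [abs_of_nonneg (by linarith [hs.2])] at h1
    simp only [div_one]
    linarith
  have ha : IsOpt P 1 (fun s => -s) x a b a := by
    refine ⟨left_mem_Icc.2 h.chart.le, fun s hs => ?_⟩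
    have h1 := lipschitz_γ P a s
    have h2 := dist_triangle (P.γ a) (P.γ s) x
    rw [abs_sub_comm, abs_of_nonneg (by linarith [hs.1])] at h1
    simp only [div_one]
    linarith
  exact ⟨h.left.unique h.chart one_pos concaveOn_self hb,
    h.right.unique h.chart one_pos concaveOn_neg_self ha⟩

/-- A disk in the target lies in the wedge of the tangents through `x`. -/
lemma Chart.radius_le (h : Chart P x a b) (hx : x ∉ P.region) {ε : ℝ}
    (hang : ∀ s ∈ Icc a b, ∀ s' ∈ Icc a b, s < s' → 0 < ε * cr (P.γ s - x) (P.γ s' - x))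
    (hε : ε ^ 2 = 1) {m : Plane} {ρ : ℝ} (hρ : 0 ≤ ρ) (hm : Metric.closedBall m ρ ⊆ P.region) :
    ρ ≤ ε * cr (dir P x a) (m - x) := by
  have ha : 0 < ‖P.γ a - x‖⁻¹ := inv_pos.2 (norm_pos_iff.2 (Chart.γ_sub_ne hx a))
  have hn := norm_dir hx a
  -- The point of the disk that reaches farthest towards the tangent through `γ a`. It must not lie
  -- beyond that tangent.
  have hy : m - (ε * ρ) • rot (dir P x a) ∈ P.region := hm (by
    rw [Metric.mem_closedBall, dist_eq_norm, sub_sub_cancel_left, norm_neg, norm_smul, norm_rot, hn,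
      mul_one, norm_mul, Real.norm_of_nonneg hρ]
    have : |ε| = 1 := by
      rw [← sq_eq_sq₀ (abs_nonneg _) zero_le_one, sq_abs, hε, one_pow]
    rw [Real.norm_eq_abs, this, one_mul])
  obtain ⟨s, hs, k, hk, he⟩ := h.exists_ray hx hy
  have h1 : 0 ≤ ε * cr (P.γ a - x) (P.γ s - x) := by
    rcases hs.1.eq_or_lt with rfl | hlt
    · rw [cr_self, mul_zero]
    · exact (hang a (left_mem_Icc.2 h.le) s hs hlt).le
  have h2 : 0 ≤ ε * cr (dir P x a) (m - (ε * ρ) • rot (dir P x a) - x) := by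
    rw [he, cr_smul_right, dir, cr_smul_left]
    have := mul_nonneg (mul_nonneg (by linarith : (0 : ℝ) ≤ k) ha.le) h1
    linarith
  rw [show m - (ε * ρ) • rot (dir P x a) - x = (m - x) - (ε * ρ) • rot (dir P x a) by abel,
    cr_sub_right, cr_smul_right, cr_rot_right, real_inner_self_eq_norm_sq, hn] at h2
  have h3 : ε * (ε * ρ * 1 ^ 2) = ρ := by
    calc _ = ε ^ 2 * ρ := by ring
      _ = ρ := by rw [hε, one_mul]
  linarith

/-- The estimate for a triangle with sides `A`, `B` and `q`, where `κ` and `K` are the cosine and the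
sine of the obtuse angle between `A` and `B`. -/
lemma excess_sq_le {c₀ A B q κ K M : ℝ} (hc₀ : 0 < c₀) (hA : 0 < A) (hB : 0 < B) (hq0 : 0 ≤ q)
    (hκ1 : -1 ≤ κ) (hκ : κ ≤ 0) (hq2 : q ^ 2 = A ^ 2 + B ^ 2 - 2 * A * B * κ)
    (hK2 : K ^ 2 = (1 - κ) * (1 + κ)) (hrad : c₀ * q ^ 2 ≤ B * K / 2) (hM0 : 0 ≤ M)
    (hM : M ≤ A + B - q) : 0 < 1 + κ ∧ c₀ ^ 2 * M ^ 2 ≤ 2 * (1 + κ) ^ 3 := by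
  have hprod : 0 ≤ A * B * (-κ) := mul_nonneg (mul_nonneg hA.le hB.le) (by linarith)
  have hBq : B ≤ q := le_of_sq_le_sq (by linarith [sq_nonneg A]) hq0
  have hqpos : 0 < q := hB.trans_le hBq
  have hK0 : 0 ≤ K := by
    have : 0 ≤ B * K := by linarith [mul_nonneg hc₀.le (sq_nonneg q)]
    exact nonneg_of_mul_nonneg_right this hB
  have hcK : c₀ * q ≤ K / 2 := by
    have h1 : B * K ≤ q * K := mul_le_mul_of_nonneg_right hBq hK0
    refine le_of_mul_le_mul_right ?_ hqpos
    calc c₀ * q * q = c₀ * q ^ 2 := by ring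
      _ ≤ K / 2 * q := by linarith
  have hsq : c₀ ^ 2 * q ^ 2 ≤ (1 + κ) / 2 := by
    have h1 : (c₀ * q) ^ 2 ≤ (K / 2) ^ 2 := pow_le_pow_left₀ (by positivity) hcK 2
    rw [div_pow, mul_pow, hK2] at h1
    have h2 : (1 - κ) * (1 + κ) ≤ 2 * (1 + κ) :=
      mul_le_mul_of_nonneg_right (by linarith) (by linarith)
    linarith
  have hpos : 0 < 1 + κ := by
    have : 0 < c₀ ^ 2 * q ^ 2 := by positivity
    linarith
  refine ⟨hpos, ?_⟩
  -- The law of cosines gives `A + B - q = 2 A B (1 + κ) / (A + B + q)`. Together with `c₀ ^ 2 * q ^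
  -- 2 ≤ (1 + κ) / 2` this yields the cube.
  have hM' : M ≤ 2 * q * (1 + κ) := by
    refine hM.trans (le_of_mul_le_mul_right ?_ (by linarith : 0 < A + B + q))
    have h4 : A * B ≤ q * (A + B + q) := by
      have h5 : A * B ≤ A * q := mul_le_mul_of_nonneg_left hBq hA.le
      have h6 : 0 ≤ q * (B + q) := by positivity
      linarith
    calc (A + B - q) * (A + B + q) = A ^ 2 + B ^ 2 + 2 * (A * B) - q ^ 2 := by ring
      _ = (2 * (1 + κ)) * (A * B) := by rw [hq2]; ring
      _ ≤ (2 * (1 + κ)) * (q * (A + B + q)) := mul_le_mul_of_nonneg_left h4 (by linarith)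
      _ = 2 * q * (1 + κ) * (A + B + q) := by ring
  calc c₀ ^ 2 * M ^ 2 ≤ c₀ ^ 2 * (2 * q * (1 + κ)) ^ 2 := by gcongr
    _ = 4 * (c₀ ^ 2 * q ^ 2) * (1 + κ) ^ 2 := by ring
    _ ≤ 4 * ((1 + κ) / 2) * (1 + κ) ^ 2 := by gcongr
    _ = 2 * (1 + κ) ^ 3 := by ring

/-- In the case of a strongly convex target the spread is controlled by the angle between the
optimal directions. -/
lemma Frame.spread_sq_le (h : Frame P 1 x a b ℓ r) (hx : x ∉ P.region) {c₀ : ℝ} (hc₀ : 0 < c₀)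
    (hsc : ∀ p ∈ P.region, ∀ q ∈ P.region,
      Metric.closedBall (midpoint ℝ p q) (c₀ * dist p q ^ 2) ⊆ P.region)
    (hneg : ⟪dir P x ℓ, dir P x r⟫ ≤ 0) :
    0 < 1 + ⟪dir P x ℓ, dir P x r⟫ ∧
      c₀ ^ 2 * spread P 1 x ℓ r ^ 2 ≤ 2 * (1 + ⟪dir P x ℓ, dir P x r⟫) ^ 3 := by
  obtain ⟨rfl, rfl⟩ := h.eq_ends
  have hM0 := h.spread_nonneg one_pos le_rfl
  obtain ⟨ε, hε, hang⟩ := h.chart.exists_angular hx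
  have hrad := h.chart.radius_le hx hang hε (by positivity) (hsc _ (γ_mem P r) _ (γ_mem P ℓ))
  have n1 := norm_dir hx r
  have n2 := norm_dir hx ℓ
  have d1 := dist_smul_dir hx r
  have d2 := dist_smul_dir hx ℓ
  have hR : 0 < dist (P.γ r) x := by
    rw [dist_eq_norm]; exact norm_pos_iff.2 (Chart.γ_sub_ne hx r)
  have hL : 0 < dist (P.γ ℓ) x := by
    rw [dist_eq_norm]; exact norm_pos_iff.2 (Chart.γ_sub_ne hx ℓ)
  have hcr := cr_sq_add_inner_sq (dir P x r) (dir P x ℓ)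
  rw [n1, n2, real_inner_comm] at hcr
  have hmid : midpoint ℝ (P.γ r) (P.γ ℓ) - x =
      (1 / 2 : ℝ) • (dist (P.γ r) x • dir P x r + dist (P.γ ℓ) x • dir P x ℓ) := by
    rw [d1, d2, midpoint_eq_smul_add, invOf_eq_inv]; module
  rw [hmid, cr_smul_right, cr_add_right, cr_smul_right, cr_smul_right, cr_self] at hrad
  have hq2 : dist (P.γ r) (P.γ ℓ) ^ 2 = dist (P.γ r) x ^ 2 + dist (P.γ ℓ) x ^ 2 -
      2 * dist (P.γ r) x * dist (P.γ ℓ) x * ⟪dir P x ℓ, dir P x r⟫ := by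
    rw [dist_eq_norm (P.γ r) (P.γ ℓ), show P.γ r - P.γ ℓ =
      dist (P.γ r) x • dir P x r - dist (P.γ ℓ) x • dir P x ℓ by rw [d1, d2]; abel,
      norm_sub_sq_real, norm_smul, norm_smul, n1, n2, real_inner_smul_left,
      real_inner_smul_right, real_inner_comm, Real.norm_of_nonneg hR.le,
      Real.norm_of_nonneg hL.le]
    ring
  have hκ1 : -1 ≤ ⟪dir P x ℓ, dir P x r⟫ := by
    have := abs_real_inner_le_norm (dir P x ℓ) (dir P x r)
    rw [n1, n2, mul_one] at this
    exact (abs_le.1 this).1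
  have harc : dist (P.γ r) (P.γ ℓ) ≤ ℓ - r := by
    have := lipschitz_γ P r ℓ
    rwa [abs_sub_comm, abs_of_nonneg (by linarith [h.chart.le])] at this
  refine excess_sq_le (K := ε * cr (dir P x r) (dir P x ℓ)) hc₀ hR hL dist_nonneg hκ1 hneg hq2 ?_ ?_
    hM0 ?_
  · rw [mul_pow, hε]; linarith
  · linarith
  · rw [spread, div_one, div_one]; linarith

end Spread

end PerimeterDefense

namespace PerimeterDefense

open Filter Topology RealInnerProductSpace

/-! ### A differential inequality with extinction in finite time -/

section Decay

/-- A nonnegative function cannot satisfy `M' ≤ -k M ^ (2 / 3)`, with a negative right-hand side,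
for a long time. -/
lemma false_of_decay {M : ℝ → ℝ} {c k K : ℝ} (hk : 0 < k) (hc : 0 < c) (h0 : M 0 ≤ c ^ 3)
    (hM : ∀ t ∈ Icc 0 (3 * c / k + 1), 0 ≤ M t)
    (hlip : ∀ t ∈ Icc 0 (3 * c / k + 1), ∀ t' ∈ Icc 0 (3 * c / k + 1),
      |M t - M t'| ≤ K * |t - t'|)
    (hd : ∀ᵐ t, t ∈ Ioo 0 (3 * c / k + 1) → ∃ ρ > 0, (M t ≤ M 0 → k ^ 3 * M t ^ 2 ≤ ρ ^ 3) ∧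
      ∀ ε > 0, ∀ᶠ h in 𝓝[>] (0 : ℝ), M (t + h) ≤ M t - (ρ - ε) * h) : False := by
  -- The time at which `(c - k t / 3) ^ 3`, the solution of `q' = -k q ^ (2 / 3)` with `q 0 = c ^
  -- 3`, reaches zero. The additional unit of time gives the contradiction, as the rate `ρ` is
  -- positive even where the function vanishes.
  set S := 3 * c / k
  have hS : 0 < S := by positivity
  have hkS : k / 3 * S = c := by simp only [S]; field_simp
  have hmono : ∀ t₀ ∈ Icc 0 (S + 1), ∀ t₁ ∈ Icc 0 (S + 1), t₀ ≤ t₁ → M t₁ ≤ M t₀ := by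
    intro t₀ ht₀ t₁ ht₁ hle
    have hsub : Icc t₀ t₁ ⊆ Icc 0 (S + 1) := Icc_subset_Icc ht₀.1 ht₁.2
    have := le_sub_of_ae_lower_derivative (f := fun t => -M t) (c := 0) (K := K) hle
      (fun t ht t' ht' => by
        rw [neg_sub_neg, abs_sub_comm]
        exact hlip t (hsub ht) t' (hsub ht')) (by
        filter_upwards [hd] with t ht hmem ε hε
        obtain ⟨ρ, hρ, -, hd⟩ := ht ⟨ht₀.1.trans_lt hmem.1, hmem.2.trans_le ht₁.2⟩
        filter_upwards [hd ε hε, self_mem_nhdsWithin] with h h1 h2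
        have h3 : 0 < h := h2
        have := mul_pos hρ h3
        linarith)
    linarith
  have hm0 : (0 : ℝ) ∈ Icc 0 (S + 1) := ⟨le_rfl, by linarith⟩
  have hmS : S ∈ Icc 0 (S + 1) := ⟨hS.le, by linarith⟩
  have hcont : ContinuousOn M (Icc 0 (S + 1)) := (LipschitzOnWith.of_dist_le_mul (K := K.toNNReal)
    fun t ht t' ht' => by
      rw [Real.dist_eq, Real.dist_eq]
      exact (hlip t ht t' ht').trans
        (mul_le_mul_of_nonneg_right (Real.le_coe_toNNReal K) (abs_nonneg _))).continuousOn
  have hzero : M S ≤ 0 := by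
    by_contra hpos
    push Not at hpos
    set q : ℝ → ℝ := fun t => (c - k / 3 * t) ^ 3
    have hq : Continuous q := by fun_prop
    have hqS : q S = 0 := by simp only [q, hkS, sub_self]; norm_num
    have hf : ContinuousOn (fun t => q t - M t) (Icc 0 S) :=
      hq.continuousOn.sub (hcont.mono (Icc_subset_Icc_right (by linarith)))
    have hcpt : IsCompact (Icc 0 S ∩ (fun t => q t - M t) ⁻¹' Ici 0) :=
      isCompact_Icc.of_isClosed_subset (hf.preimage_isClosed_of_isClosed isClosed_Icc isClosed_Ici)
        inter_subset_left
    -- After the last time `t₀` at which `M ≤ q`, the larger `M` decreases at least as fast as `q`,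
    -- so `q - M` cannot become negative.
    obtain ⟨t₀, ⟨ht₀, hft₀⟩, hmax⟩ := hcpt.exists_isGreatest
      ⟨0, ⟨le_rfl, hS.le⟩, by
        simp only [q, mem_preimage, mem_Ici, mul_zero, sub_zero]; linarith⟩
    have hft₀' : 0 ≤ q t₀ - M t₀ := hft₀
    have hlt : ∀ t ∈ Ioc t₀ S, q t < M t := fun t ht => by
      by_contra hle
      exact absurd (hmax ⟨⟨ht₀.1.trans ht.1.le, ht.2⟩, sub_nonneg.2 (not_lt.1 hle)⟩)
        (not_le.2 ht.1)
    have hy : ∀ t ∈ Icc t₀ S, 0 ≤ c - k / 3 * t ∧ c - k / 3 * t ≤ c := fun t ht => by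
      have h1 : k / 3 * t ≤ k / 3 * S := mul_le_mul_of_nonneg_left ht.2 (by positivity)
      have h2 : 0 ≤ k / 3 * t := mul_nonneg (by positivity) (ht₀.1.trans ht.1)
      constructor <;> linarith
    have hqlip : ∀ t ∈ Icc t₀ S, ∀ t' ∈ Icc t₀ S, |q t - q t'| ≤ 3 * c ^ 2 * (k / 3) * |t - t'| := by
      intro t ht t' ht'
      obtain ⟨a1, a2⟩ := hy t ht
      obtain ⟨b1, b2⟩ := hy t' ht'
      have e : q t - q t' = ((c - k / 3 * t) ^ 2 + (c - k / 3 * t) * (c - k / 3 * t') +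
          (c - k / 3 * t') ^ 2) * (k / 3) * (t' - t) := by simp only [q]; ring
      rw [e, abs_mul, abs_sub_comm t' t, abs_of_nonneg (by positivity)]
      have h1 : (c - k / 3 * t) ^ 2 ≤ c ^ 2 := pow_le_pow_left₀ a1 a2 2
      have h2 : (c - k / 3 * t') ^ 2 ≤ c ^ 2 := pow_le_pow_left₀ b1 b2 2
      have h3 : (c - k / 3 * t) * (c - k / 3 * t') ≤ c * c := mul_le_mul a2 b2 b1 hc.le
      gcongr
      linarith
    have := le_sub_of_ae_lower_derivative (f := fun t => q t - M t) (c := 0)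
      (K := 3 * c ^ 2 * (k / 3) + K) ht₀.2
      (fun t ht t' ht' => by
        have h1 := hqlip t ht t' ht'
        have h2 := hlip t ⟨ht₀.1.trans ht.1, by linarith [ht.2]⟩ t'
          ⟨ht₀.1.trans ht'.1, by linarith [ht'.2]⟩
        have h3 := abs_sub (q t - q t') (M t - M t')
        rw [show q t - M t - (q t' - M t') = q t - q t' - (M t - M t') by ring, add_mul]
        linarith) (by
        filter_upwards [hd] with t ht hmem ε hε
        have htS : t ∈ Icc 0 (S + 1) := ⟨ht₀.1.trans hmem.1.le, by linarith [hmem.2]⟩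
        obtain ⟨ρ, hρ, hρM, hd⟩ := ht ⟨ht₀.1.trans_lt hmem.1, by linarith [hmem.2]⟩
        have h1 := hρM (hmono 0 hm0 t htS htS.1)
        obtain ⟨hy0, -⟩ := hy t ⟨hmem.1.le, hmem.2.le⟩
        have hqM := hlt t ⟨hmem.1, hmem.2.le⟩
        have hyρ : k * (c - k / 3 * t) ^ 2 ≤ ρ := by
          refine le_of_pow_le_pow_left₀ three_ne_zero hρ.le (le_trans ?_ h1)
          have h2 : q t ^ 2 ≤ M t ^ 2 := pow_le_pow_left₀ (by positivity) hqM.le 2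
          calc (k * (c - k / 3 * t) ^ 2) ^ 3 = k ^ 3 * q t ^ 2 := by simp only [q]; ring
            _ ≤ k ^ 3 * M t ^ 2 := by gcongr
        have hqd : HasDerivAt q (-(k * (c - k / 3 * t) ^ 2)) t := by
          have := (((hasDerivAt_id t).const_mul (k / 3)).const_sub c).pow 3
          refine this.congr_deriv ?_
          simp; ring
        have h3 : ∀ᶠ h in 𝓝[>] (0 : ℝ),
            ‖q (t + h) - q t - h • -(k * (c - k / 3 * t) ^ 2)‖ ≤ ε / 2 * ‖h‖ :=
          ((hasDerivAt_iff_isLittleO_nhds_zero.1 hqd).def (half_pos hε)).filter_mono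
            nhdsWithin_le_nhds
        filter_upwards [hd (ε / 2) (half_pos hε), h3, self_mem_nhdsWithin] with h k1 k2 k3
        have hpos : 0 < h := k3
        rw [Real.norm_of_nonneg hpos.le, Real.norm_eq_abs, smul_eq_mul] at k2
        have k4 := (abs_le.1 k2).1
        have k5 := mul_le_mul_of_nonneg_right hyρ hpos.le
        linarith)
    have h3 : M S ≤ q S := by linarith
    rw [hqS] at h3
    linarith
  have hae : ∀ᵐ t, t ∉ Ioo S (S + 1) := by
    filter_upwards [hd] with t ht hmem
    obtain ⟨ρ, hρ, -, hd⟩ := ht ⟨hS.trans hmem.1, hmem.2⟩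
    have h1 := hmono S hmS t ⟨(hS.trans hmem.1).le, hmem.2.le⟩ hmem.1.le
    obtain ⟨h, k1, k2⟩ := ((hd (ρ / 2) (half_pos hρ)).and
      (Ioo_mem_nhdsGT (sub_pos.2 hmem.2))).exists
    have h2 := hM (t + h) ⟨by linarith [k2.1, hmem.1], by linarith [k2.2]⟩
    have h3 := mul_pos (half_pos hρ) k2.1
    linarith
  have h1 := measure_eq_zero_iff_ae_notMem.2 hae
  rw [Real.volume_Ioo] at h1
  norm_num at h1

end Decay

/-! ### The feedback strategy reaches the target in finite time -/

section Spread

variable {P : Target} {ν : ℝ}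

/-- A slow intruder has a uniform rate, which suffices since the spread is bounded by `M₀`. For `ν =
1` strong convexity handles obtuse angles, and for acute ones `1 + κ` exceeds one. -/
lemma exists_spread_rate (hν : 0 < ν) (hν' : ν ≤ 1) (hsc : ν < 1 ∨ StronglyConvexSet P.region)
    {M₀ : ℝ} (hM₀ : 0 ≤ M₀) : ∃ k > 0, ∀ x a b ℓ r, x ∉ P.region → Frame P ν x a b ℓ r →
      0 < 1 + ⟪dir P x ℓ, dir P x r⟫ ∧
      (spread P ν x ℓ r ≤ M₀ → k ^ 3 * spread P ν x ℓ r ^ 2 ≤ (1 + ⟪dir P x ℓ, dir P x r⟫) ^ 3) := by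
  suffices hδ : ∃ δ > 0, ∀ x a b ℓ r, x ∉ P.region → Frame P ν x a b ℓ r →
      0 < 1 + ⟪dir P x ℓ, dir P x r⟫ ∧ (spread P ν x ℓ r ≤ M₀ →
        δ * spread P ν x ℓ r ^ 2 ≤ (1 + ⟪dir P x ℓ, dir P x r⟫) ^ 3) by
    obtain ⟨δ, hδ, h⟩ := hδ
    refine ⟨min 1 δ, lt_min one_pos hδ, fun x a b ℓ r hx hf => ⟨(h x a b ℓ r hx hf).1, fun hM =>
      le_trans (mul_le_mul_of_nonneg_right ?_ (sq_nonneg _)) ((h x a b ℓ r hx hf).2 hM)⟩⟩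
    exact (pow_le_of_le_one (lt_min one_pos hδ).le (min_le_left _ _) three_ne_zero).trans
      (min_le_right _ _)
  have hsq : ∀ {x a b ℓ r}, Frame P ν x a b ℓ r → spread P ν x ℓ r ≤ M₀ →
      spread P ν x ℓ r ^ 2 ≤ (M₀ + 1) ^ 2 := fun hf hM =>
    pow_le_pow_left₀ (hf.spread_nonneg hν hν') (by linarith) 2
  by_cases hlt : ν < 1
  · have h1 : 0 < 2 * (1 - ν) := by linarith
    refine ⟨(2 * (1 - ν)) ^ 3 / (M₀ + 1) ^ 2, by positivity, fun x a b ℓ r hx hf => ?_⟩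
    have h2 := hf.le_one_add_inner hν hx
    refine ⟨h1.trans_le h2, fun hM => ?_⟩
    calc _ ≤ (2 * (1 - ν)) ^ 3 / (M₀ + 1) ^ 2 * (M₀ + 1) ^ 2 :=
          mul_le_mul_of_nonneg_left (hsq hf hM) (by positivity)
      _ = (2 * (1 - ν)) ^ 3 := div_mul_cancel₀ _ (by positivity)
      _ ≤ _ := by gcongr
  · obtain rfl : ν = 1 := le_antisymm hν' (not_lt.1 hlt)
    obtain ⟨c₀, hc₀, hball⟩ := hsc.resolve_left hlt
    refine ⟨min (c₀ ^ 2 / 2) (1 / (M₀ + 1) ^ 2), by positivity, fun x a b ℓ r hx hf => ?_⟩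
    rcases le_or_gt ⟪dir P x ℓ, dir P x r⟫ 0 with hle | hgt
    · obtain ⟨h1, h2⟩ := hf.spread_sq_le hx hc₀ hball hle
      refine ⟨h1, fun _ => (mul_le_mul_of_nonneg_right (min_le_left _ _) (sq_nonneg _)).trans ?_⟩
      linarith
    · refine ⟨by linarith, fun hM => ?_⟩
      calc _ ≤ 1 / (M₀ + 1) ^ 2 * (M₀ + 1) ^ 2 :=
            mul_le_mul (min_le_right _ _) (hsq hf hM) (sq_nonneg _) (by positivity)
        _ = 1 := div_mul_cancel₀ _ (by positivity)
        _ ≤ _ := one_le_pow₀ (by linarith)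

/-- The decrease of the spread while the intruder heads for a point between the breaching
points. -/
lemma Frame.spread_upper_derivative {θ ca cb cl cr : ℝ → ℝ} {X : ℝ → Plane} {t T s : ℝ}
    (hν : 0 < ν) (hν' : ν ≤ 1) (hlip : ∀ t t', dist (X t) (X t') ≤ ν * |t - t'|)
    (ht : t ∈ Ico 0 T) (hX : X t ∉ P.region)
    (hf : ∀ τ ∈ Icc 0 T, Frame P ν (X τ) (ca τ) (cb τ) (cl τ) (cr τ))
    (hθ : ContinuousOn θ (Icc 0 T)) (hθm : ∀ τ ∈ Icc 0 T, θ τ ∈ Icc (ca τ) (cb τ))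
    (hθp : ∀ τ ∈ Icc 0 T, P.γ (θ τ) = proj P (X τ)) (hs : s ∈ Icc (cr t) (cl t))
    (hd : HasDerivAt X (ν • dir P (X t) s) t) {ε : ℝ} (hε : 0 < ε) :
    ∀ᶠ h in 𝓝[>] (0 : ℝ), spread P ν (X (t + h)) (cl (t + h)) (cr (t + h)) ≤
      spread P ν (X t) (cl t) (cr t) -
        (1 + ⟪dir P (X t) (cl t), dir P (X t) (cr t)⟫ - ε) * h := by
  have htI : t ∈ Icc 0 T := ⟨ht.1, ht.2.le⟩
  have hft := hf t htI
  have hpos : 0 < Metric.infDist (X t) P.region :=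
    (P.isCompact_region.isClosed.notMem_iff_infDist_pos
      ⟨_, interior_subset P.interior_nonempty.some_mem⟩).1 hX
  have hLpos := P.L_pos
  obtain ⟨q, hq, hqx, hqL⟩ : ∃ q > 0, q < Metric.infDist (X t) P.region ∧ 4 * q < P.L := by
    refine ⟨min (Metric.infDist (X t) P.region / 2) (P.L / 8), by positivity, ?_, ?_⟩
    · linarith [min_le_left (Metric.infDist (X t) P.region / 2) (P.L / 8)]
    · linarith [min_le_right (Metric.infDist (X t) P.region / 2) (P.L / 8)]
  have hin := hft.chart.one_add_inner_le hX hft.right.1 hft.left.1 hs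
  set w := dir P (X t) (cl t) + dir P (X t) (cr t)
  have hw : ‖w‖ ≤ 2 := by
    refine (norm_add_le _ _).trans ?_
    rw [norm_dir hX, norm_dir hX]; norm_num
  have h3 : ∀ᶠ h in 𝓝[>] (0 : ℝ),
      ‖X (t + h) - X t - h • ν • dir P (X t) s‖ ≤ ν * ε / 4 * ‖h‖ :=
    ((hasDerivAt_iff_isLittleO_nhds_zero.1 hd).def (by positivity)).filter_mono nhdsWithin_le_nhds
  -- The bound `q * ε / 2` makes the quadratic error at most half of the allowance `ν ε h`; the
  -- error of differentiation takes the other half, since `‖w‖ ≤ 2`.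
  have hδ : 0 < min (T - t) (min q (q * ε / 2)) := by
    have := sub_pos.2 ht.2
    positivity
  filter_upwards [h3, Ioo_mem_nhdsGT hδ] with h k3 k4
  have hh : 0 < h := k4.1
  have k5 := k4.2.trans_le (min_le_left _ _)
  have k6 := (k4.2.trans_le (min_le_right _ _)).trans_le (min_le_left _ _)
  have k7 := (k4.2.trans_le (min_le_right _ _)).trans_le (min_le_right _ _)
  have hthI : t + h ∈ Icc 0 T := ⟨by linarith [ht.1], by linarith⟩
  have hνh : ν * h ≤ h := by nlinarith
  have hdX : dist (X t) (X (t + h)) ≤ ν * h := by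
    have := hlip t (t + h)
    rwa [sub_add_cancel_left, abs_neg, abs_of_pos hh] at this
  have hθd : |θ (t + h) - θ t| ≤ ν * (t + h - t) :=
    dist_proj_lift_le (Z := X) (by linarith) hν.le (fun τ _ τ' _ => hlip τ τ')
      (hθ.mono (Icc_subset_Icc ht.1 hthI.2))
      (fun τ hτ => hθp τ ⟨ht.1.trans hτ.1, hτ.2.trans hthI.2⟩)
  rw [add_sub_cancel_left] at hθd
  have hle := hft.spread_le_of_near (hf _ hthI) hν hν' hX (hθm t htI) (hθp t htI) (hθm _ hthI)
    (hθp _ hthI) hq hqx hqL (by linarith) (by linarith)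
  refine hle.trans (sub_le_sub_left ?_ _)
  rw [le_div_iff₀ hν]
  have e1 : ⟪X (t + h) - X t, w⟫ = h * (ν * ⟪dir P (X t) s, w⟫) +
      ⟪X (t + h) - X t - h • ν • dir P (X t) s, w⟫ := by
    rw [← real_inner_smul_left, ← real_inner_smul_left, ← inner_add_left, add_sub_cancel]
  have e2 := (abs_le.1 (abs_real_inner_le_norm (X (t + h) - X t - h • ν • dir P (X t) s) w)).1
  rw [Real.norm_of_nonneg hh.le] at k3
  have e3 : ‖X (t + h) - X t - h • ν • dir P (X t) s‖ * ‖w‖ ≤ ν * ε / 4 * h * 2 :=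
    mul_le_mul k3 hw (norm_nonneg _) (by positivity)
  have e4 : dist (X t) (X (t + h)) ^ 2 / q ≤ ν * h * ε / 2 := by
    rw [div_le_iff₀ hq]
    calc dist (X t) (X (t + h)) ^ 2 ≤ (ν * h) ^ 2 := pow_le_pow_left₀ dist_nonneg hdX 2
      _ = ν * h * (ν * h) := by ring
      _ ≤ ν * h * (q * ε / 2) := by gcongr; linarith
      _ = _ := by ring
  have e5 := mul_le_mul_of_nonneg_left hin (mul_nonneg hν.le hh.le)
  rw [e1]
  linarith

/-- The feedback strategy leads to the target in finite time. -/
lemma IsFeedbackResponse.exists_mem {a₁ a₂ : ℝ} {x₀ : Plane} {ω : DefenderControl}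
    {u : IntruderControl ν} (hu : IsFeedbackResponse P ν a₁ a₂ x₀ ω u) (hν : 0 < ν) (hν' : ν ≤ 1)
    (hx₀ : x₀ ∉ interior P.region) (hm : 0 < margin P ν a₁ a₂ x₀)
    (hsc : ν < 1 ∨ StronglyConvexSet P.region) :
    ∃ t, 0 ≤ t ∧ position x₀ u.1 t ∈ P.region := by
  by_contra hcon
  push Not at hcon
  have hmot := motion_position a₁ a₂ x₀ ω u
  have hlip := hmot.lip
  have hXc := hmot.continuous
  have hne := hu.neverEnds hν hν' hx₀ hm hcon
  have hmar := fun T hT => hu.le_margin hν hν' hx₀ hm (T := T) hT fun t ht => hcon t ht.1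
  have hder := ae_hasDerivAt_position u.2.1 u.2.2 x₀
  have hfb : ∀ᵐ t, 0 ≤ t → HasDerivAt (position x₀ u.1) (intruderFeedback P ν
      (position a₁ ω.1.1 t) (position a₂ ω.1.2 t) (position x₀ u.1 t)) t := by
    filter_upwards [hu, hder] with t h1 h2 ht
    rw [← h1 ht (hne t ht)]
    exact h2
  set X := position x₀ u.1
  have hint : ∀ t, 0 ≤ t → X t ∉ interior P.region := fun t ht hi =>
    hcon t ht (interior_subset hi)
  obtain ⟨a, b, ℓ, r, h⟩ := exists_frame (P := P) ν (hint 0 le_rfl)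
  have hM₀ := h.spread_nonneg hν hν'
  set M₀ := spread P ν (X 0) ℓ r
  obtain ⟨k, hk, hrate⟩ := exists_spread_rate hν hν' hsc hM₀
  have hc : 0 < M₀ + 1 := by linarith
  set T := 3 * (M₀ + 1) / k + 1 with hTdef
  have hT : 0 ≤ T := by positivity
  obtain ⟨θ₀, hθ₀, hp0⟩ := exists_lift_mem_chart h.chart
  obtain ⟨θ, hθ, hθ0, hθp⟩ := exists_path_lift hT hXc.continuousOn (fun t ht => hint t ht.1) hp0
  have hex : ∀ t, ∃ a' b' ℓ' r', t ∈ Icc 0 T → Frame P ν (X t) a' b' ℓ' r' ∧ θ t ∈ Icc a' b' := by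
    intro t
    by_cases ht : t ∈ Icc 0 T
    · obtain ⟨a', b', ℓ', r', hf⟩ := exists_frame_mem ν (hint t ht.1) (hθp t ht)
      exact ⟨a', b', ℓ', r', fun _ => hf⟩
    · exact ⟨0, 0, 0, 0, fun h => absurd h ht⟩
  choose ca cb cl cr hf using hex
  set M := fun t => spread P ν (X t) (cl t) (cr t)
  have hlink : ∀ t ∈ Icc 0 T, ∀ t' ∈ Icc 0 T, t ≤ t' →
      Linked P (ν * (t' - t)) (X t) (ca t) (cb t) (X t') (ca t') (cb t') := fun t ht t' ht' hle =>
    linked_of_path hle hν.le (fun τ _ τ' _ => hlip τ τ')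
      (hθ.mono (Icc_subset_Icc ht.1 ht'.2)) (fun τ hτ => hθp τ ⟨ht.1.trans hτ.1, hτ.2.trans ht'.2⟩)
      (hf t ht).1.chart (hf t ht).2 (hf t' ht').1.chart (hf t' ht').2
  have hMlip' : ∀ t ∈ Icc 0 T, ∀ t' ∈ Icc 0 T, t ≤ t' → |M t - M t'| ≤ 2 * (t' - t) :=
    fun t ht t' ht' hle => by
      have hl := hlink t ht t' ht' hle
      have h1 := (hf t ht).1.spread_le (hf t' ht').1 hν hν' hl.1
      have h2 := (hf t' ht').1.spread_le (hf t ht).1 hν hν' hl.2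
      rw [mul_div_cancel_left₀ _ hν.ne'] at h1 h2
      rw [abs_le]
      constructor <;> linarith
  have hMlip : ∀ t ∈ Icc 0 T, ∀ t' ∈ Icc 0 T, |M t - M t'| ≤ 2 * |t - t'| := by
    intro t ht t' ht'
    rcases le_total t t' with hle | hle
    · rw [abs_sub_comm t, abs_of_nonneg (sub_nonneg.2 hle)]
      exact hMlip' t ht t' ht' hle
    · rw [abs_sub_comm, abs_of_nonneg (sub_nonneg.2 hle)]
      exact hMlip' t' ht' t ht hle
  have m0 : (0 : ℝ) ∈ Icc 0 T := left_mem_Icc.2 hT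
  have hM0 : M 0 ≤ M₀ := by
    have h00 := linked_of_path le_rfl hν.le (fun τ _ τ' _ => hlip τ τ')
      (hθ.mono (Icc_subset_Icc_right hT)) (fun τ hτ => hθp τ ⟨hτ.1, hτ.2.trans hT⟩) h.chart
      (hθ0 ▸ hθ₀) (hf 0 m0).1.chart (hf 0 m0).2
    have := h.spread_le (hf 0 m0).1 hν hν' h00.1
    rwa [sub_self, mul_zero, zero_div, mul_zero, add_zero] at this
  refine false_of_decay (M := M) (K := 2) hk hc (hM0.trans ?_)
    (fun t ht => (hf t ht).1.spread_nonneg hν hν') hMlip ?_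
  · have : M₀ + 1 ≤ (M₀ + 1) ^ 3 := le_self_pow₀ (by linarith) three_ne_zero
    linarith
  filter_upwards [hfb] with t ht hmem
  have htI := Ioo_subset_Icc_self hmem
  have hX := hcon t hmem.1.le
  obtain ⟨h1, h2⟩ := hrate _ _ _ _ _ hX (hf t htI).1
  refine ⟨_, h1, fun hle => h2 (hle.trans hM0), fun ε hε => ?_⟩
  -- The tent is concave and 1-Lipschitz, so the point headed for lies between the two breaching
  -- points and the decay estimate applies.
  obtain ⟨A, B, s, hs, -, he⟩ := (hf t htI).1.exists_intruderFeedback_eq hν hν'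
    (hm.trans_le (hmar t hmem.1.le))
  have hd := ht hmem.1.le
  rw [he] at hd
  exact Frame.spread_upper_derivative hν hν' hlip ⟨hmem.1.le, hmem.2⟩ hX (fun τ hτ => (hf τ hτ).1)
    hθ (fun τ hτ => (hf τ hτ).2) hθp
    ((hf t htI).1.mem_of_isOpt hν (tent_sub_le A B) (concaveOn_tent A B) hs) hd hε

end Spread

end PerimeterDefense

theorem mainTheorem5 (P : PerimeterDefense.Target) (ν : ℝ) (hν : 0 < ν) (hν' : ν ≤ 1)
    (si sj : ℝ) (xA : PerimeterDefense.Plane)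
    (hx : xA ∈ PerimeterDefense.intruderWinning P ν si sj) :
    -- no deviation of the intruder from its strategy is profitable
    (∀ u : PerimeterDefense.IntruderControl ν,
      PerimeterDefense.payoff P ν si sj xA PerimeterDefense.pincer u ≤
        PerimeterDefense.Vij P ν si sj xA) ∧
    -- no deviation of the defenders from the pincer maneuver is profitable
    (∀ ω : PerimeterDefense.DefenderControl,
      (∃ u, PerimeterDefense.IsFeedbackResponse P ν si sj xA ω u) ∧
      ∀ u, PerimeterDefense.IsFeedbackResponse P ν si sj xA ω u →
        PerimeterDefense.Vij P ν si sj xA ≤ PerimeterDefense.payoff P ν si sj xA ω u ∨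
        (ν = 1 ∧ ¬ PerimeterDefense.StronglyConvexSet P.region ∧
          PerimeterDefense.NeverEnds P ν si sj xA ω u)) ∧
    -- the payoff if both sides use their strategies
    (∀ u, PerimeterDefense.IsFeedbackResponse P ν si sj xA PerimeterDefense.pincer u →
      PerimeterDefense.payoff P ν si sj xA PerimeterDefense.pincer u =
        PerimeterDefense.Vij P ν si sj xA) ∧
    -- the value of the game
    PerimeterDefense.IsGameValue P ν si sj xA (PerimeterDefense.Vij P ν si sj xA) := by
  have hV := PerimeterDefense.margin_eq_Vij hν hν' hx.1 hx.2
  have hm : 0 < PerimeterDefense.margin P ν si sj xA := by rw [hV]; exact hx.2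
  have hdef : ∀ ω u, PerimeterDefense.IsFeedbackResponse P ν si sj xA ω u →
      PerimeterDefense.Vij P ν si sj xA ≤ PerimeterDefense.payoff P ν si sj xA ω u ∨
      (ν = 1 ∧ ¬ PerimeterDefense.StronglyConvexSet P.region ∧
        PerimeterDefense.NeverEnds P ν si sj xA ω u) := by
    intro ω u hu
    rw [← hV]
    -- A response that reaches the target secures the margin. One that never does is never captured
    -- either, and `IsFeedbackResponse.exists_mem` leaves only the exceptional case.
    by_cases hex : ∃ t, 0 ≤ t ∧ PerimeterDefense.position xA u.1 t ∈ P.region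
    · exact Or.inl (hu.le_payoff hν hν' hx.1.1 hm hex)
    · have hnot : ¬ (ν < 1 ∨ PerimeterDefense.StronglyConvexSet P.region) := fun h =>
        hex (hu.exists_mem hν hν' hx.1.1 hm h)
      rw [not_or] at hnot
      push Not at hex
      exact Or.inr ⟨le_antisymm hν' (not_lt.1 hnot.1), hnot.2,
        hu.neverEnds hν hν' hx.1.1 hm hex⟩
  refine ⟨PerimeterDefense.payoff_pincer_le hν hν' hx,
    fun ω => ⟨PerimeterDefense.exists_isFeedbackResponse hν hν' hm ω, hdef ω⟩,
    fun u hu => le_antisymm (PerimeterDefense.payoff_pincer_le hν hν' hx u) ?_,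
    PerimeterDefense.isGameValue_Vij hν hν' hx⟩
  exact (hdef _ u hu).resolve_right fun h =>
    PerimeterDefense.not_neverEnds_pincer hν hν' hx.1 u h.2.2
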